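/- \textbf{Conventions.} For $d\ge 1$ let $\mathcal P_d(\mathbb R)$ be the set of monic real polynomials of degree $d$ all of whose roots are real. Write a real polynomial $p$ that is monic of degree $d$ as $p(x)=\sum_{k=0}^d x^{d-k}(-1)^k\binom dk \widetilde e_k(p)$ and put $$[p\boxtimes_d q](x)=\sum_{k=0}^d x^{d-k}(-1)^k\binom dk\,\widetilde e_k(p)\,\widetilde e_k(q).$$ Let $m_n(p)=\frac1d\sum_{i=1}^d\lambda_i(p)^n$, where $\lambda_1(p),\dots,\lambda_d(p)$ are the roots of $p$ in $\mathbb C$ with multiplicity. An \emph{infinitesimal distribution} is a pair $(\mu,\mu')$ of a probability measure $\mu$ on $\mathbb R$ with finite moments $m_n(\mu)=\int t^n\,d\mu(t)$ of all orders and a linear functional $\mu':\mathbb R[x]\to\mathbb R$ with $\mu'(1)=0$; put $m_n(\mu')=\mu'(x^n)$. A sequence $(p_d)_{d\ge1}$ of real polynomials, $p_d$ monic of degree $d$, \emph{has infinitesimal distribution} $(\mu,\mu')$ if, for every $n\ge 0$, $$m_n(p_d)\to m_n(\mu)\qquad\text{and}\qquad d\,\bigl(m_n(p_d)-m_n(\mu)\bigr)\to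 m_n(\mu')\qquad\text{as } d\to\infty .$$ For a set partition $\pi$ of $[n]$ and a sequence $(u_k)$ let $u_\pi=\prod_{V\in\pi}u_{|V|}$ and $u_{\pi\setminus V}=\prod_{W\in\pi,\,W\ne V}u_{|W|}$. Let $NC(n)$ be the set of non-crossing partitions of $[n]$ and $Kr(\pi)$ the Kreweras complement of $\pi$, i.e. the partition into the cycles of $\pi^{-1}(1,2,\dots,n)$, where $\pi$ is viewed as the permutation whose cycles are its blocks in increasing order. The free cumulants $r_n(\mu)$ and the infinitesimal free cumulants $r'_n(\mu,\mu')$ are defined recursively, for $n\ge1$, by $$m_n(\mu)=\sum_{\pi\in NC(n)}r_\pi(\mu),\qquad m_n(\mu')=\sum_{\pi\in NC(n)}\sum_{V\in\pi}r'_{|V|}(\mu,\mu')\,r_{\pi\setminus V}(\mu).$$ For infinitesimal distributions $(\mu,\mu')$ and $(\nu,\nu')$ with $\nu$ supported on $[0,\infty)$, an infinitesimal distribution $(\gamma,\gamma')$ is the \emph{infinitesimal free multiplicative convolution} $(\mu,\mu')\boxtimes_B(\nu,\nu')$ if, for all $n\ge1$, $$r_n(\gamma)=\sum_{\pi\in NC(n)}r_\pi(\mu)\,r_{Kr(\pi)}(\nu)$$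 (that is, $\gamma=\mu\boxtimes\nu$) and $$r'_n(\gamma,\gamma')=\sum_{\pi\in NC(n)}\Bigl(\sum_{V\in\pi}r'_{|V|}(\mu,\mu')\,r_{\pi\setminus V}(\mu)\,r_{Kr(\pi)}(\nu)+\sum_{W\in Kr(\pi)}r_\pi(\mu)\,r'_{|W|}(\nu,\nu')\,r_{Kr(\pi)\setminus W}(\nu)\Bigr).$$ \textbf{Proposition.} Let $(p_d)_{d\ge1}$ and $(q_d)_{d\ge1}$, with $p_d,q_d\in\mathcal P_d(\mathbb R)$ for every $d\ge 1$, have infinitesimal distributions $(\mu,\mu')$ and $(\nu,\nu')$, respectively. If $\nu=\delta_1$, then $(\mu,\mu')\boxtimes_B(\nu,\nu')$ exists, and whenever $(\gamma,\gamma')=(\mu,\mu')\boxtimes_B(\nu,\nu')$, the sequence of finite-free multiplicative convolutions $(p_d\boxtimes_d q_d)_{d\ge1}$ has infinitesimal distribution $(\gamma,\gamma')$. -/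

import Mathlib

open Polynomial MeasureTheory Filter Topology Finset

namespace FiniteFree

/-! ### Non-crossing partitions of `[n]`, modelled on `Fin n` -/

/-- Set partitions `P(n)` of an `n`-element linearly ordered set. -/
abbrev SetPartition (n : ℕ) := Finpartition (Finset.univ : Finset (Fin n))

/-- `π` is non-crossing: if `a < b < c < d` with `a, c` in a block `V` and `b, d` in a block `W`,
then `V = W`. -/
def IsNoncrossing {n : ℕ} (π : SetPartition n) : Prop :=
  ∀ a b c d : Fin n, a < b → b < c → c < d →
    ∀ V ∈ π.parts, ∀ W ∈ π.parts, a ∈ V → c ∈ V → b ∈ W → d ∈ W → V = W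

instance {n : ℕ} (π : SetPartition n) : Decidable (IsNoncrossing π) := by
  unfold IsNoncrossing; infer_instance

/-- The finite set `NC(n)` of non-crossing partitions of `[n]`. -/
def NC (n : ℕ) : Finset (SetPartition n) := Finset.univ.filter fun π => IsNoncrossing π

/-- The permutation attached to a set partition: its cycles are the blocks of `π`, each written in
increasing order. -/
noncomputable def blockPerm {n : ℕ} (π : SetPartition n) : Equiv.Perm (Fin n) :=
  Equiv.ofBijective (fun i => ((π.part i).sort (· ≤ ·)).formPerm i) <| by
    have key : ∀ i : Fin n, ((π.part i).sort (· ≤ ·)).formPerm i ∈ π.part i := fun i => by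
      have h : i ∈ (π.part i).sort (· ≤ ·) :=
        (Finset.mem_sort _).2 (π.mem_part (Finset.mem_univ i))
      exact (Finset.mem_sort _).1 (List.formPerm_apply_mem_of_mem h)
    refine Finite.injective_iff_bijective.1 fun i j hij => ?_
    have hij' : ((π.part i).sort (· ≤ ·)).formPerm i = ((π.part j).sort (· ≤ ·)).formPerm j := hij
    have hi := key i
    have hj := key j
    rw [← hij'] at hj
    have hp : π.part i = π.part j :=
      (π.part_eq_of_mem (π.part_mem.2 (Finset.mem_univ i)) hi).symm.trans
        (π.part_eq_of_mem (π.part_mem.2 (Finset.mem_univ j)) hj)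
    rw [hp] at hij'
    exact Equiv.injective _ hij'

/-- The set partition of `[n]` into the cycles (fixed points included) of a permutation. -/
def cyclePartition {n : ℕ} (σ : Equiv.Perm (Fin n)) : SetPartition n :=
  letI : DecidableRel (Equiv.Perm.SameCycle.setoid σ).r := fun a b =>
    inferInstanceAs (Decidable (σ.SameCycle a b))
  Finpartition.ofSetoid (Equiv.Perm.SameCycle.setoid σ)

/-- The Kreweras complement `Kr(π)`: the cycles of `π⁻¹ γₙ`, with `γₙ = (1, 2, …, n)`. -/
noncomputable def kreweras {n : ℕ} (π : SetPartition n) : SetPartition n :=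
  cyclePartition ((blockPerm π)⁻¹ * finRotate n)

/-- `u_π = ∏_{V ∈ π} u_{|V|}`. -/
def blockProd (u : ℕ → ℝ) {n : ℕ} (π : SetPartition n) : ℝ :=
  ∏ V ∈ π.parts, u V.card

/-- `∑_{V ∈ π} u'_{|V|} u_{π ∖ V}`, with `u_{π ∖ V} = ∏_{W ∈ π, W ≠ V} u_{|W|}`. -/
def blockDeriv (u u' : ℕ → ℝ) {n : ℕ} (π : SetPartition n) : ℝ :=
  ∑ V ∈ π.parts, u' V.card * ∏ W ∈ π.parts.erase V, u W.card

/-! ### Free cumulants and infinitesimal free cumulants -/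

/-- The free cumulants `r_n` of a sequence of moments `m_n`, defined recursively by solving
the moment-cumulant formula `m_n = ∑_{π ∈ NC(n)} r_π` for the summand `r_n` of `π = 1_n`. Every
block of a partition `π ≠ 1_n` has fewer than `n` elements, so the `else` branch does not occur
(see `moment_eq_sum_freeCumulant`). -/
noncomputable def freeCumulant (m : ℕ → ℝ) (n : ℕ) : ℝ :=
  m n - ∑ π ∈ (NC n).erase ⊤, ∏ V ∈ π.parts,
    if _h : V.card < n then freeCumulant m V.card else 0
termination_by n

/-- The infinitesimal free cumulants `r'_n` of a sequence of moments `m_n` and a sequence of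
infinitesimal moments `m'_n`, defined recursively by solving the infinitesimal moment-cumulant
formula `m'_n = ∑_{π ∈ NC(n)} ∑_{V ∈ π} r'_{|V|} r_{π ∖ V}` for the summand `r'_n` of `π = 1_n`
(see `infMoment_eq_sum_infFreeCumulant`). -/
noncomputable def infFreeCumulant (m m' : ℕ → ℝ) (n : ℕ) : ℝ :=
  m' n - ∑ π ∈ (NC n).erase ⊤, ∑ V ∈ π.parts,
    (if _h : V.card < n then infFreeCumulant m m' V.card else 0) *
      ∏ W ∈ π.parts.erase V, freeCumulant m W.card
termination_by n

lemma card_lt_of_ne_top {n : ℕ} {π : SetPartition n} (hπ : π ≠ ⊤) {V : Finset (Fin n)}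
    (hV : V ∈ π.parts) : V.card < n := by
  refine lt_of_le_of_ne (by simpa using Finset.card_le_univ V) fun h => hπ ?_
  have hVu : V = Finset.univ := Finset.eq_univ_of_card V (by simpa using h)
  subst hVu
  refine top_le_iff.1 ?_
  intro W hW
  exact ⟨_, hV, Finset.subset_univ W⟩

lemma top_mem_NC (n : ℕ) : (⊤ : SetPartition n) ∈ NC n := by
  refine Finset.mem_filter.2 ⟨Finset.mem_univ _, ?_⟩
  intro a b c d _ _ _ V hV W hW _ _ _ _
  exact Finset.mem_singleton.1 (Finpartition.parts_top_subset _ hV) |>.trans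
    (Finset.mem_singleton.1 (Finpartition.parts_top_subset _ hW)).symm

lemma parts_top {n : ℕ} (hn : n ≠ 0) : (⊤ : SetPartition n).parts = {Finset.univ} := by
  have : NeZero n := ⟨hn⟩
  have h := Finpartition.parts_top_subset (Finset.univ : Finset (Fin n))
  rcases Finset.subset_singleton_iff.1 h with h0 | h1
  · have h2 := (⊤ : SetPartition n).part_mem.2 (Finset.mem_univ (0 : Fin n))
    rw [h0] at h2
    exact absurd h2 (Finset.notMem_empty _)
  · exact h1

theorem moment_eq_sum_freeCumulant (m : ℕ → ℝ) {n : ℕ} (hn : n ≠ 0) :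
    m n = ∑ π ∈ NC n, blockProd (freeCumulant m) π := by
  rw [← Finset.add_sum_erase _ _ (top_mem_NC n)]
  have h1 : blockProd (freeCumulant m) (⊤ : SetPartition n) = freeCumulant m n := by
    simp [blockProd, parts_top hn]
  rw [h1, freeCumulant]
  have h2 : ∀ π ∈ (NC n).erase ⊤, (∏ V ∈ π.parts,
      if _h : V.card < n then freeCumulant m V.card else 0) = blockProd (freeCumulant m) π := by
    intro π hπ
    refine Finset.prod_congr rfl fun V hV => ?_
    rw [dif_pos (card_lt_of_ne_top (Finset.ne_of_mem_erase hπ) hV)]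
  rw [Finset.sum_congr rfl h2]
  ring

theorem infMoment_eq_sum_infFreeCumulant (m m' : ℕ → ℝ) {n : ℕ} (hn : n ≠ 0) :
    m' n = ∑ π ∈ NC n, blockDeriv (freeCumulant m) (infFreeCumulant m m') π := by
  rw [← Finset.add_sum_erase _ _ (top_mem_NC n)]
  have h1 : blockDeriv (freeCumulant m) (infFreeCumulant m m') (⊤ : SetPartition n)
      = infFreeCumulant m m' n := by
    simp [blockDeriv, parts_top hn]
  rw [h1, infFreeCumulant]
  have h2 : ∀ π ∈ (NC n).erase ⊤, (∑ V ∈ π.parts,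
      (if _h : V.card < n then infFreeCumulant m m' V.card else 0) *
        ∏ W ∈ π.parts.erase V, freeCumulant m W.card)
      = blockDeriv (freeCumulant m) (infFreeCumulant m m') π := by
    intro π hπ
    refine Finset.sum_congr rfl fun V hV => ?_
    rw [dif_pos (card_lt_of_ne_top (Finset.ne_of_mem_erase hπ) hV)]
  rw [Finset.sum_congr rfl h2]
  ring

/-! ### Infinitesimal distributions and their free multiplicative convolution -/

/-- An infinitesimal distribution: a probability measure on `ℝ` with finite moments of all orders
and a linear functional `μ'` on `ℝ[x]` with `μ'(1) = 0`. -/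
structure IsInfDistribution (μ : Measure ℝ) (μ' : ℝ[X] →ₗ[ℝ] ℝ) : Prop where
  isProbabilityMeasure : IsProbabilityMeasure μ
  integrable_pow : ∀ n : ℕ, Integrable (fun t : ℝ => t ^ n) μ
  map_one : μ' 1 = 0

/-- The moments `m_n(μ)` of a measure on `ℝ`. -/
noncomputable def measureMoment (μ : Measure ℝ) (n : ℕ) : ℝ := ∫ t, t ^ n ∂μ

/-- The moments `m_n(μ') = μ'(x^n)` of a linear functional on `ℝ[x]`. -/
noncomputable def functionalMoment (μ' : ℝ[X] →ₗ[ℝ] ℝ) (n : ℕ) : ℝ := μ' (X ^ n)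

/-- The free cumulants `r_n(μ)`. -/
noncomputable def freeCumulants (μ : Measure ℝ) : ℕ → ℝ := freeCumulant (measureMoment μ)

/-- The infinitesimal free cumulants `r'_n(μ, μ')`. -/
noncomputable def infFreeCumulants (μ : Measure ℝ) (μ' : ℝ[X] →ₗ[ℝ] ℝ) : ℕ → ℝ :=
  infFreeCumulant (measureMoment μ) (functionalMoment μ')

/-- `γ` is a free multiplicative convolution `μ ⊠ ν`, where `ν` lives on `[0, ∞)`: a probability
measure with finite moments of all orders such that
`r_n(γ) = ∑_{π ∈ NC(n)} r_π(μ) r_{Kr(π)}(ν)` for all `n ≥ 1`. -/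
structure IsFreeMulConv (μ ν γ : Measure ℝ) : Prop where
  nonneg : ν (Set.Iio 0) = 0
  isProbabilityMeasure : IsProbabilityMeasure γ
  integrable_pow : ∀ n : ℕ, Integrable (fun t : ℝ => t ^ n) γ
  freeCumulants_eq : ∀ n : ℕ, 1 ≤ n → freeCumulants γ n =
    ∑ π ∈ NC n, blockProd (freeCumulants μ) π * blockProd (freeCumulants ν) (kreweras π)

/-- `(γ, γ')` is the infinitesimal free multiplicative convolution `(μ, μ') ⊠_B (ν, ν')`. -/
structure IsInfFreeMulConv (μ : Measure ℝ) (μ' : ℝ[X] →ₗ[ℝ] ℝ) (ν : Measure ℝ)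
    (ν' : ℝ[X] →ₗ[ℝ] ℝ) (γ : Measure ℝ) (γ' : ℝ[X] →ₗ[ℝ] ℝ) : Prop where
  isFreeMulConv : IsFreeMulConv μ ν γ
  map_one : γ' 1 = 0
  infFreeCumulants_eq : ∀ n : ℕ, 1 ≤ n → infFreeCumulants γ γ' n =
    ∑ π ∈ NC n,
      (blockDeriv (freeCumulants μ) (infFreeCumulants μ μ') π *
          blockProd (freeCumulants ν) (kreweras π) +
        blockProd (freeCumulants μ) π *
          blockDeriv (freeCumulants ν) (infFreeCumulants ν ν') (kreweras π))

/-! ### Polynomials and their root distributions -/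

/-- `p ∈ 𝒫_d(ℝ)`: a monic polynomial of degree `d` all of whose roots are real. -/
structure IsRealRooted (d : ℕ) (p : ℝ[X]) : Prop where
  monic : p.Monic
  natDegree_eq : p.natDegree = d
  splits : p.Splits

/-- The coefficients `e_k(p)` in `p(x) = ∑_k x^{d-k} (-1)^k (d choose k) e_k(p)`. -/
noncomputable def normCoeff (d : ℕ) (p : ℝ[X]) (k : ℕ) : ℝ :=
  (-1) ^ k * p.coeff (d - k) / (d.choose k : ℝ)

/-- The finite-free multiplicative convolution `p ⊠_d q`. -/
noncomputable def finiteFreeMulConv (d : ℕ) (p q : ℝ[X]) : ℝ[X] :=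
  ∑ k ∈ Finset.range (d + 1),
    C ((-1) ^ k * (d.choose k : ℝ) * (normCoeff d p k * normCoeff d q k)) * X ^ (d - k)

/-- The `n`-th moment `(1/d) ∑_i λ_i(p)^n` of the root distribution of a real polynomial `p` of
degree `d`, where the sum is over the complex roots of `p` with multiplicity. If `p` is real-rooted
this is the corresponding sum over the real roots (see `rootMoment_of_splits`). -/
noncomputable def rootMoment (d : ℕ) (p : ℝ[X]) (n : ℕ) : ℂ :=
  ((p.map (algebraMap ℝ ℂ)).roots.map fun z => z ^ n).sum / d

theorem rootMoment_of_splits (d : ℕ) {p : ℝ[X]} (hp : p.Splits) (n : ℕ) :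
    rootMoment d p n = (((p.roots.map fun x => x ^ n).sum / d : ℝ) : ℂ) := by
  rw [rootMoment, hp.roots_map (algebraMap ℝ ℂ), Multiset.map_map, Complex.ofReal_div,
    Complex.ofReal_natCast]
  congr 1
  have h := map_multiset_sum (algebraMap ℝ ℂ) (p.roots.map fun x => x ^ n)
  rw [Multiset.map_map] at h
  refine Eq.trans ?_ h.symm
  congr 1
  exact Multiset.map_congr rfl fun x _ => by simp

/-- The sequence `(p_d)_{d ≥ 1}` has infinitesimal distribution `(μ, μ')`: for all `n`,
`m_n(p_d) → m_n(μ)` and `d (m_n(p_d) - m_n(μ)) → μ'(x^n)` as `d → ∞`. -/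
structure HasInfDistribution (p : ℕ → ℝ[X]) (μ : Measure ℝ) (μ' : ℝ[X] →ₗ[ℝ] ℝ) : Prop where
  isInfDistribution : IsInfDistribution μ μ'
  tendsto_moment : ∀ n : ℕ,
    Tendsto (fun d : ℕ => rootMoment d (p d) n) atTop (𝓝 (measureMoment μ n : ℂ))
  tendsto_infMoment : ∀ n : ℕ,
    Tendsto (fun d : ℕ => (d : ℂ) * (rootMoment d (p d) n - (measureMoment μ n : ℂ))) atTop
      (𝓝 (functionalMoment μ' n : ℂ))

end FiniteFree

/-! Write `P = ∏ (1 - λ X)` for the reversed polynomial of `p_d`. Its logarithmic derivative `-X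
P'/P` generates the power sums of the roots, so the infinitesimal distribution of `p_d ⊠_d q_d` is
visible in how this logarithmic derivative differs from that of `p_d`.

Analytic side. Let `a_j` be the coefficients of the reversed Taylor shift of `q_d` at `1`, whose
roots are `λ - 1`. Then the normalized coefficients of `q_d` are `∑_j (-1)^j a_j (k)_j / (d)_j`, and
multiplying the `k`-th coefficient of `P` by `(k)_j` is the operator `X^j (d/dX)^j`. Hence
convolution multiplies `P` by a series `B_d = ∑_j (-1)^j a_j X^j P^{(j)} / ((d)_j P)`
(`reverse_finiteFreeMulConv`). As `d → ∞`, `X^j P^{(j)} / ((d)_j P)` tends to `(-M)^j`, with `M =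
∑_{n ≥ 1} m_n(μ) X^n` (`tendsto_normDeriv`). Since `ν = δ₁`, the power sums of the numbers `λ - 1`
converge, without normalization, to limits `κ_n`; by Newton's identities the `a_j` converge too, to
the coefficients of a series `a` with `a'/a = -N`, `N = ∑ κ_{k+1} X^k`. So `B_d → a(M)`, and the
power sums of `p_d ⊠_d q_d` minus those of `p_d` converge to the coefficients of `-X (a(M))' / a(M)
= X M' N(M)`.

Combinatorial side. The free cumulants of `δ₁` are `1, 0, 0, …`, and the infinitesimal ones of `(δ₁,
ν')` are the same `κ_n`: both solve one triangular binomial system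
(`tendsto_rootPowerSums_taylor_one`). In the formula for `r'_n(γ, γ')` the first sum keeps only `π =
1_n`, and the second only those `π` whose Kreweras complement has at most one block that is not a
singleton. These `π` are the partitions into cyclic intervals ending at the points of a set `W`
(`isPointed_kreweras_iff`). Summing over `W` adds to the infinitesimal cumulants the series `X R'
N(R)`, where `R` generates the free cumulants of `μ`. Linearizing `M = R(X (1 + M))` turns this into
the contribution `X M' N(M)` to the infinitesimal moments (`momentSeries_infSum_eq`), which is the
analytic answer. -/

namespace FiniteFree

open scoped PowerSeries PowerSeries.WithPiTopology

/-! ### The Euler operator on power series -/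

/-- The Euler operator `X d/dX` on power series. -/
noncomputable def euler {K : Type*} [CommRing K] (f : K⟦X⟧) : K⟦X⟧ :=
  PowerSeries.X * PowerSeries.derivative K f

section Euler

variable {K : Type*} [CommRing K]

@[simp] lemma coeff_euler (f : K⟦X⟧) (n : ℕ) :
    PowerSeries.coeff n (euler f) = n * PowerSeries.coeff n f := by
  rcases n with _ | n
  · simp [euler]
  · rw [euler, PowerSeries.coeff_succ_X_mul, PowerSeries.coeff_derivative]
    push_cast; ring

lemma euler_mul (f g : K⟦X⟧) : euler (f * g) = f * euler g + g * euler f := by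
  simp only [euler, Derivation.leibniz, smul_eq_mul]; ring

lemma euler_one : euler (1 : K⟦X⟧) = 0 := by simp [euler]

lemma euler_subst {f g : K⟦X⟧} (hg : PowerSeries.HasSubst g) :
    euler (f.subst g) = (PowerSeries.derivative K f).subst g * euler g := by
  rw [euler, PowerSeries.derivative_subst hg, euler]; ring

lemma constantCoeff_euler (f : K⟦X⟧) : PowerSeries.constantCoeff (euler f) = 0 := by
  simp [euler]

end Euler

/-! ### Newton's identities for the reversed polynomial -/

/-- The generating series `∑_{n ≥ 1} p_n X^n` of the power sums of a multiset. -/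
noncomputable def powerSumSeries {K : Type*} [CommRing K] (s : Multiset K) : K⟦X⟧ :=
  PowerSeries.mk fun n => if n = 0 then 0 else (s.map fun z => z ^ n).sum

/-- Newton's identities as a logarithmic derivative: logarithmic derivatives add over factors, and a
single factor gives a geometric series. -/
lemma euler_prod_one_sub {K : Type*} [CommRing K] (s : Multiset K) :
    euler (s.map fun z => 1 - PowerSeries.C z * PowerSeries.X).prod
      = -((s.map fun z => 1 - PowerSeries.C z * PowerSeries.X).prod * powerSumSeries s) := by
  induction s using Multiset.induction_on with
  | empty =>
    have : powerSumSeries (0 : Multiset K) = 0 := by ext n; simp [powerSumSeries]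
    simp [this, euler_one]
  | cons a s ih =>
    have h1 : powerSumSeries (a ::ₘ s) = powerSumSeries {a} + powerSumSeries s := by
      ext n; by_cases h : n = 0 <;> simp [powerSumSeries, h]
    have h2 : euler (1 - PowerSeries.C a * PowerSeries.X)
        = -((1 - PowerSeries.C a * PowerSeries.X) * powerSumSeries {a}) := by
      ext n
      rw [sub_mul, one_mul, mul_assoc]
      rcases n with _ | _ | n
      · simp [powerSumSeries]
      · simp [powerSumSeries, PowerSeries.coeff_one, PowerSeries.coeff_succ_X_mul]
      · simp [powerSumSeries, PowerSeries.coeff_one, PowerSeries.coeff_succ_X_mul]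
        ring
    rw [Multiset.map_cons, Multiset.prod_cons, euler_mul, ih, h1, h2]
    ring

lemma reverse_multiset_prod_X_sub_C {K : Type*} [Field K] (s : Multiset K) :
    (((s.map fun z => X - C z).prod.reverse : K[X]) : K⟦X⟧)
      = (s.map fun z => 1 - PowerSeries.C z * PowerSeries.X).prod := by
  induction s using Multiset.induction_on with
  | empty => simp [Polynomial.reverse, Polynomial.natDegree_one]
  | cons a s ih =>
    rw [Multiset.map_cons, Multiset.prod_cons, Polynomial.reverse_mul_of_domain,
      Polynomial.coe_mul, ih, Multiset.map_cons, Multiset.prod_cons]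
    congr 1
    ext n
    rw [Polynomial.coeff_coe, Polynomial.coeff_reverse, natDegree_X_sub_C]
    rcases n with _ | _ | n
    · simp [Polynomial.revAt_le]
    · simp [Polynomial.revAt_le, PowerSeries.coeff_one]
    · rw [Polynomial.revAt_eq_self_of_lt (by omega)]
      simp [PowerSeries.coeff_one, Polynomial.coeff_X]

lemma coeff_reverse_of_le {K : Type*} [Semiring K] {d : ℕ} {f : K[X]} (hf : f.natDegree = d)
    {k : ℕ} (hk : k ≤ d) : PowerSeries.coeff k ((f.reverse : K[X]) : K⟦X⟧) = f.coeff (d - k) := by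
  rw [Polynomial.coeff_coe, Polynomial.coeff_reverse, hf, Polynomial.revAt_le hk]

lemma coeff_reverse_of_lt {K : Type*} [Semiring K] {d : ℕ} {f : K[X]} (hf : f.natDegree = d)
    {k : ℕ} (hk : d < k) : PowerSeries.coeff k ((f.reverse : K[X]) : K⟦X⟧) = 0 := by
  rw [Polynomial.coeff_coe, Polynomial.coeff_reverse, hf, Polynomial.revAt_eq_self_of_lt hk,
    Polynomial.coeff_eq_zero_of_natDegree_lt (hf ▸ hk)]

lemma constantCoeff_reverse {K : Type*} [Semiring K] {f : K[X]} (hf : f.Monic) :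
    PowerSeries.constantCoeff ((f.reverse : K[X]) : K⟦X⟧) = 1 := by
  rw [← PowerSeries.coeff_zero_eq_constantCoeff_apply, coeff_reverse_of_le rfl (Nat.zero_le _)]
  simpa using hf.leadingCoeff

/-- The generating series of the power sums of the complex roots of a real polynomial, as the
logarithmic derivative of the reversed polynomial. -/
noncomputable def rootPowerSums (f : ℝ[X]) : ℝ⟦X⟧ :=
  -(euler ((f.reverse : ℝ[X]) : ℝ⟦X⟧) * ((f.reverse : ℝ[X]) : ℝ⟦X⟧)⁻¹)

lemma euler_reverse {f : ℝ[X]} (hf : f.Monic) :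
    euler ((f.reverse : ℝ[X]) : ℝ⟦X⟧) = -(((f.reverse : ℝ[X]) : ℝ⟦X⟧) * rootPowerSums f) := by
  have h := PowerSeries.mul_inv_cancel ((f.reverse : ℝ[X]) : ℝ⟦X⟧)
    (by rw [constantCoeff_reverse hf]; exact one_ne_zero)
  rw [rootPowerSums]
  linear_combination (-euler ((f.reverse : ℝ[X]) : ℝ⟦X⟧)) * h

lemma map_euler {K L : Type*} [CommRing K] [CommRing L] (φ : K →+* L) (f : K⟦X⟧) :
    PowerSeries.map φ (euler f) = euler (PowerSeries.map φ f) := by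
  ext n; simp

/-- Bridge between complex roots and real coefficients. A convolution of real-rooted polynomials
need not be real-rooted, but its power sums are real, so all limits can be taken in `ℝ⟦X⟧`. -/
lemma map_rootPowerSums {f : ℝ[X]} (hf : f.Monic) :
    PowerSeries.map (algebraMap ℝ ℂ) (rootPowerSums f)
      = powerSumSeries (f.map (algebraMap ℝ ℂ)).roots := by
  set g := f.map (algebraMap ℝ ℂ) with hg
  have hgm : g.Monic := hf.map _
  have h1 : g = (g.roots.map fun z => X - C z).prod := by
    have := (IsAlgClosed.splits g).eq_prod_roots
    rwa [hgm.leadingCoeff, C_1, one_mul] at this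
  have h2 := euler_prod_one_sub g.roots
  rw [← reverse_multiset_prod_X_sub_C, ← h1] at h2
  have h3 : PowerSeries.map (algebraMap ℝ ℂ) ((f.reverse : ℝ[X]) : ℝ⟦X⟧)
      = ((g.reverse : ℂ[X]) : ℂ⟦X⟧) := by
    ext n
    rw [PowerSeries.coeff_map, Polynomial.coeff_coe, Polynomial.coeff_coe, hg,
      Polynomial.coeff_reverse, Polynomial.coeff_reverse, Polynomial.natDegree_map,
      Polynomial.coeff_map]
  have h4 := congrArg (PowerSeries.map (algebraMap ℝ ℂ)) (euler_reverse hf)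
  rw [map_euler, map_neg, map_mul, h3, h2] at h4
  have h5 : ((g.reverse : ℂ[X]) : ℂ⟦X⟧) ≠ 0 := fun h => by
    have := constantCoeff_reverse hgm
    rw [h] at this; simp at this
  exact (mul_left_cancel₀ h5 (neg_injective h4)).symm

lemma rootMoment_eq_rootPowerSums {f : ℝ[X]} (hf : f.Monic) (d : ℕ) {n : ℕ} (hn : n ≠ 0) :
    rootMoment d f n = ((PowerSeries.coeff n (rootPowerSums f) / d : ℝ) : ℂ) := by
  have h := congrArg (PowerSeries.coeff n) (map_rootPowerSums hf)
  rw [PowerSeries.coeff_map, powerSumSeries, PowerSeries.coeff_mk, if_neg hn] at h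
  rw [rootMoment, ← h]
  simp

lemma rootMoment_zero {f : ℝ[X]} {d : ℕ} (hd : f.natDegree = d) (hd0 : d ≠ 0) :
    rootMoment d f 0 = 1 := by
  have : Multiset.card (f.map (algebraMap ℝ ℂ)).roots = d := by
    rw [← (IsAlgClosed.splits _).natDegree_eq_card_roots, Polynomial.natDegree_map, hd]
  simp only [rootMoment, pow_zero, Multiset.map_const', Multiset.sum_replicate, this]
  simp [hd0]

lemma rootPowerSums_of_splits {f : ℝ[X]} (hf : f.Monic) (hs : f.Splits) {n : ℕ} (hn : n ≠ 0) :
    PowerSeries.coeff n (rootPowerSums f) = (f.roots.map fun z => z ^ n).sum := by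
  have h := congrArg (PowerSeries.coeff n) (map_rootPowerSums hf)
  have h0 := rootMoment_of_splits 1 hs n
  have h1 := rootMoment_eq_rootPowerSums hf 1 hn
  rw [h0] at h1
  simpa using (Complex.ofReal_injective h1).symm

lemma constantCoeff_rootPowerSums (f : ℝ[X]) :
    PowerSeries.constantCoeff (rootPowerSums f) = 0 := by
  simp [rootPowerSums, constantCoeff_euler]

/-! ### Substitution of power series, coefficientwise -/

lemma coeff_pow_eq_zero_of_lt {A : Type*} [CommRing A] {b : A⟦X⟧}
    (hb : PowerSeries.constantCoeff b = 0) {n j : ℕ} (h : n < j) :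
    PowerSeries.coeff n (b ^ j) = 0 :=
  PowerSeries.X_pow_dvd_iff.1 (pow_dvd_pow_of_dvd (PowerSeries.X_dvd_iff.2 hb) j) n h

/-- Since `b ^ j` has order at least `j`, only `j ≤ n` reach degree `n`; limits can then be taken
term by term. -/
lemma coeff_subst_eq_sum {A : Type*} [CommRing A] {b : A⟦X⟧}
    (hb : PowerSeries.constantCoeff b = 0) (a : A⟦X⟧) (n : ℕ) :
    PowerSeries.coeff n (a.subst b)
      = ∑ j ∈ range (n + 1), PowerSeries.coeff j a * PowerSeries.coeff n (b ^ j) := by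
  rw [PowerSeries.coeff_subst' (PowerSeries.HasSubst.of_constantCoeff_zero' hb),
    finsum_eq_sum_of_support_subset (s := range (n + 1))]
  · rfl
  · intro j hj
    by_contra hjn
    refine hj ?_
    dsimp only
    rw [coeff_pow_eq_zero_of_lt hb (by simpa using hjn), smul_zero]

/-- The factor `f` uses up one degree, so the sum already stops at `j < n`. -/
lemma coeff_mul_subst_eq_sum {A : Type*} [CommRing A] {b f : A⟦X⟧}
    (hb : PowerSeries.constantCoeff b = 0) (hf : PowerSeries.constantCoeff f = 0) (a : A⟦X⟧)
    (n : ℕ) : PowerSeries.coeff n (f * a.subst b)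
      = ∑ j ∈ range n, PowerSeries.coeff j a * PowerSeries.coeff n (b ^ j * f) := by
  have h1 : ∀ x ∈ antidiagonal n, PowerSeries.coeff x.1 f * PowerSeries.coeff x.2 (a.subst b)
      = ∑ j ∈ range n, PowerSeries.coeff j a *
        (PowerSeries.coeff x.1 f * PowerSeries.coeff x.2 (b ^ j)) := by
    intro x hx
    have hx := HasAntidiagonal.mem_antidiagonal.1 hx
    by_cases hx1 : x.1 = 0
    · simp [hx1, hf]
    · rw [coeff_subst_eq_sum hb, Finset.mul_sum, Finset.sum_subset (s₂ := range n)]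
      · exact Finset.sum_congr rfl fun j _ => by ring
      · exact Finset.range_subset_range.2 (by omega)
      · intro j _ hj
        rw [coeff_pow_eq_zero_of_lt hb (by simpa using hj), mul_zero, mul_zero]
  rw [PowerSeries.coeff_mul, Finset.sum_congr rfl h1, Finset.sum_comm]
  refine Finset.sum_congr rfl fun j _ => ?_
  rw [← Finset.mul_sum, mul_comm (b ^ j), PowerSeries.coeff_mul]

/-! ### Coefficientwise limits of power series -/

section Limits

variable {ι : Type*} {l : Filter ι}

lemma tendsto_euler {F : ι → ℝ⟦X⟧} {f : ℝ⟦X⟧} (h : Tendsto F l (𝓝 f)) :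
    Tendsto (fun i => euler (F i)) l (𝓝 (euler f)) := by
  rw [PowerSeries.WithPiTopology.tendsto_iff_coeff_tendsto] at h ⊢
  intro n
  simpa using (h n).const_mul (n : ℝ)

lemma tendsto_powerSeries_inv {F : ι → ℝ⟦X⟧} {f : ℝ⟦X⟧} (h : Tendsto F l (𝓝 f))
    (h0 : PowerSeries.constantCoeff f ≠ 0) :
    Tendsto (fun i => (F i)⁻¹) l (𝓝 f⁻¹) := by
  rw [PowerSeries.WithPiTopology.tendsto_iff_coeff_tendsto] at h ⊢
  have hc : Tendsto (fun i => (PowerSeries.constantCoeff (F i))⁻¹) l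
      (𝓝 (PowerSeries.constantCoeff f)⁻¹) := by
    have := h 0
    simp only [PowerSeries.coeff_zero_eq_constantCoeff_apply] at this
    exact this.inv₀ h0
  intro n
  induction n using Nat.strong_induction_on with
  | _ n ih =>
    simp_rw [fun g : ℝ⟦X⟧ => PowerSeries.coeff_inv n g]
    split_ifs with hn
    · exact hc
    · refine hc.neg.mul (tendsto_finsetSum _ fun x _ => ?_)
      split_ifs with hx
      · exact (h _).mul (ih _ hx)
      · exact tendsto_const_nhds

/-- Degree `k` of the equation reads `k A_k = -∑_{i < k} A_i N_{k-i}`, so convergence of the power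
sums forces that of the elementary symmetric functions, however many roots there are. -/
lemma exists_tendsto_of_euler_eq [l.NeBot] {A N : ι → ℝ⟦X⟧} {n : ℝ⟦X⟧}
    (h0 : ∀ᶠ i in l, PowerSeries.constantCoeff (A i) = 1)
    (hA : ∀ᶠ i in l, euler (A i) = -(A i * N i)) (hN : Tendsto N l (𝓝 n))
    (hN0 : ∀ i, PowerSeries.constantCoeff (N i) = 0) :
    ∃ a : ℝ⟦X⟧, Tendsto A l (𝓝 a) ∧ PowerSeries.constantCoeff a = 1 ∧ euler a = -(a * n) := by
  have key : ∀ k, ∃ c : ℝ, Tendsto (fun i => PowerSeries.coeff k (A i)) l (𝓝 c) := by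
    intro k
    induction k using Nat.strong_induction_on with
    | _ k ih =>
      rcases Nat.eq_zero_or_pos k with rfl | hk
      · refine ⟨1, tendsto_const_nhds.congr' ?_⟩
        filter_upwards [h0] with i hi
        simp [hi]
      · have hk' : (k : ℝ) ≠ 0 := by positivity
        have h1 : ∀ x ∈ antidiagonal k, ∃ c : ℝ, Tendsto (fun i => PowerSeries.coeff x.1 (A i) *
            PowerSeries.coeff x.2 (N i)) l (𝓝 c) := by
          intro x hx
          by_cases hxk : x.1 < k
          · obtain ⟨c, hc⟩ := ih _ hxk
            exact ⟨_, hc.mul ((PowerSeries.WithPiTopology.tendsto_iff_coeff_tendsto _ _ _ _).1 hN x.2)⟩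
          -- The term containing `A_k` itself is multiplied by `N_0 = 0`, so the recursion is not
          -- circular.
          · have : x.2 = 0 := by
              have := mem_antidiagonal.1 hx
              omega
            refine ⟨0, tendsto_const_nhds.congr fun i => ?_⟩
            rw [this, PowerSeries.coeff_zero_eq_constantCoeff_apply, hN0, mul_zero]
        choose! c hc using h1
        refine ⟨-(∑ x ∈ antidiagonal k, c x) / k, ?_⟩
        refine (((tendsto_finsetSum _ hc).neg).div_const (k : ℝ)).congr' ?_
        filter_upwards [hA] with i hi
        have := congrArg (PowerSeries.coeff k) hi
        rw [coeff_euler, map_neg, PowerSeries.coeff_mul] at this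
        rw [← this]
        field_simp
  choose c hc using key
  have hlim : Tendsto A l (𝓝 (PowerSeries.mk c)) := by
    rw [PowerSeries.WithPiTopology.tendsto_iff_coeff_tendsto]
    simpa using hc
  refine ⟨PowerSeries.mk c, hlim, ?_, ?_⟩
  · refine tendsto_nhds_unique (f := fun i => PowerSeries.constantCoeff (A i))
      (((PowerSeries.WithPiTopology.continuous_constantCoeff ℝ).tendsto _).comp hlim) ?_
    exact tendsto_const_nhds.congr' (h0.mono fun i hi => hi.symm)
  · exact tendsto_nhds_unique (tendsto_euler hlim)
      (((hlim.mul hN).neg).congr' (hA.mono fun i hi => hi.symm))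

end Limits

/-! ### The finite free multiplicative convolution as a differential operator -/

/-- The series `X^j P^{(j)} / ((d)_j P)` expressed through `U = X P' / (d P)`. -/
noncomputable def normDeriv (d : ℕ) (U : ℝ⟦X⟧) : ℕ → ℝ⟦X⟧
  | 0 => 1
  -- This encodes `X^{j+1} P^{(j+1)} = (X d/dX - j) (X^j P^{(j)})`, using `X P' = d P U` and
  -- `(d)_{j+1} = (d - j) (d)_j`.
  | j + 1 => ((d : ℝ) - j)⁻¹ •
      ((d : ℝ) • (normDeriv d U j * U) + euler (normDeriv d U j) - (j : ℝ) • normDeriv d U j)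

/-- The vanishing is exact for every `d`, so a fixed coefficient of the multiplier involves a number
of terms independent of `d`. -/
lemma coeff_normDeriv_of_lt (d : ℕ) {U : ℝ⟦X⟧} (hU : PowerSeries.constantCoeff U = 0) (j : ℕ) :
    ∀ n < j, PowerSeries.coeff n (normDeriv d U j) = 0 := by
  induction j with
  | zero => intro n hn; omega
  | succ j ih =>
    intro n hn
    have h1 : PowerSeries.coeff n (normDeriv d U j * U) = 0 := by
      rw [PowerSeries.coeff_mul]
      refine Finset.sum_eq_zero fun x hx => ?_
      have hx := mem_antidiagonal.1 hx
      by_cases h : x.1 < j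
      · rw [ih _ h, zero_mul]
      · have : x.2 = 0 := by omega
        rw [this, PowerSeries.coeff_zero_eq_constantCoeff_apply, hU, mul_zero]
    simp only [normDeriv, map_smul, map_sub, map_add, h1, coeff_euler, smul_eq_mul, mul_zero,
      zero_add]
    rcases Nat.lt_or_ge n j with h | h
    · rw [ih _ h]; ring
    -- In degree `j` the operator `X d/dX - j` acts as zero.
    · have : n = j := by omega
      rw [this]; ring

/-- Both sides are the coefficient of `X^j P^{(j)}`: differentiation multiplies coefficients by
falling factorials. The bound `j ≤ d` keeps the divisors `d - i`, `i < j`, nonzero. -/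
lemma descFactorial_mul_coeff_normDeriv {d : ℕ} {P U : ℝ⟦X⟧} (hP : euler P = (d : ℝ) • (P * U))
    {j : ℕ} (hj : j ≤ d) (k : ℕ) :
    (k.descFactorial j : ℝ) * PowerSeries.coeff k P
      = d.descFactorial j * PowerSeries.coeff k (P * normDeriv d U j) := by
  induction j with
  | zero => simp [normDeriv]
  | succ j ih =>
    have ih := ih (by omega)
    have hd : (d : ℝ) - j ≠ 0 := by
      have : ((j + 1 : ℕ) : ℝ) ≤ d := by exact_mod_cast hj
      push_cast at this
      linarith
    have h1 : P * normDeriv d U (j + 1) = ((d : ℝ) - j)⁻¹ •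
        (euler (P * normDeriv d U j) - (j : ℝ) • (P * normDeriv d U j)) := by
      rw [euler_mul, hP, normDeriv, mul_smul_comm]
      congr 1
      simp only [PowerSeries.smul_eq_C_mul]
      ring
    have h2 : (d.descFactorial (j + 1) : ℝ) = (d - j) * d.descFactorial j := by
      rw [Nat.descFactorial_succ, Nat.cast_mul, Nat.cast_sub (by omega)]
    have h3 : (k.descFactorial (j + 1) : ℝ) = (k - j) * k.descFactorial j := by
      rw [Nat.descFactorial_succ, Nat.cast_mul]
      -- For `k < j` truncated subtraction differs from `k - j`, but the falling factorial vanishes.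
      rcases Nat.lt_or_ge k j with h | h
      · rw [Nat.descFactorial_eq_zero_iff_lt.2 h]; simp
      · rw [Nat.cast_sub h]
    rw [h1, h2, h3]
    simp only [map_smul, map_sub, coeff_euler, smul_eq_mul]
    field_simp
    linear_combination ((k : ℝ) - j) * ih

/-- In the recursion only the product with `U` survives, with weight `d / (d - j) → 1`; the other
two terms carry `1 / (d - j) → 0`. -/
lemma tendsto_normDeriv {U : ℕ → ℝ⟦X⟧} {u : ℝ⟦X⟧} (hU : Tendsto U atTop (𝓝 u)) (j : ℕ) :
    Tendsto (fun d => normDeriv d (U d) j) atTop (𝓝 (u ^ j)) := by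
  induction j with
  | zero => simp [normDeriv]
  | succ j ih =>
    have hs : Tendsto (fun d : ℕ => (d : ℝ) - j) atTop atTop :=
      tendsto_atTop_add_const_right _ _ tendsto_natCast_atTop_atTop
    have h0 : Tendsto (fun d : ℕ => ((d : ℝ) - j)⁻¹) atTop (𝓝 0) := hs.inv_tendsto_atTop
    have h1 : Tendsto (fun d : ℕ => ((d : ℝ) - j)⁻¹ * d) atTop (𝓝 1) := by
      have : Tendsto (fun d : ℕ => 1 + ((d : ℝ) - j)⁻¹ * j) atTop (𝓝 (1 + 0 * j)) :=
        (h0.mul_const _).const_add _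
      rw [zero_mul, add_zero] at this
      refine this.congr' ?_
      filter_upwards [hs.eventually_gt_atTop 0] with d hd
      field_simp
      ring
    rw [PowerSeries.WithPiTopology.tendsto_iff_coeff_tendsto]
    intro n
    have h2 := (PowerSeries.WithPiTopology.tendsto_iff_coeff_tendsto _ _ _ _).1 (ih.mul hU) n
    have h3 := (PowerSeries.WithPiTopology.tendsto_iff_coeff_tendsto _ _ _ _).1 ih n
    have h4 := ((h1.mul h2).add (h0.mul (h3.const_mul ((n : ℝ) - j))))
    rw [one_mul, zero_mul, add_zero, ← pow_succ] at h4
    refine h4.congr fun d => ?_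
    simp only [normDeriv, map_smul, map_sub, map_add, coeff_euler, smul_eq_mul]
    ring

/-- The coefficients of a polynomial from those of its Taylor shift at `1`. -/
lemma normCoeff_eq_sum_taylor {d : ℕ} {q : ℝ[X]} (hq : q.natDegree = d) {k : ℕ} (hk : k ≤ d) :
    normCoeff d q k = ∑ j ∈ range (d + 1), (-1) ^ j *
      PowerSeries.coeff j (((taylor 1 q).reverse : ℝ[X]) : ℝ⟦X⟧) *
        (k.descFactorial j / d.descFactorial j) := by
  set h := taylor 1 q with hh
  have hhd : h.natDegree = d := by rw [hh, natDegree_taylor, hq]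
  have h1 : q = taylor (-1) h := by rw [hh, taylor_taylor]; simp
  have h2 : q.coeff (d - k) = ∑ m ∈ range (d + 1),
      (m.choose (d - k) : ℝ) * h.coeff m * (-1) ^ (m - (d - k)) := by
    conv_lhs => rw [h1]
    rw [taylor_coeff, hasseDeriv_apply, Polynomial.sum_over_range' _ (by simp) (d + 1) (by omega),
      Polynomial.eval_finsetSum]
    simp
  rw [normCoeff, h2, ← Finset.sum_range_reflect, Finset.mul_sum, Finset.sum_div]
  refine Finset.sum_congr rfl fun j hj => ?_
  have hj : j ≤ d := by simpa [Nat.lt_succ_iff] using hj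
  rw [coeff_reverse_of_le hhd hj, show d + 1 - 1 - j = d - j by omega]
  have hdf : (d.descFactorial j : ℝ) ≠ 0 := by
    exact_mod_cast (Nat.descFactorial_eq_zero_iff_lt.not.2 (by omega))
  have hdc : (d.choose k : ℝ) ≠ 0 := by
    exact_mod_cast (Nat.choose_pos hk).ne'
  rcases Nat.lt_or_ge k j with hkj | hkj
  · rw [Nat.descFactorial_eq_zero_iff_lt.2 hkj, Nat.choose_eq_zero_of_lt (by omega)]; simp
  -- Dividing the binomial of the Taylor expansion by the normalizing `d.choose k` leaves `(k)_j /
  -- (d)_j`.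
  · have e1 : (d - j).choose (d - k) * d.descFactorial j = d.choose k * k.descFactorial j := by
      rw [Nat.descFactorial_eq_factorial_mul_choose, Nat.descFactorial_eq_factorial_mul_choose,
        Nat.choose_symm_of_eq_add (show d - j = d - k + (k - j) by omega)]
      have := Nat.choose_mul (n := d) hkj
      calc _ = j.factorial * (d.choose j * (d - j).choose (k - j)) := by ring
        _ = _ := by rw [← this]; ring
    have e2 : ((d - j).choose (d - k) : ℝ) * d.descFactorial j
        = d.choose k * k.descFactorial j := by exact_mod_cast e1
    have e3 : (-1 : ℝ) ^ k * (-1) ^ (d - j - (d - k)) = (-1) ^ j := by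
      rw [show d - j - (d - k) = k - j by omega]
      obtain ⟨c, rfl⟩ := Nat.exists_eq_add_of_le hkj
      rw [Nat.add_sub_cancel_left, pow_add, mul_assoc, ← pow_add, ← two_mul]
      simp
    have e4 : ((d - j).choose (d - k) : ℝ) / d.choose k = k.descFactorial j / d.descFactorial j := by
      rw [div_eq_div_iff hdc hdf, e2]; ring
    rw [← e3, ← e4]
    ring

lemma finiteFreeMulConv_coeff {d : ℕ} (p q : ℝ[X]) {k : ℕ} (hk : k ≤ d) :
    (finiteFreeMulConv d p q).coeff (d - k)
      = (-1) ^ k * (d.choose k : ℝ) * (normCoeff d p k * normCoeff d q k) := by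
  rw [finiteFreeMulConv, Polynomial.finsetSum_coeff, Finset.sum_eq_single k]
  · rw [Polynomial.coeff_C_mul, Polynomial.coeff_X_pow_self, mul_one]
  · intro j hj hjk
    have : j ≤ d := by simpa [Nat.lt_succ_iff] using hj
    rw [Polynomial.coeff_C_mul, Polynomial.coeff_X_pow, if_neg (by omega), mul_zero]
  · intro h
    exact absurd (Finset.mem_range.2 (by omega)) h

lemma natDegree_finiteFreeMulConv_le (d : ℕ) (p q : ℝ[X]) :
    (finiteFreeMulConv d p q).natDegree ≤ d := by
  refine Polynomial.natDegree_sum_le_of_forall_le _ _ fun k _ => ?_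
  exact (Polynomial.natDegree_C_mul_X_pow_le _ _).trans (Nat.sub_le _ _)

lemma normCoeff_zero {d : ℕ} {p : ℝ[X]} (hp : p.Monic) (hd : p.natDegree = d) :
    normCoeff d p 0 = 1 := by
  simp [normCoeff, ← hd, hp.leadingCoeff]

lemma finiteFreeMulConv_coeff_self {d : ℕ} {p q : ℝ[X]} (hp : p.Monic) (hpd : p.natDegree = d)
    (hq : q.Monic) (hqd : q.natDegree = d) : (finiteFreeMulConv d p q).coeff d = 1 := by
  have := finiteFreeMulConv_coeff (d := d) p q (Nat.zero_le _)
  simpa [normCoeff_zero hp hpd, normCoeff_zero hq hqd] using this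

lemma finiteFreeMulConv_natDegree {d : ℕ} {p q : ℝ[X]} (hp : p.Monic) (hpd : p.natDegree = d)
    (hq : q.Monic) (hqd : q.natDegree = d) : (finiteFreeMulConv d p q).natDegree = d :=
  Polynomial.natDegree_eq_of_le_of_coeff_ne_zero (natDegree_finiteFreeMulConv_le d p q)
    (by rw [finiteFreeMulConv_coeff_self hp hpd hq hqd]; exact one_ne_zero)

lemma finiteFreeMulConv_monic {d : ℕ} {p q : ℝ[X]} (hp : p.Monic) (hpd : p.natDegree = d)
    (hq : q.Monic) (hqd : q.natDegree = d) : (finiteFreeMulConv d p q).Monic :=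
  Polynomial.monic_of_natDegree_le_of_coeff_eq_one d (natDegree_finiteFreeMulConv_le d p q)
    (finiteFreeMulConv_coeff_self hp hpd hq hqd)

/-- The multiplier by which `⊠_d q` acts on the reversed polynomial with logarithmic Euler
derivative `d U`. -/
noncomputable def convMultiplier (d : ℕ) (q : ℝ[X]) (U : ℝ⟦X⟧) : ℝ⟦X⟧ :=
  ∑ j ∈ range (d + 1), ((-1) ^ j *
      PowerSeries.coeff j (((taylor 1 q).reverse : ℝ[X]) : ℝ⟦X⟧)) • normDeriv d U j

/-- The `k`-th coefficient of `P` is multiplied by a combination of the numbers `(k)_j / (d)_j`, and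
each of these acts on `P` as multiplication by a series not depending on `k`. So `P` factors out. -/
lemma reverse_finiteFreeMulConv {d : ℕ} {p q : ℝ[X]} (hp : p.Monic) (hpd : p.natDegree = d)
    (hq : q.Monic) (hqd : q.natDegree = d) {U : ℝ⟦X⟧}
    (hU : euler ((p.reverse : ℝ[X]) : ℝ⟦X⟧) = (d : ℝ) • (((p.reverse : ℝ[X]) : ℝ⟦X⟧) * U)) :
    (((finiteFreeMulConv d p q).reverse : ℝ[X]) : ℝ⟦X⟧)
      = ((p.reverse : ℝ[X]) : ℝ⟦X⟧) * convMultiplier d q U := by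
  have hdeg := finiteFreeMulConv_natDegree hp hpd hq hqd
  have key : ∀ j ≤ d, ∀ k, PowerSeries.coeff k (((p.reverse : ℝ[X]) : ℝ⟦X⟧) * normDeriv d U j)
      = PowerSeries.coeff k ((p.reverse : ℝ[X]) : ℝ⟦X⟧) *
        (k.descFactorial j / d.descFactorial j) := by
    intro j hj k
    have hdf : (d.descFactorial j : ℝ) ≠ 0 := by
      exact_mod_cast (Nat.descFactorial_eq_zero_iff_lt.not.2 (by omega))
    have := descFactorial_mul_coeff_normDeriv hU hj k
    field_simp
    linear_combination -this
  ext k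
  rw [convMultiplier, Finset.mul_sum, map_sum]
  have h1 : ∀ j ∈ range (d + 1), PowerSeries.coeff k (((p.reverse : ℝ[X]) : ℝ⟦X⟧) *
      (((-1) ^ j * PowerSeries.coeff j (((taylor 1 q).reverse : ℝ[X]) : ℝ⟦X⟧)) •
        normDeriv d U j)) = PowerSeries.coeff k ((p.reverse : ℝ[X]) : ℝ⟦X⟧) *
      ((-1) ^ j * PowerSeries.coeff j (((taylor 1 q).reverse : ℝ[X]) : ℝ⟦X⟧) *
        (k.descFactorial j / d.descFactorial j)) := by
    intro j hj
    have hj : j ≤ d := by simpa [Nat.lt_succ_iff] using hj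
    rw [mul_smul_comm, map_smul, key j hj, smul_eq_mul]
    ring
  rw [Finset.sum_congr rfl h1, ← Finset.mul_sum]
  rcases Nat.lt_or_ge d k with h | h
  -- Above degree `d` both sides vanish, although the multiplier is a genuine power series.
  · rw [coeff_reverse_of_lt hdeg h, coeff_reverse_of_lt hpd h, zero_mul]
  · rw [← normCoeff_eq_sum_taylor hqd h, coeff_reverse_of_le hdeg h, coeff_reverse_of_le hpd h,
      finiteFreeMulConv_coeff p q h]
    have hdc : (d.choose k : ℝ) ≠ 0 := by exact_mod_cast (Nat.choose_pos h).ne'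
    have h2 : (-1 : ℝ) ^ k * (-1) ^ k = 1 := by rw [← mul_pow]; simp
    rw [normCoeff.eq_def d p]
    field_simp
    linear_combination (p.coeff (d - k) * normCoeff d q k) * h2

/-! ### The limit of the multiplier and of the differences of power sums -/

/-- The generating series of the numbers `m n`, `n ≥ 1`. -/
noncomputable def momentSeries {K : Type*} [CommRing K] (m : ℕ → K) : K⟦X⟧ :=
  PowerSeries.mk fun n => if n = 0 then 0 else m n

lemma coeff_momentSeries {K : Type*} [CommRing K] (m : ℕ → K) {n : ℕ} (hn : n ≠ 0) :
    PowerSeries.coeff n (momentSeries m) = m n := by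
  rw [momentSeries, PowerSeries.coeff_mk, if_neg hn]

lemma constantCoeff_momentSeries {K : Type*} [CommRing K] (m : ℕ → K) :
    PowerSeries.constantCoeff (momentSeries m) = 0 := by
  rw [← PowerSeries.coeff_zero_eq_constantCoeff_apply]; simp [momentSeries]

lemma tendsto_convMultiplier {q : ℕ → ℝ[X]} {U : ℕ → ℝ⟦X⟧} {u a : ℝ⟦X⟧}
    (hU : Tendsto U atTop (𝓝 u)) (hU0 : ∀ d, PowerSeries.constantCoeff (U d) = 0)
    (hq : Tendsto (fun d => (((taylor 1 (q d)).reverse : ℝ[X]) : ℝ⟦X⟧)) atTop (𝓝 a)) :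
    Tendsto (fun d => convMultiplier d (q d) (U d)) atTop (𝓝 (a.subst (-u))) := by
  have hu0 : PowerSeries.constantCoeff u = 0 := by
    refine tendsto_nhds_unique (f := fun i => PowerSeries.constantCoeff (U i))
      (((PowerSeries.WithPiTopology.continuous_constantCoeff ℝ).tendsto _).comp hU) ?_
    simp [hU0]
  rw [PowerSeries.WithPiTopology.tendsto_iff_coeff_tendsto] at hq ⊢
  intro n
  have hv := fun j => (PowerSeries.WithPiTopology.tendsto_iff_coeff_tendsto _ _ _ _).1
    (tendsto_normDeriv hU j) n
  have hlim : PowerSeries.coeff n (a.subst (-u)) = ∑ j ∈ range (n + 1),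
      (-1) ^ j * PowerSeries.coeff j a * PowerSeries.coeff n (u ^ j) := by
    rw [coeff_subst_eq_sum (by simp [hu0])]
    refine Finset.sum_congr rfl fun j _ => ?_
    rw [neg_pow, ← map_one PowerSeries.C, ← map_neg, ← map_pow, PowerSeries.coeff_C_mul]
    ring
  rw [hlim]
  refine Tendsto.congr' ?_ (tendsto_finsetSum _ fun j _ => ((hq j).const_mul _).mul (hv j))
  -- Once `d ≥ n`, the terms `n < j ≤ d` contribute nothing in degree `n`.
  filter_upwards [eventually_ge_atTop n] with d hd
  rw [convMultiplier, map_sum]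
  symm
  rw [← Finset.sum_subset (s₁ := range (n + 1))]
  · refine Finset.sum_congr rfl fun j _ => ?_
    rw [map_smul, smul_eq_mul]
  · exact Finset.range_subset_range.2 (by omega)
  · intro j _ hj
    rw [map_smul, coeff_normDeriv_of_lt d (hU0 d) j n (by simpa using hj), smul_zero]

/-- The infinitesimal difference between the power sums of `p_d ⊠_d q_d` and of `p_d`, when the
moments of `p_d` converge and the power sums of `λ - 1`, `λ` a root of `q_d`, converge. -/
theorem tendsto_rootPowerSums_finiteFreeMulConv {p q : ℕ → ℝ[X]}
    (hp : ∀ d, 1 ≤ d → (p d).Monic) (hpd : ∀ d, 1 ≤ d → (p d).natDegree = d)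
    (hq : ∀ d, 1 ≤ d → (q d).Monic) (hqd : ∀ d, 1 ≤ d → (q d).natDegree = d) {m κ : ℕ → ℝ}
    (hm : ∀ n, n ≠ 0 →
      Tendsto (fun d : ℕ => PowerSeries.coeff n (rootPowerSums (p d)) / d) atTop (𝓝 (m n)))
    (hκ : ∀ n, n ≠ 0 →
      Tendsto (fun d => PowerSeries.coeff n (rootPowerSums (taylor 1 (q d)))) atTop (𝓝 (κ n)))
    (n : ℕ) :
    Tendsto (fun d => PowerSeries.coeff n (rootPowerSums (finiteFreeMulConv d (p d) (q d)))
      - PowerSeries.coeff n (rootPowerSums (p d))) atTop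
      (𝓝 (PowerSeries.coeff n (euler (momentSeries m) *
        (PowerSeries.mk fun k => κ (k + 1)).subst (momentSeries m)))) := by
  have hcc := fun m : ℕ → ℝ => constantCoeff_momentSeries m
  have hN : Tendsto (fun d => rootPowerSums (taylor 1 (q d))) atTop (𝓝 (momentSeries κ)) := by
    rw [PowerSeries.WithPiTopology.tendsto_iff_coeff_tendsto]
    intro k
    by_cases hk : k = 0
    · subst hk; simp [hcc, constantCoeff_rootPowerSums]
    · simpa [momentSeries, hk] using hκ k hk
  have htm : ∀ d, 1 ≤ d → (taylor 1 (q d)).Monic := fun d hd => by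
    rw [Polynomial.Monic, leadingCoeff_taylor]; exact hq d hd
  -- `a` is the limit of the products `∏ (1 - (λ - 1) X)` over the roots `λ` of `q_d`.
  obtain ⟨a, ha, ha0, haN⟩ := exists_tendsto_of_euler_eq
    (A := fun d => (((taylor 1 (q d)).reverse : ℝ[X]) : ℝ⟦X⟧))
    ((eventually_ge_atTop 1).mono fun d hd => constantCoeff_reverse (htm d hd))
    ((eventually_ge_atTop 1).mono fun d hd => euler_reverse (htm d hd)) hN
    (fun d => constantCoeff_rootPowerSums _)
  -- `U d = X P' / (d P)`, which tends to `-M` because power sums enter with a minus sign.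
  set U : ℕ → ℝ⟦X⟧ := fun d => -((d : ℝ)⁻¹ • rootPowerSums (p d)) with hUdef
  have hU : Tendsto U atTop (𝓝 (-momentSeries m)) := by
    refine Tendsto.neg ?_
    rw [PowerSeries.WithPiTopology.tendsto_iff_coeff_tendsto]
    intro k
    by_cases hk : k = 0
    · subst hk; simp [hcc, constantCoeff_rootPowerSums]
    · simp only [momentSeries, PowerSeries.coeff_mk, if_neg hk, map_smul, smul_eq_mul]
      refine (hm k hk).congr fun d => ?_
      rw [div_eq_inv_mul]
  have hU0 : ∀ d, PowerSeries.constantCoeff (U d) = 0 := fun d => by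
    simp [hUdef, constantCoeff_rootPowerSums]
  have hB := tendsto_convMultiplier hU hU0 ha
  rw [neg_neg] at hB
  set B := fun d => convMultiplier d (q d) (U d) with hBdef
  set M := momentSeries m with hM
  have hMs : PowerSeries.HasSubst M := PowerSeries.HasSubst.of_constantCoeff_zero' (hcc m)
  have h1 : ∀ d, 1 ≤ d → euler (((p d).reverse : ℝ[X]) : ℝ⟦X⟧)
      = (d : ℝ) • ((((p d).reverse : ℝ[X]) : ℝ⟦X⟧) * U d) := fun d hd => by
    have hd0 : (d : ℝ) ≠ 0 := by positivity
    rw [euler_reverse (hp d hd), hUdef]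
    simp [smul_smul, hd0]
  have hBc : ∀ d, 1 ≤ d → PowerSeries.constantCoeff (B d) = 1 := fun d hd => by
    have h4 := constantCoeff_reverse
      (finiteFreeMulConv_monic (hp d hd) (hpd d hd) (hq d hd) (hqd d hd))
    rwa [reverse_finiteFreeMulConv (hp d hd) (hpd d hd) (hq d hd) (hqd d hd) (h1 d hd), map_mul,
      constantCoeff_reverse (hp d hd), one_mul] at h4
  have hB0 : PowerSeries.constantCoeff (a.subst M : ℝ⟦X⟧) ≠ 0 := by
    rw [tendsto_nhds_unique (f := fun d => PowerSeries.constantCoeff (B d))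
      (((PowerSeries.WithPiTopology.continuous_constantCoeff ℝ).tendsto _).comp hB)
      (tendsto_const_nhds.congr' ((eventually_ge_atTop 1).mono fun d hd => (hBc d hd).symm))]
    exact one_ne_zero
  -- The logarithmic derivative of `P` cancels, so the difference of two sums over `d` roots is
  -- expressed exactly by `B d`, which has a limit.
  have hlog : ∀ d, 1 ≤ d → -(euler (B d) * (B d)⁻¹)
      = rootPowerSums (finiteFreeMulConv d (p d) (q d)) - rootPowerSums (p d) := by
    intro d hd
    have h2 := reverse_finiteFreeMulConv (hp d hd) (hpd d hd) (hq d hd) (hqd d hd) (h1 d hd)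
    have h3 := euler_reverse (finiteFreeMulConv_monic (hp d hd) (hpd d hd) (hq d hd) (hqd d hd))
    have h5 := constantCoeff_reverse (hp d hd)
    rw [h2, euler_mul, euler_reverse (hp d hd)] at h3
    have h6 := PowerSeries.mul_inv_cancel (B d) (by rw [hBc d hd]; exact one_ne_zero)
    have h7 : (((p d).reverse : ℝ[X]) : ℝ⟦X⟧) ≠ 0 := fun h => by
      rw [h] at h5; simp at h5
    have h8 : euler (B d) = -(B d) *
        (rootPowerSums (finiteFreeMulConv d (p d) (q d)) - rootPowerSums (p d)) := by
      refine mul_left_cancel₀ h7 ?_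
      linear_combination h3
    rw [h8]
    linear_combination
      (rootPowerSums (finiteFreeMulConv d (p d) (q d)) - rootPowerSums (p d)) * h6
  -- Chain rule together with `a' = -a N`.
  have hfin : -(euler (a.subst M : ℝ⟦X⟧) * (a.subst M : ℝ⟦X⟧)⁻¹)
      = euler M * (PowerSeries.mk fun k => κ (k + 1)).subst M := by
    have h1 : PowerSeries.derivative ℝ a = -(a * PowerSeries.mk fun k => κ (k + 1)) := by
      have hX : momentSeries κ = PowerSeries.X * PowerSeries.mk fun k => κ (k + 1) := by
        ext k
        rcases k with _ | k
        · simp [momentSeries]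
        · simp [momentSeries, PowerSeries.coeff_succ_X_mul]
      rw [hX, euler] at haN
      refine mul_left_cancel₀ PowerSeries.X_ne_zero ?_
      linear_combination haN
    have h2 := PowerSeries.mul_inv_cancel (a.subst M : ℝ⟦X⟧) hB0
    have h3 : (-(a * PowerSeries.mk fun k => κ (k + 1)) : ℝ⟦X⟧).subst M
        = -(a.subst M * (PowerSeries.mk fun k => κ (k + 1)).subst M : ℝ⟦X⟧) := by
      rw [← PowerSeries.coe_substAlgHom hMs, map_neg, map_mul]
    rw [euler_subst hMs, h1, h3]
    linear_combination (euler M * (PowerSeries.mk fun k => κ (k + 1)).subst M) * h2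
  have hT := ((tendsto_euler hB).mul (tendsto_powerSeries_inv hB hB0)).neg
  rw [hfin] at hT
  refine ((PowerSeries.WithPiTopology.tendsto_iff_coeff_tendsto _ _ _ _).1 hT n).congr' ?_
  filter_upwards [eventually_ge_atTop 1] with d hd
  rw [← map_sub, ← hlog d hd]

section NonCrossingSums

/-! ### Non-crossing partitions relative to a distinguished block -/

/-- `Q` is a partition of `S ∖ V` such that `Q ∪ {V}` is non-crossing. -/
structure IsNCRel (S V : Finset ℕ) (Q : Finset (Finset ℕ)) : Prop where
  nonempty : ∀ W ∈ Q, ∃ i, i ∈ W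
  subset : ∀ W ∈ Q, ∀ i ∈ W, i ∈ S ∧ i ∉ V
  cover : ∀ i ∈ S, i ∉ V → ∃ W ∈ Q, i ∈ W
  disjoint : ∀ U ∈ Q, ∀ W ∈ Q, ∀ i ∈ U, i ∈ W → U = W
  noncrossing : ∀ a b c d, a < b → b < c → c < d → ∀ U ∈ Q, ∀ W ∈ Q,
    a ∈ U → c ∈ U → b ∈ W → d ∈ W → U = W
  noncrossing_left : ∀ a b c d, a < b → b < c → c < d → ∀ W ∈ Q,
    a ∈ V → c ∈ V → b ∈ W → d ∈ W → False
  noncrossing_right : ∀ a b c d, a < b → b < c → c < d → ∀ W ∈ Q,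
    a ∈ W → c ∈ W → b ∈ V → d ∈ V → False

open scoped Classical in
/-- The finite set of all `Q` with `IsNCRel S V Q`. -/
noncomputable def ncRel (S V : Finset ℕ) : Finset (Finset (Finset ℕ)) :=
  S.powerset.powerset.filter fun Q => IsNCRel S V Q

open scoped Classical in
lemma mem_ncRel {S V : Finset ℕ} {Q : Finset (Finset ℕ)} : Q ∈ ncRel S V ↔ IsNCRel S V Q := by
  rw [ncRel, Finset.mem_filter, and_iff_right_iff_imp]
  intro h
  rw [Finset.mem_powerset]
  intro W hW
  rw [Finset.mem_powerset]
  exact fun i hi => (h.subset W hW i hi).1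

/-- The weighted count of the partitions `Q` with `IsNCRel S V Q`. -/
noncomputable def ncRelSum {A : Type*} [CommRing A] (r : ℕ → A) (S V : Finset ℕ) : A :=
  ∑ Q ∈ ncRel S V, ∏ W ∈ Q, r W.card

/-- The weighted count of `NC(n)`. -/
noncomputable def ncSum {A : Type*} [CommRing A] (r : ℕ → A) (n : ℕ) : A :=
  ∑ π ∈ NC n, ∏ V ∈ π.parts, r V.card

variable {A : Type*} [CommRing A] (r : ℕ → A)

/-- A crossing needs two points of each block, so a singleton block constrains nothing. -/
lemma ncRelSum_singleton (x y : ℕ) :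
    ncRelSum r (Ico x y) {x} = ncRelSum r (Ico (x + 1) y) ∅ := by
  have : ncRel (Ico x y) {x} = ncRel (Ico (x + 1) y) ∅ := by
    ext Q
    rw [mem_ncRel, mem_ncRel]
    constructor
    · rintro ⟨h1, h2, h3, h4, h5, h6, h7⟩
      refine ⟨h1, ?_, ?_, h4, h5, ?_, ?_⟩
      · intro W hW i hi
        have := h2 W hW i hi
        simp at this ⊢
        omega
      · intro i hi _
        refine h3 i ?_ ?_ <;> (simp at hi ⊢; omega)
      · simp
      · simp
    · rintro ⟨h1, h2, h3, h4, h5, h6, h7⟩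
      refine ⟨h1, ?_, ?_, h4, h5, ?_, ?_⟩
      · intro W hW i hi
        have := h2 W hW i hi
        simp at this ⊢
        omega
      · intro i hi hix
        rw [Finset.mem_Ico] at hi
        rw [Finset.mem_singleton] at hix
        exact h3 i (Finset.mem_Ico.2 (by omega)) (Finset.notMem_empty i)
      · intro a b c d h h' h'' W hW ha hc
        simp at ha hc; omega
      · intro a b c d h h' h'' W hW ha hc hb hd
        simp at hb hd; omega
  rw [ncRelSum, this, ncRelSum]

/-- Decomposition according to the block `V` of the smallest point. -/
lemma ncRelSum_eq_sum_block {x y : ℕ} (hxy : x < y) :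
    ncRelSum r (Ico x y) ∅ = ∑ V ∈ (Ico x y).powerset.filter (x ∈ ·),
      r V.card * ncRelSum r (Ico x y) V := by
  simp only [ncRelSum, Finset.mul_sum]
  rw [Finset.sum_sigma']
  symm
  refine Finset.sum_bij (fun VQ _ => insert VQ.1 VQ.2) ?_ ?_ ?_ ?_
  · rintro ⟨V, Q⟩ h
    simp only [mem_sigma, mem_filter, mem_powerset, mem_ncRel] at h ⊢
    obtain ⟨⟨hV, hx⟩, h1, h2, h3, h4, h5, h6, h7⟩ := h
    refine ⟨?_, ?_, ?_, ?_, ?_, by simp, by simp⟩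
    · intro W hW
      rcases Finset.mem_insert.1 hW with rfl | hW
      exacts [⟨x, hx⟩, h1 W hW]
    · intro W hW i hi
      refine ⟨?_, Finset.notMem_empty i⟩
      rcases Finset.mem_insert.1 hW with rfl | hW
      exacts [hV hi, (h2 W hW i hi).1]
    · intro i hi _
      by_cases hiV : i ∈ V
      · exact ⟨V, Finset.mem_insert_self _ _, hiV⟩
      · obtain ⟨W, hW, hiW⟩ := h3 i hi hiV
        exact ⟨W, Finset.mem_insert_of_mem hW, hiW⟩
    · intro U hU₀ W hW₀ i hi hi'
      rcases Finset.mem_insert.1 hU₀ with rfl | hU <;> rcases Finset.mem_insert.1 hW₀ with rfl | hW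
      · rfl
      · exact absurd hi (h2 W hW i hi').2
      · exact absurd hi' (h2 U hU i hi).2
      · exact h4 U hU W hW i hi hi'
    · intro a b c d hab hbc hcd U hU₀ W hW₀ ha hc hb hd
      rcases Finset.mem_insert.1 hU₀ with rfl | hU <;> rcases Finset.mem_insert.1 hW₀ with rfl | hW
      · rfl
      · exact (h6 a b c d hab hbc hcd W hW ha hc hb hd).elim
      · exact (h7 a b c d hab hbc hcd U hU ha hc hb hd).elim
      · exact h5 a b c d hab hbc hcd U hU W hW ha hc hb hd
  · rintro ⟨V, Q⟩ h ⟨V', Q'⟩ h' heq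
    simp only [mem_sigma, mem_filter, mem_powerset, mem_ncRel] at h h' heq
    obtain ⟨⟨hV, hx⟩, h1, h2, h3, h4, h5, h6, h7⟩ := h
    obtain ⟨⟨hV', hx'⟩, h1', h2', h3', h4', h5', h6', h7'⟩ := h'
    have hVQ : V ∉ Q := fun h => (h2 V h x hx).2 hx
    have hVQ' : V' ∉ Q' := fun h => (h2' V' h x hx').2 hx'
    have hVV : V = V' := by
      have : V ∈ insert V' Q' := heq ▸ Finset.mem_insert_self V Q
      rcases Finset.mem_insert.1 this with h | h
      · exact h
      · exact absurd hx' (h2' V h x hx).2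
    subst hVV
    have : Q = Q' := by
      rw [← Finset.erase_insert hVQ, heq, Finset.erase_insert hVQ']
    rw [this]
  · intro P hP
    rw [mem_ncRel] at hP
    obtain ⟨V, hV, hx⟩ := hP.cover x (by simp [hxy]) (by simp)
    refine ⟨⟨V, P.erase V⟩, ?_, Finset.insert_erase hV⟩
    simp only [mem_sigma, mem_filter, mem_powerset, mem_ncRel]
    obtain ⟨h1, h2, h3, h4, h5, h6, h7⟩ := hP
    have hE : ∀ W, W ∈ P.erase V ↔ W ≠ V ∧ W ∈ P := fun W => Finset.mem_erase
    refine ⟨⟨fun i hi => (h2 V hV i hi).1, hx⟩, ?_, ?_, ?_, ?_, ?_, ?_, ?_⟩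
    · exact fun W hW => h1 W ((hE W).1 hW).2
    · intro W hW i hi
      have hW := (hE W).1 hW
      exact ⟨(h2 W hW.2 i hi).1, fun h => hW.1 (h4 W hW.2 V hV i hi h)⟩
    · intro i hi hiV
      obtain ⟨W, hW, hiW⟩ := h3 i hi (Finset.notMem_empty i)
      exact ⟨W, (hE W).2 ⟨fun h => hiV (h ▸ hiW), hW⟩, hiW⟩
    · exact fun U hU W hW => h4 U ((hE U).1 hU).2 W ((hE W).1 hW).2
    · exact fun a b c d hab hbc hcd U hU W hW =>
        h5 a b c d hab hbc hcd U ((hE U).1 hU).2 W ((hE W).1 hW).2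
    · exact fun a b c d hab hbc hcd W hW ha hc hb hd =>
        ((hE W).1 hW).1 (h5 a b c d hab hbc hcd V hV W ((hE W).1 hW).2 ha hc hb hd).symm
    · exact fun a b c d hab hbc hcd W hW ha hc hb hd =>
        ((hE W).1 hW).1 (h5 a b c d hab hbc hcd W ((hE W).1 hW).2 V hV ha hc hb hd)
  · rintro ⟨V, Q⟩ h
    simp only [mem_sigma, mem_filter, mem_powerset, mem_ncRel] at h ⊢
    have hVQ : V ∉ Q := fun h' => (h.2.subset V h' x h.1.2).2 h.1.2
    rw [Finset.prod_insert hVQ]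

/-- Here `x` and `v` are consecutive in the distinguished block. No other block can meet both the
gap `(x, v)` and the points beyond `v`, so the count factors. -/
lemma ncRelSum_insert {x v y : ℕ} (hxv : x < v) (hvy : v < y) {V : Finset ℕ} (hV : V ⊆ Ico v y)
    (hv : v ∈ V) : ncRelSum r (Ico x y) (insert x V)
      = ncRelSum r (Ico (x + 1) v) ∅ * ncRelSum r (Ico v y) V := by
  simp only [ncRelSum]
  rw [Finset.sum_mul_sum, ← Finset.sum_product']
  have hV' : ∀ i ∈ V, v ≤ i ∧ i < y := fun i hi => by simpa using hV hi
  symm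
  refine Finset.sum_bij (fun QQ _ => QQ.1 ∪ QQ.2) ?_ ?_ ?_ ?_
  · rintro ⟨Q, R⟩ h
    simp only [mem_product, mem_ncRel] at h ⊢
    obtain ⟨⟨h1, h2, h3, h4, h5, h6, h7⟩, h1', h2', h3', h4', h5', h6', h7'⟩ := h
    simp only [Finset.mem_Ico, Finset.notMem_empty, not_false_eq_true, and_true] at h2 h3 h2' h3'
    have hU : ∀ W, W ∈ Q ∪ R ↔ W ∈ Q ∨ W ∈ R := fun W => Finset.mem_union
    have hxV : ∀ i, i ∈ insert x V ↔ i = x ∨ i ∈ V := fun i => Finset.mem_insert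
    refine ⟨?_, ?_, ?_, ?_, ?_, ?_, ?_⟩
    · intro W hW
      rcases (hU W).1 hW with hW | hW
      exacts [h1 W hW, h1' W hW]
    · intro W hW i hi
      rw [Finset.mem_Ico, hxV]
      rcases (hU W).1 hW with hW | hW
      · have := h2 W hW i hi
        exact ⟨by omega, fun h => h.elim (by omega) fun h => by have := hV' i h; omega⟩
      · have := h2' W hW i hi
        exact ⟨by omega, fun h => h.elim (by omega) this.2⟩
    · intro i hi hiV
      rw [Finset.mem_Ico] at hi
      rw [hxV, not_or] at hiV
      rcases Nat.lt_or_ge i v with h | h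
      · obtain ⟨W, hW, hiW⟩ := h3 i (by omega) trivial
        exact ⟨W, (hU W).2 (.inl hW), hiW⟩
      · obtain ⟨W, hW, hiW⟩ := h3' i (by omega) hiV.2
        exact ⟨W, (hU W).2 (.inr hW), hiW⟩
    · intro U hU' W hW i hi hi'
      rcases (hU U).1 hU' with hU' | hU' <;> rcases (hU W).1 hW with hW | hW
      · exact h4 U hU' W hW i hi hi'
      · have := h2 U hU' i hi; have := h2' W hW i hi'; omega
      · have := h2' U hU' i hi; have := h2 W hW i hi'; omega
      · exact h4' U hU' W hW i hi hi'
    · intro a b c d hab hbc hcd U hU' W hW ha hc hb hd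
      rcases (hU U).1 hU' with hU' | hU' <;> rcases (hU W).1 hW with hW | hW
      · exact h5 a b c d hab hbc hcd U hU' W hW ha hc hb hd
      · have := h2 U hU' c hc; have := h2' W hW b hb; omega
      · have := h2' U hU' a ha; have := h2 W hW d hd; omega
      · exact h5' a b c d hab hbc hcd U hU' W hW ha hc hb hd
    · intro a b c d hab hbc hcd W hW ha hc hb hd
      rw [hxV] at ha hc
      have hcV : c ∈ V := by
        rcases hc with rfl | hc
        · rcases ha with rfl | ha
          · omega
          · have := hV' a ha; omega
        · exact hc
      have hc' := hV' c hcV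
      rcases (hU W).1 hW with hW | hW
      · have := h2 W hW d hd; omega
      · have hb' := h2' W hW b hb
        rcases ha with rfl | ha
        -- The point `a = x` is absent from `V` and is replaced by `v`, which is still below `b`.
        · rcases Nat.lt_or_ge v b with h | h
          · exact h6' v b c d h hbc hcd W hW hv hcV hb hd
          · exact hb'.2 ((show v = b by omega) ▸ hv)
        · exact h6' a b c d hab hbc hcd W hW ha hcV hb hd
    · intro a b c d hab hbc hcd W hW ha hc hb hd
      rw [hxV] at hb hd
      rcases (hU W).1 hW with hW | hW
      · have := h2 W hW a ha
        have := h2 W hW c hc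
        rcases hb with rfl | hb
        · omega
        · have := hV' b hb; omega
      · have := h2' W hW a ha
        exact h7' a b c d hab hbc hcd W hW ha hc (hb.resolve_left (by omega))
          (hd.resolve_left (by omega))
  · rintro ⟨Q, R⟩ h ⟨Q', R'⟩ h' heq
    simp only [mem_product, mem_ncRel] at h h' heq
    -- The two factors are recovered from their union by comparing blocks with `v`; nonemptiness of
    -- blocks makes the two conditions exclusive.
    have key : ∀ {Q R : Finset (Finset ℕ)}, IsNCRel (Ico (x + 1) v) ∅ Q → IsNCRel (Ico v y) V R →
        Q = (Q ∪ R).filter (∀ i ∈ ·, i < v) ∧ R = (Q ∪ R).filter (∀ i ∈ ·, v ≤ i) := by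
      intro Q R hQ hR
      have h1 := hQ.nonempty
      have h2 := hQ.subset
      have h1' := hR.nonempty
      have h2' := hR.subset
      simp only [Finset.mem_Ico, Finset.notMem_empty, not_false_eq_true, and_true] at h2 h2'
      constructor
      · ext W
        rw [Finset.mem_filter, Finset.mem_union]
        refine ⟨fun h => ⟨.inl h, fun i hi => (h2 W h i hi).2⟩, fun h => h.1.resolve_right fun h' => ?_⟩
        obtain ⟨i, hi⟩ := h1' W h'
        have := h2' W h' i hi
        have := h.2 i hi
        omega
      · ext W
        rw [Finset.mem_filter, Finset.mem_union]
        refine ⟨fun h => ⟨.inr h, fun i hi => (h2' W h i hi).1.1⟩,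
          fun h => h.1.resolve_left fun h' => ?_⟩
        obtain ⟨i, hi⟩ := h1 W h'
        have := h2 W h' i hi
        have := h.2 i hi
        omega
    obtain ⟨a, b⟩ := key h.1 h.2
    obtain ⟨a', b'⟩ := key h'.1 h'.2
    rw [Prod.mk.injEq]
    exact ⟨by rw [a, heq, ← a'], by rw [b, heq, ← b']⟩
  · intro P hP
    rw [mem_ncRel] at hP
    obtain ⟨h1, h2, h3, h4, h5, h6, h7⟩ := hP
    -- A block with `i < v < j` would cross the distinguished block at `x < i < v < j`.
    have hsplit : ∀ W ∈ P, (∀ i ∈ W, i < v) ∨ (∀ i ∈ W, v ≤ i) := by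
      intro W hW
      by_contra! hcon
      obtain ⟨⟨j, hj, hjv⟩, i, hi, hiv⟩ := hcon
      have hi' := h2 W hW i hi
      have hj' := h2 W hW j hj
      simp only [Finset.mem_Ico, Finset.mem_insert, not_or] at hi' hj'
      refine h6 x i v j ?_ hiv ?_ W hW (by simp) (by simp [hv]) hi hj
      · omega
      · exact lt_of_le_of_ne hjv (fun h => hj'.2.2 (h ▸ hv))
    refine ⟨(P.filter (∀ i ∈ ·, i < v), P.filter (∀ i ∈ ·, v ≤ i)), ?_, ?_⟩
    · simp only [mem_product, mem_ncRel]
      simp only [Finset.mem_Ico, Finset.mem_insert, not_or] at h2 h3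
      have hL : ∀ W, W ∈ P.filter (∀ i ∈ ·, i < v) ↔ W ∈ P ∧ ∀ i ∈ W, i < v :=
        fun W => Finset.mem_filter
      have hG : ∀ W, W ∈ P.filter (∀ i ∈ ·, v ≤ i) ↔ W ∈ P ∧ ∀ i ∈ W, v ≤ i :=
        fun W => Finset.mem_filter
      constructor
      · refine ⟨?_, ?_, ?_, ?_, ?_, by simp, by simp⟩
        · exact fun W hW => h1 W ((hL W).1 hW).1
        · intro W hW i hi
          have hW := (hL W).1 hW
          have h := h2 W hW.1 i hi
          have := hW.2 i hi
          exact ⟨Finset.mem_Ico.2 (by omega), Finset.notMem_empty i⟩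
        · intro i hi _
          rw [Finset.mem_Ico] at hi
          obtain ⟨W, hW, hiW⟩ := h3 i (by omega) ⟨by omega, fun h => by have := hV' i h; omega⟩
          refine ⟨W, (hL W).2 ⟨hW, (hsplit W hW).resolve_right fun h => ?_⟩, hiW⟩
          have := h i hiW
          omega
        · exact fun U hU W hW => h4 U ((hL U).1 hU).1 W ((hL W).1 hW).1
        · exact fun a b c d hab hbc hcd U hU W hW =>
            h5 a b c d hab hbc hcd U ((hL U).1 hU).1 W ((hL W).1 hW).1
      · refine ⟨?_, ?_, ?_, ?_, ?_, ?_, ?_⟩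
        · exact fun W hW => h1 W ((hG W).1 hW).1
        · intro W hW i hi
          have hW := (hG W).1 hW
          have h := h2 W hW.1 i hi
          have := hW.2 i hi
          exact ⟨Finset.mem_Ico.2 (by omega), h.2.2⟩
        · intro i hi hiV
          rw [Finset.mem_Ico] at hi
          obtain ⟨W, hW, hiW⟩ := h3 i (by omega) ⟨by omega, hiV⟩
          refine ⟨W, (hG W).2 ⟨hW, (hsplit W hW).resolve_left fun h => ?_⟩, hiW⟩
          have := h i hiW
          omega
        · exact fun U hU W hW => h4 U ((hG U).1 hU).1 W ((hG W).1 hW).1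
        · exact fun a b c d hab hbc hcd U hU W hW =>
            h5 a b c d hab hbc hcd U ((hG U).1 hU).1 W ((hG W).1 hW).1
        · exact fun a b c d hab hbc hcd W hW ha hc =>
            h6 a b c d hab hbc hcd W ((hG W).1 hW).1 (Finset.mem_insert_of_mem ha)
              (Finset.mem_insert_of_mem hc)
        · exact fun a b c d hab hbc hcd W hW ha hc hb hd =>
            h7 a b c d hab hbc hcd W ((hG W).1 hW).1 ha hc (Finset.mem_insert_of_mem hb)
              (Finset.mem_insert_of_mem hd)
    · ext W
      rw [Finset.mem_union, Finset.mem_filter, Finset.mem_filter, ← and_or_left]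
      exact and_iff_left_of_imp (hsplit W)
  · rintro ⟨Q, R⟩ h
    simp only [mem_product, mem_ncRel] at h ⊢
    rw [Finset.prod_union]
    rw [Finset.disjoint_left]
    intro W hW hW'
    obtain ⟨i, hi⟩ := h.1.nonempty W hW
    have h2 := h.1.subset W hW i hi
    have h2' := h.2.subset W hW' i hi
    simp only [Finset.mem_Ico] at h2 h2'
    omega

/-! ### Sums over subsets with given minimum, one element at a time -/

/-- The subsets of `[x, y)` of cardinality `k` that contain `x`. -/
def subsetsFrom (x y k : ℕ) : Finset (Finset ℕ) :=
  (Ico x y).powerset.filter fun V => x ∈ V ∧ V.card = k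

lemma mem_subsetsFrom {x y k : ℕ} {V : Finset ℕ} :
    V ∈ subsetsFrom x y k ↔ (∀ i ∈ V, x ≤ i ∧ i < y) ∧ x ∈ V ∧ V.card = k := by
  simp [subsetsFrom, Finset.subset_iff]

lemma subsetsFrom_one {x y : ℕ} (hxy : x < y) : subsetsFrom x y 1 = {{x}} := by
  ext V
  rw [mem_subsetsFrom, Finset.mem_singleton]
  constructor
  · rintro ⟨_, hx, hc⟩
    obtain ⟨a, rfl⟩ := Finset.card_eq_one.1 hc
    rw [Finset.mem_singleton.1 hx]
  · rintro rfl
    simp [hxy]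

/-- `v` is the second smallest element. -/
lemma sum_subsetsFrom_succ (x y k : ℕ) (F : Finset ℕ → A) :
    ∑ V ∈ subsetsFrom x y (k + 2), F V
      = ∑ v ∈ Ioo x y, ∑ V ∈ subsetsFrom v y (k + 1), F (insert x V) := by
  rw [Finset.sum_sigma']
  symm
  refine Finset.sum_bij (fun vV _ => insert x vV.2) ?_ ?_ ?_ ?_
  · rintro ⟨v, V⟩ h
    simp only [mem_sigma, Finset.mem_Ioo, mem_subsetsFrom] at h ⊢
    obtain ⟨⟨h1, h2⟩, h3, h4, h5⟩ := h
    refine ⟨?_, by simp, ?_⟩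
    · grind
    · rw [Finset.card_insert_of_notMem, h5]
      grind
  · rintro ⟨v, V⟩ h ⟨v', V'⟩ h' heq
    simp only [mem_sigma, Finset.mem_Ioo, mem_subsetsFrom] at h h' heq
    have hx : x ∉ V := fun hx => by have := h.2.1 x hx; omega
    have hx' : x ∉ V' := fun hx => by have := h'.2.1 x hx; omega
    have hVV : V = V' := by rw [← Finset.erase_insert hx, heq, Finset.erase_insert hx']
    subst hVV
    have : v = v' := le_antisymm (h.2.1 _ h'.2.2.1).1 (h'.2.1 _ h.2.2.1).1
    rw [this]
  · intro V hV
    rw [mem_subsetsFrom] at hV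
    obtain ⟨h1, h2, h3⟩ := hV
    have hc : (V.erase x).card = k + 1 := by rw [Finset.card_erase_of_mem h2, h3]; rfl
    have hne : (V.erase x).Nonempty := Finset.card_pos.1 (by omega)
    refine ⟨⟨(V.erase x).min' hne, V.erase x⟩, ?_, Finset.insert_erase h2⟩
    have hm := Finset.min'_mem _ hne
    have hle := fun i hi => Finset.min'_le (V.erase x) i hi
    set v := (V.erase x).min' hne
    simp only [mem_sigma, Finset.mem_Ioo, mem_subsetsFrom]
    refine ⟨?_, ?_, hm, hc⟩
    · have := Finset.mem_erase.1 hm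
      have := h1 v this.2
      omega
    · intro i hi
      exact ⟨hle i hi, (h1 i (Finset.mem_of_mem_erase hi)).2⟩
  · intros; rfl

/-! ### Transport to `NC(n)` -/

/-- The recursion cuts intervals of `ℕ`, where no reindexing is needed; only the final count is
carried to `Fin n`, and it depends on the length alone. -/
lemma ncRelSum_Ico (x n : ℕ) : ncRelSum r (Ico x (x + n)) ∅ = ncSum r n := by
  let e : Fin n ↪ ℕ := ⟨fun i => x + i, fun i j h => Fin.ext (by simpa using h)⟩
  have he : ∀ i j : Fin n, e i < e j ↔ i < j := fun i j => by
    change x + (i : ℕ) < x + j ↔ i < j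
    rw [Fin.lt_def]
    omega
  have hmem : ∀ k, k ∈ Ico x (x + n) ↔ ∃ i : Fin n, e i = k := by
    intro k
    rw [Finset.mem_Ico]
    constructor
    · intro h; exact ⟨⟨k - x, by omega⟩, by change x + (k - x) = k; omega⟩
    · rintro ⟨i, rfl⟩
      change x ≤ x + (i : ℕ) ∧ x + (i : ℕ) < x + n
      omega
  let φ : Finset (Fin n) ↪ Finset ℕ := ⟨fun V => V.map e, Finset.map_injective e⟩
  rw [ncRelSum, ncSum]
  symm
  refine Finset.sum_bij (fun π _ => π.parts.map φ) ?_ ?_ ?_ ?_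
  · intro π hπ
    have hnc : IsNoncrossing π := (Finset.mem_filter.1 hπ).2
    rw [mem_ncRel]
    refine ⟨?_, ?_, ?_, ?_, ?_, by simp, by simp⟩
    · intro W hW
      obtain ⟨V, hV, rfl⟩ := Finset.mem_map.1 hW
      obtain ⟨i, hi⟩ := π.nonempty_of_mem_parts hV
      exact ⟨e i, Finset.mem_map_of_mem e hi⟩
    · intro W hW i hi
      obtain ⟨V, hV, rfl⟩ := Finset.mem_map.1 hW
      obtain ⟨j, hj, rfl⟩ := Finset.mem_map.1 hi
      exact ⟨(hmem _).2 ⟨j, rfl⟩, by simp⟩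
    · intro i hi _
      obtain ⟨j, rfl⟩ := (hmem i).1 hi
      exact ⟨φ (π.part j), Finset.mem_map_of_mem φ (π.part_mem.2 (Finset.mem_univ j)),
        Finset.mem_map_of_mem e (π.mem_part (Finset.mem_univ j))⟩
    · intro U hU W hW i hi hi'
      obtain ⟨V, hV, rfl⟩ := Finset.mem_map.1 hU
      obtain ⟨V', hV', rfl⟩ := Finset.mem_map.1 hW
      obtain ⟨j, hj, rfl⟩ := Finset.mem_map.1 hi
      have hj' := (Finset.mem_map' e).1 hi'
      rw [π.eq_of_mem_parts hV hV' hj hj']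
    · intro a b c d hab hbc hcd U hU W hW ha hc hb hd
      obtain ⟨V, hV, rfl⟩ := Finset.mem_map.1 hU
      obtain ⟨V', hV', rfl⟩ := Finset.mem_map.1 hW
      obtain ⟨a, -, rfl⟩ := Finset.mem_map.1 ha
      obtain ⟨b, -, rfl⟩ := Finset.mem_map.1 hb
      obtain ⟨c, -, rfl⟩ := Finset.mem_map.1 hc
      obtain ⟨d, -, rfl⟩ := Finset.mem_map.1 hd
      rw [hnc a b c d ((he _ _).1 hab) ((he _ _).1 hbc) ((he _ _).1 hcd) V hV V' hV' ((Finset.mem_map' e).1 ha)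
        ((Finset.mem_map' e).1 hc) ((Finset.mem_map' e).1 hb) ((Finset.mem_map' e).1 hd)]
  · intro π _ π' _ h
    exact Finpartition.ext (Finset.map_injective φ h)
  · intro Q hQ
    rw [mem_ncRel] at hQ
    have hpre : ∀ W ∈ Q, φ (W.preimage e e.injective.injOn) = W := by
      intro W hW
      ext k
      simp only [φ, Function.Embedding.coeFn_mk, Finset.mem_map, Finset.mem_preimage]
      constructor
      · rintro ⟨i, hi, rfl⟩; exact hi
      · intro hk
        obtain ⟨i, rfl⟩ := (hmem k).1 (hQ.subset W hW k hk).1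
        exact ⟨i, hk, rfl⟩
    have hmemQ : ∀ V : Finset (Fin n),
        V ∈ Q.image (fun W => W.preimage e e.injective.injOn) ↔ φ V ∈ Q := by
      intro V
      rw [Finset.mem_image]
      constructor
      · rintro ⟨W, hW, rfl⟩; rwa [hpre W hW]
      · intro h
        exact ⟨_, h, φ.injective (hpre _ h)⟩
    let π : SetPartition n := Finpartition.ofExistsUnique
      (Q.image fun W => W.preimage e e.injective.injOn) (fun V _ => Finset.subset_univ V)
      (by
        intro i _
        obtain ⟨W, hW, hi⟩ := hQ.cover (e i) ((hmem _).2 ⟨i, rfl⟩) (by simp)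
        refine ⟨W.preimage e e.injective.injOn, ⟨Finset.mem_image_of_mem _ hW, by simpa using hi⟩, ?_⟩
        rintro V ⟨hV, hiV⟩
        rw [hmemQ] at hV
        exact φ.injective ((hQ.disjoint _ hV _ hW (e i) (Finset.mem_map_of_mem e hiV) hi).trans
          (hpre W hW).symm))
      (by
        intro h
        rw [hmemQ] at h
        obtain ⟨i, hi⟩ := hQ.nonempty _ h
        simp [φ] at hi)
    have hπ : ∀ V, V ∈ π.parts ↔ φ V ∈ Q := hmemQ
    refine ⟨π, ?_, ?_⟩
    · refine Finset.mem_filter.2 ⟨Finset.mem_univ _, ?_⟩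
      intro a b c d hab hbc hcd V hV W hW ha hc hb hd
      exact φ.injective (hQ.noncrossing (e a) (e b) (e c) (e d) ((he _ _).2 hab) ((he _ _).2 hbc)
        ((he _ _).2 hcd) _ ((hπ V).1 hV) _ ((hπ W).1 hW) (Finset.mem_map_of_mem e ha)
        (Finset.mem_map_of_mem e hc) (Finset.mem_map_of_mem e hb) (Finset.mem_map_of_mem e hd))
    · ext W
      rw [Finset.mem_map]
      constructor
      · rintro ⟨V, hV, rfl⟩; exact (hπ V).1 hV
      · intro hW
        exact ⟨_, (hπ _).2 (by rwa [hpre W hW]), hpre W hW⟩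
  · intro π _
    rw [Finset.prod_map]
    refine Finset.prod_congr rfl fun V _ => ?_
    simp [φ]

lemma ncRelSum_Ico' {x y : ℕ} (h : x ≤ y) : ncRelSum r (Ico x y) ∅ = ncSum r (y - x) := by
  obtain ⟨n, rfl⟩ := Nat.exists_eq_add_of_le h
  rw [ncRelSum_Ico, Nat.add_sub_cancel_left]

/-! ### The functional equation for non-crossing sums -/

/-- The series `X (1 + M(X))`, with `M` the generating series of the weighted counts of `NC(n)`. -/
noncomputable def ncSeries : A⟦X⟧ := PowerSeries.X * PowerSeries.mk (ncSum r)

lemma coeff_ncSeries {n : ℕ} (hn : n ≠ 0) : PowerSeries.coeff n (ncSeries r) = ncSum r (n - 1) := by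
  obtain ⟨k, rfl⟩ := Nat.exists_eq_succ_of_ne_zero hn
  simp [ncSeries, PowerSeries.coeff_succ_X_mul]

lemma constantCoeff_ncSeries : PowerSeries.constantCoeff (ncSeries r) = 0 := by simp [ncSeries]

/-- Convolution of coefficients along an interval. -/
lemma sum_Ioc_coeff_mul_coeff {f g : A⟦X⟧} (hf : PowerSeries.constantCoeff f = 0) {x y : ℕ}
    (hxy : x ≤ y) : ∑ v ∈ Ioc x y, PowerSeries.coeff (v - x) f * PowerSeries.coeff (y - v) g
      = PowerSeries.coeff (y - x) (f * g) := by
  rw [PowerSeries.coeff_mul]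
  refine Finset.sum_of_injOn (fun v => (v - x, y - v)) ?_ ?_ ?_ ?_
  · intro v hv w hw h
    simp only [coe_Ioc, Set.mem_Ioc, Prod.mk.injEq] at hv hw h
    omega
  · intro v hv
    simp only [coe_Ioc, Set.mem_Ioc] at hv
    rw [Finset.mem_coe, HasAntidiagonal.mem_antidiagonal]
    dsimp only
    omega
  · rintro ⟨a, b⟩ hab hnot
    rw [HasAntidiagonal.mem_antidiagonal] at hab
    simp only at hab
    rcases Nat.eq_zero_or_pos a with rfl | ha
    · simp [hf]
    refine absurd ⟨x + a, ?_, ?_⟩ hnot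
    · simp only [coe_Ioc, Set.mem_Ioc]; omega
    · simp only [Prod.mk.injEq]; omega
  · intros; rfl

lemma sum_Ioo_coeff_mul_coeff {f g : A⟦X⟧} (hf : PowerSeries.constantCoeff f = 0)
    (hg : PowerSeries.constantCoeff g = 0) {x y : ℕ} (hxy : x < y) :
    ∑ v ∈ Ioo x y, PowerSeries.coeff (v - x) f * PowerSeries.coeff (y - v) g
      = PowerSeries.coeff (y - x) (f * g) := by
  rw [← sum_Ioc_coeff_mul_coeff hf hxy.le, ← Finset.Ioo_insert_right hxy,
    Finset.sum_insert Finset.right_notMem_Ioo, Nat.sub_self,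
    PowerSeries.coeff_zero_eq_constantCoeff_apply, hg, mul_zero, zero_add]

/-- Each of the `k + 1` points of `V` contributes a factor `X (1 + M)`: the point itself, and an
arbitrary non-crossing partition of the gap up to the next point or to `y`. -/
lemma sum_subsetsFrom_ncRelSum {x y : ℕ} (hxy : x < y) (k : ℕ) :
    ∑ V ∈ subsetsFrom x y (k + 1), ncRelSum r (Ico x y) V
      = PowerSeries.coeff (y - x) (ncSeries r ^ (k + 1)) := by
  induction k generalizing x with
  | zero =>
    rw [zero_add, subsetsFrom_one hxy, Finset.sum_singleton, ncRelSum_singleton,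
      ncRelSum_Ico' r hxy, pow_one, coeff_ncSeries r (by omega), Nat.sub_sub]
  | succ k ih =>
    rw [sum_subsetsFrom_succ, pow_succ', ← sum_Ioo_coeff_mul_coeff (constantCoeff_ncSeries r)
      (by simp [constantCoeff_ncSeries]) hxy]
    refine Finset.sum_congr rfl fun v hv => ?_
    rw [Finset.mem_Ioo] at hv
    rw [← ih hv.2, Finset.mul_sum]
    refine Finset.sum_congr rfl fun V hV => ?_
    rw [mem_subsetsFrom] at hV
    rw [ncRelSum_insert r hv.1 hv.2 (fun i hi => by simpa using hV.1 i hi) hV.2.1,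
      ncRelSum_Ico' r hv.1, coeff_ncSeries r (by omega), Nat.sub_sub]

/-- The functional equation `M(X) = R(X (1 + M(X)))` between weights and weighted counts of
non-crossing partitions, coefficientwise. -/
theorem ncSum_eq_sum_coeff {n : ℕ} (hn : n ≠ 0) :
    ncSum r n = ∑ k ∈ range (n + 1), r k * PowerSeries.coeff n (ncSeries r ^ k) := by
  rw [Finset.sum_range_succ', ← Nat.sub_zero n, ← ncRelSum_Ico' r (Nat.zero_le n),
    ncRelSum_eq_sum_block r (by omega), Nat.sub_zero]
  have h0 : r 0 * PowerSeries.coeff n (ncSeries r ^ 0) = 0 := by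
    simp [PowerSeries.coeff_one, hn]
  -- Group the possible blocks of the point `0` by cardinality, which runs from `1` to `n`.
  rw [h0, add_zero, ← Finset.sum_fiberwise_of_maps_to (t := (range n).map ⟨Nat.succ, Nat.succ_injective⟩)
    (g := Finset.card)]
  · rw [Finset.sum_map]
    refine Finset.sum_congr rfl fun k _ => ?_
    have h1 := sum_subsetsFrom_ncRelSum r (Nat.pos_of_ne_zero hn) k
    rw [Nat.sub_zero] at h1
    rw [← h1, Finset.mul_sum]
    refine Finset.sum_congr ?_ ?_
    · rw [subsetsFrom, Finset.filter_filter]; rfl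
    · intro V hV
      rw [(mem_subsetsFrom.1 hV).2.2]
  · intro V hV
    rw [Finset.mem_filter, Finset.mem_powerset] at hV
    have h1 := Finset.card_le_card hV.1
    have h2 := Finset.card_pos.2 ⟨0, hV.2⟩
    rw [Nat.card_Ico, Nat.sub_zero] at h1
    rw [Finset.mem_map]
    exact ⟨V.card - 1, by rw [Finset.mem_range]; omega, by simp; omega⟩

end NonCrossingSums

/-! ### The Kreweras complement of a non-crossing partition -/

section Kreweras

variable {n : ℕ}

lemma mem_part_iff (π : SetPartition n) (a b : Fin n) : a ∈ π.part b ↔ π.part a = π.part b :=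
  π.mem_part_iff_part_eq_part (Finset.mem_univ a) (Finset.mem_univ b)

lemma setPartition_ext {π τ : SetPartition n}
    (h : ∀ a b, π.part a = π.part b ↔ τ.part a = τ.part b) : π = τ := by
  have hp : ∀ a, π.part a = τ.part a := fun a => by
    ext b; rw [mem_part_iff, mem_part_iff, h]
  have key : ∀ {π τ : SetPartition n}, (∀ a, π.part a = τ.part a) → π.parts ⊆ τ.parts := by
    intro π τ hp V hV
    obtain ⟨a, ha⟩ := π.nonempty_of_mem_parts hV
    rw [← π.part_eq_of_mem hV ha, hp]
    exact τ.part_mem.2 (Finset.mem_univ a)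
  exact Finpartition.ext (Finset.Subset.antisymm (key hp) (key fun a => (hp a).symm))

lemma isNoncrossing_iff_part {π : SetPartition n} : IsNoncrossing π ↔
    ∀ a b c d : Fin n, a < b → b < c → c < d → π.part a = π.part c → π.part b = π.part d →
      π.part a = π.part b := by
  constructor
  · intro h a b c d hab hbc hcd hac hbd
    exact h a b c d hab hbc hcd _ (π.part_mem.2 (Finset.mem_univ a)) _
      (π.part_mem.2 (Finset.mem_univ b)) ((mem_part_iff _ _ _).2 rfl)
      ((mem_part_iff _ _ _).2 hac.symm) ((mem_part_iff _ _ _).2 rfl)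
      ((mem_part_iff _ _ _).2 hbd.symm)
  · intro h a b c d hab hbc hcd V hV W hW ha hc hb hd
    rw [← π.part_eq_of_mem hV ha, ← π.part_eq_of_mem hW hb]
    refine h a b c d hab hbc hcd ?_ ?_
    · rw [π.part_eq_of_mem hV ha, π.part_eq_of_mem hV hc]
    · rw [π.part_eq_of_mem hW hb, π.part_eq_of_mem hW hd]

/-- `blockPerm` sends an element to the next one in its block, or from the maximum to the
minimum. -/
lemma blockPerm_spec (π : SetPartition n) (i : Fin n) :
    π.part (blockPerm π i) = π.part i ∧
    ((i < blockPerm π i ∧ ∀ x, π.part x = π.part i → ¬(i < x ∧ x < blockPerm π i)) ∨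
      ∀ x, π.part x = π.part i → x ≤ i ∧ blockPerm π i ≤ x) := by
  set l := (π.part i).sort (· ≤ ·) with hl
  have hb : blockPerm π i = l.formPerm i := rfl
  have hnd : l.Nodup := Finset.sort_nodup _ _
  have hmem : ∀ x, x ∈ l ↔ π.part x = π.part i := fun x => by
    rw [hl, Finset.mem_sort, mem_part_iff]
  have hmono : ∀ j k (hj : j < l.length) (hk : k < l.length), l[j] < l[k] ↔ j < k :=
    fun j k hj hk => (Finset.sortedLT_sort (π.part i)).getElem_lt_getElem_iff
  obtain ⟨k, hk, hki⟩ := List.mem_iff_getElem.1 ((hmem i).2 rfl)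
  have hval := List.formPerm_apply_getElem l hnd k hk
  rw [hki, ← hb] at hval
  refine ⟨(hmem _).1 (by rw [hval]; exact List.getElem_mem _), ?_⟩
  rcases Nat.lt_or_ge (k + 1) l.length with h | h
  · left
    have hval' : blockPerm π i = l[k + 1] := by
      rw [hval]; congr 1; exact Nat.mod_eq_of_lt h
    rw [hval']
    refine ⟨?_, ?_⟩
    · conv_lhs => rw [← hki]
      exact (hmono _ _ _ _).2 (Nat.lt_succ_self k)
    · intro x hx ⟨h1, h2⟩
      obtain ⟨m, hm, rfl⟩ := List.mem_iff_getElem.1 ((hmem x).2 hx)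
      rw [← hki] at h1
      have h1 := (hmono _ _ _ _).1 h1
      have h2 := (hmono _ _ _ _).1 h2
      omega
  · right
    have hk1 : k + 1 = l.length := by omega
    have hval' : blockPerm π i = l[0] := by
      rw [hval]; congr 1; rw [hk1, Nat.mod_self]
    rw [hval']
    intro x hx
    obtain ⟨m, hm, rfl⟩ := List.mem_iff_getElem.1 ((hmem x).2 hx)
    constructor
    · rw [← not_lt, ← hki, hmono]; omega
    · rw [← not_lt, hmono]; omega

lemma val_finRotate_of_lt {a b : Fin n} (h : a < b) : (finRotate n a : ℕ) = a + 1 := by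
  obtain ⟨m, rfl⟩ : ∃ m, n = m + 1 := ⟨n - 1, by have := a.2; omega⟩
  exact coe_finRotate_of_ne_last fun ha => absurd (Fin.le_last b) (not_le.2 (ha ▸ h))

lemma part_cyclePartition_iff (σ : Equiv.Perm (Fin n)) (a b : Fin n) :
    (cyclePartition σ).part a = (cyclePartition σ).part b ↔ σ.SameCycle a b := by
  let _ : DecidableRel (Equiv.Perm.SameCycle.setoid σ).r := fun a b =>
    inferInstanceAs (Decidable (σ.SameCycle a b))
  rw [← mem_part_iff]
  exact Finpartition.mem_part_ofSetoid_iff_rel.trans Equiv.Perm.sameCycle_comm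

/-- The permutation whose cycles are the blocks of the Kreweras complement. -/
noncomputable def krewerasPerm (π : SetPartition n) : Equiv.Perm (Fin n) :=
  (blockPerm π)⁻¹ * finRotate n

lemma blockPerm_krewerasPerm (π : SetPartition n) (a : Fin n) :
    blockPerm π (krewerasPerm π a) = finRotate n a := by
  simp [krewerasPerm]

lemma part_kreweras_iff_sameCycle (π : SetPartition n) (a b : Fin n) :
    (kreweras π).part a = (kreweras π).part b ↔ (krewerasPerm π).SameCycle a b :=
  part_cyclePartition_iff _ a b

/-- The permutation takes `a` to the cyclic predecessor `y` of `c = a + 1` in the block of `c`. If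
that block contains `i`, then `y` cannot jump back over `i < c`; otherwise a `y` outside `[i, j)`
would make `{c, y}` cross `{i, j}`. -/
lemma krewerasPerm_mem_interval {π : SetPartition n} (hπ : IsNoncrossing π) {i j : Fin n}
    (hij : π.part i = π.part j) {a : Fin n} (hia : i ≤ a) (haj : a < j) :
    i ≤ krewerasPerm π a ∧ krewerasPerm π a < j := by
  rw [isNoncrossing_iff_part] at hπ
  have hc : ((finRotate n a : Fin n) : ℕ) = a + 1 := val_finRotate_of_lt haj
  have hs := blockPerm_spec π (krewerasPerm π a)
  rw [blockPerm_krewerasPerm] at hs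
  generalize krewerasPerm π a = y at *
  generalize finRotate n a = c at *
  obtain ⟨hyc, hs⟩ := hs
  have hic : i < c := by rw [Fin.lt_def]; rw [Fin.le_def] at hia; omega
  have hcj : c ≤ j := by rw [Fin.le_def]; rw [Fin.lt_def] at haj; omega
  by_cases hci : π.part c = π.part i
  · rcases hs with ⟨h1, h2⟩ | h
    · refine ⟨not_lt.1 fun hyi => h2 i (hci ▸ hyc) ⟨hyi, hic⟩, h1.trans_le hcj⟩
    · exact absurd (h i (hci ▸ hyc)).2 (not_le.2 hic)
  · have hcj' : c < j := lt_of_le_of_ne hcj fun h => hci (by rw [h, hij])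
    constructor
    · by_contra hyi
      rw [not_le] at hyi
      exact hci (hyc.trans (hπ y i c j hyi hic hcj' hyc.symm hij))
    · by_contra hyj
      rw [not_lt] at hyj
      have hyj' : j < y := lt_of_le_of_ne hyj fun h => hci (by rw [hyc, ← h, hij])
      exact hci (hπ i c j y hic hcj' hyj' hij hyc).symm

lemma sameCycle_mem_interval {π : SetPartition n} (hπ : IsNoncrossing π) {i j : Fin n}
    (hij : π.part i = π.part j) {a b : Fin n} (hab : (krewerasPerm π).SameCycle a b)
    (ha : i ≤ a ∧ a < j) : i ≤ b ∧ b < j := by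
  obtain ⟨m, -, rfl⟩ := hab.exists_pow_eq'
  induction m with
  | zero => simpa using ha
  | succ m ih =>
    have := ih ⟨m, rfl⟩
    rw [pow_succ', Equiv.Perm.mul_apply]
    exact krewerasPerm_mem_interval hπ hij this.1 this.2

/-- Two elements lie in the same block of the Kreweras complement of a non-crossing partition iff
they are not separated by any pair of elements of a common block. -/
theorem part_kreweras_iff {π : SetPartition n} (hπ : IsNoncrossing π) (a b : Fin n) :
    (kreweras π).part a = (kreweras π).part b ↔
      ∀ i j, π.part i = π.part j → ((i ≤ a ∧ a < j) ↔ (i ≤ b ∧ b < j)) := by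
  rw [part_kreweras_iff_sameCycle]
  constructor
  · intro h i j hij
    exact ⟨sameCycle_mem_interval hπ hij h, sameCycle_mem_interval hπ hij h.symm⟩
  · have key : ∀ a b : Fin n, a < b →
        (∀ i j, π.part i = π.part j → ((i ≤ a ∧ a < j) ↔ (i ≤ b ∧ b < j))) →
        (krewerasPerm π).SameCycle a b := by
      classical
      intro a b hab h
      by_contra hns
      -- Let `c` be the last point of the cycle of `a` below `b`, `y` its image and `g = c + 1`; `y`
      -- and `g` share a block of `π`. By maximality `y ≤ c` or `y > b`, so `[y, g)` or `[g, y)`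
      -- separates `c` from `b`, a contradiction.
      obtain ⟨c, hc, hmax⟩ := Finset.exists_max_image
        (Finset.univ.filter fun x => (krewerasPerm π).SameCycle a x ∧ x < b) id
        ⟨a, by simp [hab, Equiv.Perm.SameCycle.refl]⟩
      simp only [Finset.mem_filter, Finset.mem_univ, true_and, id] at hc hmax
      obtain ⟨hac, hcb⟩ := hc
      have hcy : (krewerasPerm π).SameCycle a (krewerasPerm π c) :=
        Equiv.Perm.sameCycle_apply_right.2 hac
      have hR : ∀ i j, π.part i = π.part j → ((i ≤ c ∧ c < j) ↔ (i ≤ b ∧ b < j)) :=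
        fun i j hij => Iff.trans ⟨sameCycle_mem_interval hπ hij hac.symm,
          sameCycle_mem_interval hπ hij hac⟩ (h i j hij)
      have hs := blockPerm_spec π (krewerasPerm π c)
      rw [blockPerm_krewerasPerm] at hs
      have hv : ((finRotate n c : Fin n) : ℕ) = c + 1 := val_finRotate_of_lt hcb
      have hyb : krewerasPerm π c ≠ b := fun hyb => hns (hyb ▸ hcy)
      have hy := fun h => hmax _ ⟨hcy, h⟩
      generalize krewerasPerm π c = y at *
      generalize finRotate n c = g at *
      have hlt := hR y g hs.1.symm
      have hlt' := hR g y hs.1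
      have hgy : y < g ∨ g ≤ y := by
        rcases hs.2 with ⟨h1, -⟩ | h1
        exacts [.inl h1, .inr (h1 y rfl).2]
      simp only [Fin.lt_def, Fin.le_def, ne_eq, Fin.ext_iff] at *
      omega
    intro h
    rcases lt_trichotomy a b with hab | rfl | hab
    · exact key a b hab h
    · exact Equiv.Perm.SameCycle.refl _ _
    · exact (key b a hab fun i j hij => (h i j hij).symm).symm

/-! ### Partitions with one distinguished block -/

/-- `W` is a block of `τ` and all other blocks are singletons. -/
def IsPointed (τ : SetPartition n) (W : Finset (Fin n)) : Prop :=
  W ∈ τ.parts ∧ ∀ V ∈ τ.parts.erase W, V.card = 1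

lemma isPointed_iff {τ : SetPartition n} {W : Finset (Fin n)} (hW : W.Nonempty) :
    IsPointed τ W ↔ ∀ a b, τ.part a = τ.part b ↔ a = b ∨ (a ∈ W ∧ b ∈ W) := by
  constructor
  · rintro ⟨h1, h2⟩ a b
    constructor
    · intro hab
      by_cases ha : a ∈ W
      · right
        rw [← τ.part_eq_iff_mem h1] at ha ⊢
        exact ⟨ha, by rw [← τ.part_eq_iff_mem h1, ← hab, ha]⟩
      · left
        have hne : τ.part a ≠ W := fun h => ha ((τ.part_eq_iff_mem h1).1 h)
        have hc := h2 _ (Finset.mem_erase.2 ⟨hne, τ.part_mem.2 (Finset.mem_univ a)⟩)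
        exact Finset.card_le_one.1 hc.le a ((mem_part_iff _ _ _).2 rfl) b
          ((mem_part_iff _ _ _).2 hab.symm)
    · rintro (rfl | ⟨ha, hb⟩)
      · rfl
      · rw [τ.part_eq_of_mem h1 ha, τ.part_eq_of_mem h1 hb]
  · intro h
    have hpart : ∀ a ∈ W, τ.part a = W := by
      intro a ha
      ext b
      rw [mem_part_iff, h]
      constructor
      · rintro (rfl | hb)
        exacts [ha, hb.1]
      · exact fun hb => .inr ⟨hb, ha⟩
    obtain ⟨a, ha⟩ := hW
    refine ⟨hpart a ha ▸ τ.part_mem.2 (Finset.mem_univ a), fun V hV => ?_⟩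
    rw [Finset.mem_erase] at hV
    refine le_antisymm (Finset.card_le_one.2 fun x hx y hy => ?_)
      (Finset.card_pos.2 (τ.nonempty_of_mem_parts hV.2))
    have hxy : τ.part x = τ.part y := by
      rw [τ.part_eq_of_mem hV.2 hx, τ.part_eq_of_mem hV.2 hy]
    rcases (h x y).1 hxy with h | ⟨hx', -⟩
    · exact h
    · exact absurd ((τ.part_eq_of_mem hV.2 hx).symm.trans (hpart x hx')) hV.1

/-- The partition into the fibres of a function. -/
noncomputable def fiberPartition {α : Type*} [DecidableEq α] (f : Fin n → α) : SetPartition n :=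
  letI : DecidableRel (Setoid.ker f).r := fun a b => inferInstanceAs (Decidable (f a = f b))
  Finpartition.ofSetoid (Setoid.ker f)

lemma part_fiberPartition_iff {α : Type*} [DecidableEq α] (f : Fin n → α) (a b : Fin n) :
    (fiberPartition f).part a = (fiberPartition f).part b ↔ f a = f b := by
  let _ : DecidableRel (Setoid.ker f).r := fun a b => inferInstanceAs (Decidable (f a = f b))
  rw [← mem_part_iff]
  exact Finpartition.mem_part_ofSetoid_iff_rel.trans eq_comm

/-- The non-crossing partition with the block `W` and singletons otherwise. -/
noncomputable def pointedPartition (W : Finset (Fin n)) : SetPartition n :=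
  fiberPartition fun a => if a ∈ W then none else some a

lemma part_pointedPartition_iff (W : Finset (Fin n)) (a b : Fin n) :
    (pointedPartition W).part a = (pointedPartition W).part b ↔ a = b ∨ (a ∈ W ∧ b ∈ W) := by
  rw [pointedPartition, part_fiberPartition_iff]
  by_cases ha : a ∈ W <;> by_cases hb : b ∈ W <;> simp [ha, hb]
  · rintro rfl; exact hb ha
  · rintro rfl; exact ha hb

lemma isNoncrossing_pointedPartition (W : Finset (Fin n)) :
    IsNoncrossing (pointedPartition W) := by
  rw [isNoncrossing_iff_part]
  intro a b c d hab hbc hcd hac hbd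
  rw [part_pointedPartition_iff] at *
  rcases hac with h | h
  · exact absurd h (hab.trans hbc).ne
  · rcases hbd with h' | h'
    · exact absurd h' (hbc.trans hcd).ne
    · exact .inr ⟨h.1, h'.1⟩

lemma isPointed_iff_eq {τ : SetPartition n} {W : Finset (Fin n)} (hW : W.Nonempty) :
    IsPointed τ W ↔ τ = pointedPartition W := by
  rw [isPointed_iff hW]
  constructor
  · intro h
    refine setPartition_ext fun a b => ?_
    rw [h, part_pointedPartition_iff]
  · rintro rfl
    exact part_pointedPartition_iff W

/-- The number of elements of `W` below `a`. -/
def rankIn (W : Finset (Fin n)) (a : Fin n) : ℕ := (W.filter (· < a)).card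

lemma rankIn_le_card (W : Finset (Fin n)) (a : Fin n) : rankIn W a ≤ W.card :=
  Finset.card_filter_le _ _

lemma rankIn_add {W : Finset (Fin n)} {a b : Fin n} (h : a ≤ b) :
    rankIn W b = rankIn W a + (W.filter fun w => a ≤ w ∧ w < b).card := by
  rw [rankIn, rankIn, ← Finset.card_union_of_disjoint]
  · congr 1
    ext w
    simp only [mem_filter, mem_union, Fin.lt_def, Fin.le_def] at *
    by_cases hw : w ∈ W
    · simp only [hw, true_and]; omega
    · simp [hw]
  · rw [Finset.disjoint_left]
    intro w h1 h2
    simp only [mem_filter, Fin.lt_def, Fin.le_def] at *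
    omega

lemma rankIn_mono (W : Finset (Fin n)) {a b : Fin n} (h : a ≤ b) : rankIn W a ≤ rankIn W b := by
  rw [rankIn_add h]; exact Nat.le_add_right _ _

/-- The partition of `[n]` into the cyclic intervals ending at the elements of `W`. -/
noncomputable def intervalPartition (W : Finset (Fin n)) : SetPartition n :=
  -- Points after the last element of `W` have rank `W.card`; reducing modulo `W.card` joins them to
  -- the points up to the first.
  fiberPartition fun a => rankIn W a % W.card

lemma mod_eq_mod_iff_of_le {k a b : ℕ} (hk : 0 < k) (hab : a ≤ b) (hb : b ≤ k) :
    a % k = b % k ↔ b - a = 0 ∨ b - a = k := by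
  rcases Nat.lt_or_ge b k with h | h
  · rw [Nat.mod_eq_of_lt h, Nat.mod_eq_of_lt (by omega)]; omega
  · have : b = k := by omega
    subst this
    rw [Nat.mod_self]
    rcases Nat.lt_or_ge a b with h' | h'
    · rw [Nat.mod_eq_of_lt h']; omega
    · have : a = b := by omega
      subst this
      simp

/-- Ranks lie between `0` and `W.card`, so congruent ranks differ by `0` or by `W.card`. -/
lemma part_intervalPartition_iff {W : Finset (Fin n)} (hW : W.Nonempty) {a b : Fin n}
    (hab : a ≤ b) : (intervalPartition W).part a = (intervalPartition W).part b ↔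
      (∀ w ∈ W, ¬(a ≤ w ∧ w < b)) ∨ ∀ w ∈ W, a ≤ w ∧ w < b := by
  rw [intervalPartition, part_fiberPartition_iff, mod_eq_mod_iff_of_le (Finset.card_pos.2 hW)
    (rankIn_mono W hab) (rankIn_le_card W b), rankIn_add hab, Nat.add_sub_cancel_left,
    Finset.card_eq_zero, Finset.filter_eq_empty_iff, Finset.card_filter_eq_iff]

lemma isNoncrossing_intervalPartition {W : Finset (Fin n)} (hW : W.Nonempty) :
    IsNoncrossing (intervalPartition W) := by
  rw [isNoncrossing_iff_part]
  intro a b c d hab hbc hcd hac hbd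
  rw [part_intervalPartition_iff hW (hab.trans hbc).le] at hac
  rw [part_intervalPartition_iff hW (hbc.trans hcd).le] at hbd
  rw [part_intervalPartition_iff hW hab.le]
  obtain ⟨w₀, hw₀⟩ := hW
  rcases hac with h | h
  · exact .inl fun w hw hw' => h w hw ⟨hw'.1, hw'.2.trans hbc⟩
  · rcases hbd with h' | h'
    · exact .inr fun w hw => ⟨(h w hw).1, not_le.1 fun hbw =>
        h' w hw ⟨hbw, (h w hw).2.trans hcd⟩⟩
    · exact .inl fun w hw hw' => absurd (h' w hw).1 (not_le.2 hw'.2)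

/-- A point `a ∉ W` is fixed by the Kreweras permutation, which means that `π` joins `a` to its
cyclic successor; this builds the intervals. Nothing more is joined, because a pair in one block of
`π` cannot separate points of `W`. -/
lemma isPointed_kreweras_iff {π : SetPartition n} (hπ : IsNoncrossing π) {W : Finset (Fin n)}
    (hW : W.Nonempty) : IsPointed (kreweras π) W ↔ π = intervalPartition W := by
  rw [isPointed_iff hW]
  constructor
  · intro h
    have hchain : ∀ i j : Fin n, i ≤ j → (∀ a, i ≤ a → a < j → a ∉ W) → π.part i = π.part j := by
      intro i j hij hno
      obtain ⟨m, hm⟩ := Nat.exists_eq_add_of_le (Fin.le_def.1 hij)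
      induction m generalizing j with
      | zero => rw [Fin.ext (by omega : (i : ℕ) = j)]
      | succ m ih =>
        have hlt : (i : ℕ) + m < n := by have := j.2; omega
        rw [ih ⟨i + m, hlt⟩ (by rw [Fin.le_def]; simp) (fun a h1 h2 => hno a h1
          (by rw [Fin.lt_def] at *; simp at h2; omega)) rfl]
        set a : Fin n := ⟨i + m, hlt⟩ with ha
        have haj : a < j := by rw [Fin.lt_def, ha]; simp; omega
        have haW : a ∉ W := hno a (by rw [Fin.le_def, ha]; simp) haj
        have hfix : krewerasPerm π a = a := by
          have h1 : (kreweras π).part a = (kreweras π).part (krewerasPerm π a) := by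
            rw [part_kreweras_iff_sameCycle, Equiv.Perm.sameCycle_apply_right]
          exact (((h _ _).1 h1).resolve_right fun h2 => haW h2.1).symm
        have h2 := blockPerm_krewerasPerm π a
        rw [hfix] at h2
        have h3 : finRotate n a = j := by
          refine Fin.ext ?_
          rw [val_finRotate_of_lt haj, ha]; simp; omega
        rw [← h3, ← h2, (blockPerm_spec π a).1]
    -- The interval wrapping around: the last point is not in `W`, so it is joined to `0`.
    have hlast : ∀ i j : Fin n, i < j → (∀ w ∈ W, i ≤ w ∧ w < j) → π.part i = π.part j := by
      intro i j hij hW'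
      obtain ⟨m, rfl⟩ : ∃ m, n = m + 1 := ⟨n - 1, by have := i.2; omega⟩
      have h1 : π.part 0 = π.part i :=
        hchain 0 i (Fin.zero_le i) fun a _ hai ha => absurd hai (not_lt.2 (hW' a ha).1)
      have h2 : π.part j = π.part (Fin.last m) :=
        hchain j _ (Fin.le_last j) fun a hja _ ha => absurd hja (not_le.2 (hW' a ha).2)
      have hfix : krewerasPerm π (Fin.last m) = Fin.last m := by
        have h1 : (kreweras π).part (Fin.last m)
            = (kreweras π).part (krewerasPerm π (Fin.last m)) := by
          rw [part_kreweras_iff_sameCycle, Equiv.Perm.sameCycle_apply_right]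
        exact (((h _ _).1 h1).resolve_right fun h2 =>
          absurd (hW' _ h2.1).2 (not_lt.2 (Fin.le_last j))).symm
      have h3 := blockPerm_krewerasPerm π (Fin.last m)
      rw [hfix, finRotate_last] at h3
      rw [← h1, ← h3, (blockPerm_spec π _).1, h2]
    have key : ∀ a b : Fin n, a ≤ b → (π.part a = π.part b ↔
        (intervalPartition W).part a = (intervalPartition W).part b) := by
      intro a b hab
      rw [part_intervalPartition_iff hW hab]
      constructor
      · intro hab'
        obtain ⟨w₀, hw₀⟩ := hW
        have hsep : ∀ w ∈ W, (a ≤ w ∧ w < b) ↔ (a ≤ w₀ ∧ w₀ < b) := fun w hw =>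
          (part_kreweras_iff hπ w w₀).1 ((h w w₀).2 (.inr ⟨hw, hw₀⟩)) a b hab'
        by_cases h0 : a ≤ w₀ ∧ w₀ < b
        · exact .inr fun w hw => (hsep w hw).2 h0
        · exact .inl fun w hw hw' => h0 ((hsep w hw).1 hw')
      · rintro (h1 | h1)
        · exact hchain a b hab fun c hac hcb hc => h1 c hc ⟨hac, hcb⟩
        · obtain ⟨w₀, hw₀⟩ := hW
          exact hlast a b ((h1 w₀ hw₀).1.trans_lt (h1 w₀ hw₀).2) h1
    refine setPartition_ext fun a b => ?_
    rcases le_total a b with hab | hab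
    · exact key a b hab
    · rw [eq_comm, key b a hab, eq_comm]
  · rintro rfl a b
    rw [part_kreweras_iff hπ]
    constructor
    -- A point `a ∉ W` is isolated by the joined pair `a`, `a + 1`, or, when `a` is the last point,
    -- by the joined pair `0`, `a`, whose half-open interval is the complement of `a`.
    · have key : ∀ a b : Fin n, a ∉ W → (∀ i j, (intervalPartition W).part i =
          (intervalPartition W).part j → ((i ≤ a ∧ a < j) ↔ (i ≤ b ∧ b < j))) → a = b := by
        intro a b ha h
        by_contra hne
        rcases Nat.lt_or_ge (a + 1) n with h1 | h1
        · have hle : a ≤ ⟨a + 1, h1⟩ := by rw [Fin.le_def]; simp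
          have hint : ∀ x : Fin n, a ≤ x ∧ x < ⟨a + 1, h1⟩ ↔ x = a := fun x => by
            rw [Fin.le_def, Fin.lt_def, Fin.ext_iff]; simp; omega
          have h2 := h a ⟨a + 1, h1⟩ ((part_intervalPartition_iff hW hle).2
            (.inl fun w hw hw' => ha ((hint w).1 hw' ▸ hw)))
          rw [hint, hint] at h2
          exact hne (h2.1 rfl).symm
        · have ha' := a.2
          have hle : (⟨0, by omega⟩ : Fin n) ≤ a := by rw [Fin.le_def]; simp
          have hint : ∀ x : Fin n, (⟨0, by omega⟩ ≤ x ∧ x < a) ↔ x ≠ a := fun x => by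
            have := x.2
            rw [Fin.le_def, Fin.lt_def, Ne, Fin.ext_iff]; simp; omega
          have h2 := h ⟨0, by omega⟩ a ((part_intervalPartition_iff hW hle).2
            (.inr fun w hw => (hint w).2 fun h => ha (h ▸ hw)))
          rw [hint, hint] at h2
          exact (h2.2 (Ne.symm hne)) rfl
      intro h
      by_cases ha : a ∈ W
      · by_cases hb : b ∈ W
        · exact .inr ⟨ha, hb⟩
        · exact .inl (key b a hb fun i j hij => (h i j hij).symm).symm
      · exact .inl (key a b ha h)
    · rintro (rfl | ⟨ha, hb⟩) i j hij
      · rfl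
      · rcases le_total i j with hle | hle
        · rcases (part_intervalPartition_iff hW hle).1 hij with h | h
          · exact iff_of_false (h a ha) (h b hb)
          · exact iff_of_true (h a ha) (h b hb)
        · exact iff_of_false (fun h => absurd (h.1.trans_lt h.2) (not_lt.2 hle))
            fun h => absurd (h.1.trans_lt h.2) (not_lt.2 hle)

end Kreweras

/-! ### Sums over non-crossing partitions against the free cumulants of `δ₁` -/

section Pointed

variable {n : ℕ} {u : ℕ → ℝ}

lemma prod_eq_ite_of_delta (h1 : u 1 = 1) (h2 : ∀ k, 2 ≤ k → u k = 0)
    {P : Finset (Finset (Fin n))} (hP : ∀ V ∈ P, V.Nonempty) [Decidable (∀ V ∈ P, V.card = 1)] :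
    ∏ V ∈ P, u V.card = if ∀ V ∈ P, V.card = 1 then 1 else 0 := by
  split_ifs with h
  · exact Finset.prod_eq_one fun V hV => by rw [h V hV, h1]
  · push Not at h
    obtain ⟨V, hV, hc⟩ := h
    have := Finset.card_pos.2 (hP V hV)
    exact Finset.prod_eq_zero hV (h2 _ (by omega))

open scoped Classical in
-- Summing over all nonempty `W` instead of the blocks of `τ` makes the index set independent of
-- `τ`, so the sum can be exchanged with one over partitions.
lemma blockDeriv_eq_sum_isPointed (h1 : u 1 = 1) (h2 : ∀ k, 2 ≤ k → u k = 0) (κ : ℕ → ℝ)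
    (τ : SetPartition n) : blockDeriv u κ τ =
      ∑ W : Finset (Fin n) with W.Nonempty, if IsPointed τ W then κ W.card else 0 := by
  have hsub : τ.parts ⊆ Finset.univ.filter fun W : Finset (Fin n) => W.Nonempty := fun V hV => by
    simpa using τ.nonempty_of_mem_parts hV
  rw [blockDeriv, ← Finset.sum_subset hsub]
  · refine Finset.sum_congr rfl fun V hV => ?_
    rw [prod_eq_ite_of_delta h1 h2 fun W hW =>
      τ.nonempty_of_mem_parts (Finset.mem_of_mem_erase hW), mul_ite, mul_one, mul_zero]
    simp only [IsPointed, hV, true_and]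
  · intro W _ hW
    rw [if_neg fun h => hW h.1]

open scoped Classical in
-- With an arbitrary anchor `a`, "all blocks are singletons" becomes a case of `IsPointed`, so one
-- classification serves both kinds of sums.
lemma blockProd_eq_ite_isPointed (h1 : u 1 = 1) (h2 : ∀ k, 2 ≤ k → u k = 0)
    (τ : SetPartition n) (a : Fin n) :
    blockProd u τ = if IsPointed τ {a} then 1 else 0 := by
  rw [blockProd, prod_eq_ite_of_delta h1 h2 fun W hW => τ.nonempty_of_mem_parts hW]
  refine if_congr ⟨fun h => ⟨?_, fun V hV => h V (Finset.mem_of_mem_erase hV)⟩, ?_⟩ rfl rfl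
  · obtain ⟨V, hV, haV⟩ := τ.exists_mem (Finset.mem_univ a)
    obtain ⟨b, rfl⟩ := Finset.card_eq_one.1 (h V hV)
    rw [Finset.mem_singleton.1 haV]
    exact hV
  · intro h V hV
    by_cases hVa : V = {a}
    · rw [hVa, Finset.card_singleton]
    · exact h.2 V (Finset.mem_erase.2 ⟨hVa, hV⟩)

lemma mem_NC {π : SetPartition n} : π ∈ NC n ↔ IsNoncrossing π := by simp [NC]

lemma sum_NC_blockDeriv_delta (h1 : u 1 = 1) (h2 : ∀ k, 2 ≤ k → u k = 0) (κ : ℕ → ℝ) :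
    ∑ τ ∈ NC n, blockDeriv u κ τ = ∑ k ∈ range n, (n.choose (k + 1) : ℝ) * κ (k + 1) := by
  classical
  simp only [blockDeriv_eq_sum_isPointed h1 h2 κ]
  rw [Finset.sum_comm]
  have h3 : ∀ W ∈ Finset.univ.filter fun W : Finset (Fin n) => W.Nonempty,
      (∑ τ ∈ NC n, if IsPointed τ W then κ W.card else 0) = κ W.card := by
    intro W hW
    have hW : W.Nonempty := (Finset.mem_filter.1 hW).2
    simp only [isPointed_iff_eq hW]
    rw [Finset.sum_ite_eq', if_pos (mem_NC.2 (isNoncrossing_pointedPartition W))]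
  rw [Finset.sum_congr rfl h3, Finset.sum_filter]
  -- The value `0` at `k = 0` removes the empty set.
  have h4 := Finset.sum_powerset_apply_card (fun k => if k = 0 then 0 else κ k)
    (x := (Finset.univ : Finset (Fin n)))
  rw [Finset.card_univ, Fintype.card_fin, Finset.sum_range_succ', Finset.powerset_univ] at h4
  simp only [if_true, smul_zero, add_zero, nsmul_eq_mul, Nat.succ_ne_zero, if_false] at h4
  rw [← h4]
  refine Finset.sum_congr rfl fun W _ => ?_
  by_cases hW : W = ∅
  · simp [hW]
  · rw [if_pos (Finset.nonempty_iff_ne_empty.2 hW), if_neg (by simpa using hW)]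

lemma sum_NC_blockProd_mul_blockDeriv_kreweras (h1 : u 1 = 1) (h2 : ∀ k, 2 ≤ k → u k = 0)
    (r κ : ℕ → ℝ) : ∑ π ∈ NC n, blockProd r π * blockDeriv u κ (kreweras π)
      = ∑ W : Finset (Fin n) with W.Nonempty, κ W.card * blockProd r (intervalPartition W) := by
  classical
  simp only [blockDeriv_eq_sum_isPointed h1 h2 κ, Finset.mul_sum]
  rw [Finset.sum_comm]
  refine Finset.sum_congr rfl fun W hW => ?_
  have hW : W.Nonempty := (Finset.mem_filter.1 hW).2
  rw [Finset.sum_eq_single_of_mem _ (mem_NC.2 (isNoncrossing_intervalPartition hW)),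
    if_pos ((isPointed_kreweras_iff (isNoncrossing_intervalPartition hW) hW).2 rfl), mul_comm]
  intro π hπ hne
  rw [if_neg fun h => hne ((isPointed_kreweras_iff (mem_NC.1 hπ) hW).1 h), mul_zero]

lemma intervalPartition_singleton (a : Fin n) : intervalPartition {a} = ⊤ := by
  have hn : n ≠ 0 := by have := a.2; omega
  refine setPartition_ext fun b c => iff_of_true ?_ ?_
  · rw [intervalPartition, part_fiberPartition_iff, Finset.card_singleton, Nat.mod_one, Nat.mod_one]
  · have h : Finset.univ ∈ (⊤ : SetPartition n).parts := by simp [parts_top hn]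
    rw [Finpartition.part_eq_of_mem _ h (Finset.mem_univ b),
      Finpartition.part_eq_of_mem _ h (Finset.mem_univ c)]

lemma blockProd_top (hn : n ≠ 0) (r : ℕ → ℝ) : blockProd r (⊤ : SetPartition n) = r n := by
  simp [blockProd, parts_top hn]

lemma blockDeriv_top (hn : n ≠ 0) (r s : ℕ → ℝ) : blockDeriv r s (⊤ : SetPartition n) = s n := by
  simp [blockDeriv, parts_top hn]

/-- Only `π = ⊤` has a Kreweras complement consisting of singletons. -/
lemma sum_NC_mul_blockProd_kreweras (h1 : u 1 = 1) (h2 : ∀ k, 2 ≤ k → u k = 0)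
    (hn : n ≠ 0) (F : SetPartition n → ℝ) :
    ∑ π ∈ NC n, F π * blockProd u (kreweras π) = F ⊤ := by
  classical
  let a : Fin n := ⟨0, Nat.pos_of_ne_zero hn⟩
  have ha : ({a} : Finset (Fin n)).Nonempty := Finset.singleton_nonempty a
  simp only [fun π => blockProd_eq_ite_isPointed h1 h2 (kreweras π) a]
  have hiff : ∀ π, IsNoncrossing π → (IsPointed (kreweras π) {a} ↔ π = ⊤) := fun π hπ => by
    rw [isPointed_kreweras_iff hπ ha, intervalPartition_singleton]
  rw [Finset.sum_eq_single_of_mem _ (top_mem_NC n),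
    if_pos ((hiff _ (mem_NC.1 (top_mem_NC n))).2 rfl), mul_one]
  intro π hπ hne
  rw [if_neg fun h => hne ((hiff π (mem_NC.1 hπ)).1 h), mul_zero]

end Pointed

/-! ### The free cumulants of `δ₁` -/

lemma freeCumulant_one_eq {m : ℕ → ℝ} (hm : ∀ n, m n = 1) : freeCumulant m 1 = 1 := by
  have h := moment_eq_sum_freeCumulant m one_ne_zero
  rw [hm, Finset.sum_eq_single_of_mem _ (top_mem_NC 1), blockProd_top one_ne_zero] at h
  · exact h.symm
  · intro π _ hne
    obtain ⟨V, hV, hx⟩ := π.exists_mem (Finset.mem_univ (0 : Fin 1))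
    have := card_lt_of_ne_top hne hV
    have := Finset.card_pos.2 ⟨_, hx⟩
    omega

/-- By induction, among `π ≠ ⊤` only the partition into singletons contributes, and its contribution
`1` already exhausts the moment. -/
lemma freeCumulant_eq_zero {m : ℕ → ℝ} (hm : ∀ n, m n = 1) {n : ℕ} (hn : 2 ≤ n) :
    freeCumulant m n = 0 := by
  classical
  induction n using Nat.strong_induction_on with
  | _ n ih =>
    have hn0 : n ≠ 0 := by omega
    let a : Fin n := ⟨0, by omega⟩
    have ha : ({a} : Finset (Fin n)).Nonempty := Finset.singleton_nonempty a
    -- `u` agrees with the cumulants on sizes `1, …, n - 1`, where the induction hypothesis reaches,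
    -- and has the required values at all sizes.
    let u : ℕ → ℝ := fun k => if k = 1 then 1 else 0
    have hpne : pointedPartition {a} ≠ ⊤ := by
      intro h
      have h1 : ∀ b c, (pointedPartition {a}).part b = (pointedPartition {a}).part c := by
        intro b c
        have h : Finset.univ ∈ (pointedPartition {a}).parts := by rw [h]; simp [parts_top hn0]
        rw [Finpartition.part_eq_of_mem _ h (Finset.mem_univ b),
          Finpartition.part_eq_of_mem _ h (Finset.mem_univ c)]
      have h2 := (part_pointedPartition_iff _ _ _).1 (h1 a ⟨1, by omega⟩)
      simp [a] at h2
    have hbp : ∀ π : SetPartition n, π ≠ ⊤ →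
        blockProd (freeCumulant m) π = if IsPointed π {a} then 1 else 0 := by
      intro π hne
      have hu : blockProd (freeCumulant m) π = blockProd u π := by
        refine Finset.prod_congr rfl fun V hV => ?_
        have h1 := card_lt_of_ne_top hne hV
        have h2 := Finset.card_pos.2 (π.nonempty_of_mem_parts hV)
        by_cases hV1 : V.card = 1
        · simp [u, hV1, freeCumulant_one_eq hm]
        · simp [u, hV1, ih _ h1 (by omega)]
      rw [hu, blockProd_eq_ite_isPointed (u := u) (if_pos rfl)
        (fun k hk => if_neg (by omega)) π a]
    have h := moment_eq_sum_freeCumulant m hn0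
    rw [hm, ← Finset.add_sum_erase _ _ (top_mem_NC n), blockProd_top hn0,
      Finset.sum_eq_single_of_mem (pointedPartition {a})
        (Finset.mem_erase.2 ⟨hpne, mem_NC.2 (isNoncrossing_pointedPartition _)⟩)] at h
    · rw [hbp _ hpne, if_pos ((isPointed_iff_eq ha).2 rfl)] at h
      linarith
    · intro π hπ hne
      rw [hbp π (Finset.ne_of_mem_erase hπ), if_neg fun h => hne ((isPointed_iff_eq ha).1 h)]

/-! ### Block sizes of interval partitions -/

/-- The number of elements of the interval ending at `w` and starting after the previous element
of `V`. -/
def gapBefore (V : Finset ℕ) (w : ℕ) : ℕ := ((range (w + 1)).filter fun a => ∀ u ∈ V, a ≤ u → w ≤ u).card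

/-- The weight of the gaps of `V`, without the one before `x`. -/
def gapProd (r : ℕ → ℝ) (x : ℕ) (V : Finset ℕ) : ℝ := ∏ w ∈ V.erase x, r (gapBefore V w)

lemma gapProd_insert (r : ℕ → ℝ) {x v : ℕ} (hxv : x < v) {V : Finset ℕ} (hv : v ∈ V)
    (hV : ∀ i ∈ V, v ≤ i) : gapProd r x (insert x V) = r (v - x) * gapProd r v V := by
  have hx : x ∉ V := fun h => absurd (hV x h) (not_le.2 hxv)
  rw [gapProd, gapProd, Finset.erase_insert hx, ← Finset.mul_prod_erase V _ hv]
  congr 1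
  · congr 1
    have : (range (v + 1)).filter (fun a => ∀ u ∈ insert x V, a ≤ u → v ≤ u) = Ioc x v := by
      ext a
      simp only [Finset.mem_filter, Finset.mem_range, Finset.mem_Ioc, Finset.forall_mem_insert]
      constructor
      · rintro ⟨h1, h2, -⟩
        by_contra h
        have := h2 (by omega)
        omega
      · rintro ⟨h1, h2⟩
        exact ⟨by omega, fun h => by omega, fun u hu _ => hV u hu⟩
    rw [gapBefore, this, Nat.card_Ioc]
  · refine Finset.prod_congr rfl fun w hw => ?_
    rw [Finset.mem_erase] at hw
    have hvw := hV w hw.2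
    rw [gapBefore, gapBefore]
    congr 2
    ext a
    simp only [Finset.mem_filter, Finset.mem_range, Finset.forall_mem_insert]
    refine and_congr_right fun _ => ⟨fun h => h.2, fun h => ⟨fun hax => ?_, h⟩⟩
    have := h v hv (by omega)
    omega

/-- The `k` gaps between the first and the last element give `R^k`. The function `g` keeps track of
the last element, on which the block wrapping around depends. -/
lemma sum_subsetsFrom_gapProd (r g : ℕ → ℝ) {x n : ℕ} (hx : x < n) (k : ℕ) :
    ∑ V ∈ subsetsFrom x n (k + 1), g (V.sup id) * gapProd r x V
      = ∑ y ∈ Ico x n, g y * PowerSeries.coeff (y - x) (momentSeries r ^ k) := by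
  induction k generalizing x with
  | zero =>
    rw [zero_add, subsetsFrom_one hx, Finset.sum_singleton, Finset.sum_eq_single x]
    · simp [gapProd]
    · intro y hy hne
      rw [Finset.mem_Ico] at hy
      rw [pow_zero, PowerSeries.coeff_one, if_neg (by omega), mul_zero]
    · intro h
      exact absurd (Finset.mem_Ico.2 ⟨le_rfl, hx⟩) h
  | succ k ih =>
    rw [sum_subsetsFrom_succ]
    have h1 : ∀ v ∈ Ioo x n, ∑ V ∈ subsetsFrom v n (k + 1),
        g ((insert x V).sup id) * gapProd r x (insert x V)
        = ∑ y ∈ Ico v n, g y * (r (v - x) * PowerSeries.coeff (y - v) (momentSeries r ^ k)) := by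
      intro v hv
      rw [Finset.mem_Ioo] at hv
      simp only [mul_left_comm _ (r (v - x))]
      rw [← Finset.mul_sum, ← ih hv.2, Finset.mul_sum]
      refine Finset.sum_congr rfl fun V hV => ?_
      rw [mem_subsetsFrom] at hV
      rw [gapProd_insert r hv.1 hV.2.1 fun i hi => (hV.1 i hi).1, Finset.sup_insert,
        sup_eq_right.2]
      · ring
      · exact hv.1.le.trans (Finset.le_sup (f := id) hV.2.1)
    rw [Finset.sum_congr rfl h1, Finset.sum_comm' (t' := Ico x n) (s' := fun y => Ioc x y)]
    · refine Finset.sum_congr rfl fun y hy => ?_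
      rw [← Finset.mul_sum]
      rw [Finset.mem_Ico] at hy
      congr 1
      rw [pow_succ', ← sum_Ioc_coeff_mul_coeff (constantCoeff_momentSeries r) hy.1]
      refine Finset.sum_congr rfl fun v hv => ?_
      rw [Finset.mem_Ioc] at hv
      rw [coeff_momentSeries _ (by omega)]
    · intro v y
      simp only [Finset.mem_Ioo, Finset.mem_Ico, Finset.mem_Ioc]
      omega

section IntervalPartition

variable {n : ℕ} {W : Finset (Fin n)}

lemma injOn_part_intervalPartition (W : Finset (Fin n)) :
    Set.InjOn (intervalPartition W).part W := by
  have key : ∀ a ∈ W, ∀ b ∈ W, a ≤ b →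
      (intervalPartition W).part a = (intervalPartition W).part b → a = b := by
    intro a ha b hb hab h
    rcases (part_intervalPartition_iff ⟨a, ha⟩ hab).1 h with h | h
    · exact le_antisymm hab (not_lt.1 fun hlt => h a ha ⟨le_rfl, hlt⟩)
    · exact absurd (h b hb).2 (lt_irrefl b)
  intro a ha b hb h
  rcases le_total a b with hab | hab
  · exact key a ha b hb hab h
  · exact (key b hb a ha hab h.symm).symm

lemma parts_intervalPartition (hW : W.Nonempty) :
    (intervalPartition W).parts = W.image (intervalPartition W).part := by
  ext V
  rw [Finset.mem_image]
  constructor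
  · intro hV
    obtain ⟨b, hb⟩ := (intervalPartition W).nonempty_of_mem_parts hV
    rw [← (intervalPartition W).part_eq_of_mem hV hb]
    by_cases h : (W.filter (b ≤ ·)).Nonempty
    · have hm := Finset.min'_mem _ h
      have hle := fun i hi => Finset.min'_le (W.filter (b ≤ ·)) i hi
      set w := (W.filter (b ≤ ·)).min' h
      rw [Finset.mem_filter] at hm
      refine ⟨w, hm.1, ((part_intervalPartition_iff hW hm.2).2 (.inl fun v hv hv' => ?_)).symm⟩
      exact absurd (hle v (Finset.mem_filter.2 ⟨hv, hv'.1⟩)) (not_le.2 hv'.2)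
    · rw [Finset.not_nonempty_iff_eq_empty, Finset.filter_eq_empty_iff] at h
      refine ⟨W.min' hW, Finset.min'_mem _ _, ?_⟩
      have hlt := not_le.1 (h (Finset.min'_mem W hW))
      exact (part_intervalPartition_iff hW hlt.le).2
        (.inr fun v hv => ⟨Finset.min'_le W v hv, not_le.1 (h hv)⟩)
  · rintro ⟨w, _, rfl⟩
    exact (intervalPartition W).part_mem.2 (Finset.mem_univ w)

/-- The block of the minimum `x` wraps around and is the complement of `(x, y]`. -/
lemma card_part_intervalPartition_min {x y : Fin n} (hx : x ∈ W) (hy : y ∈ W)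
    (hxW : ∀ w ∈ W, x ≤ w) (hyW : ∀ w ∈ W, w ≤ y) :
    ((intervalPartition W).part x).card = n - (y - x) := by
  have hW : W.Nonempty := ⟨x, hx⟩
  have hmap : ((intervalPartition W).part x).map Fin.valEmbedding
      = range n \ Ioc (x : ℕ) y := by
    ext b
    simp only [Finset.mem_map, Fin.valEmbedding_apply, Finset.mem_sdiff, Finset.mem_range,
      Finset.mem_Ioc, mem_part_iff]
    constructor
    · rintro ⟨b, hb, rfl⟩
      refine ⟨b.2, fun h => ?_⟩
      have hxb : x < b := h.1
      rcases (part_intervalPartition_iff hW hxb.le).1 hb.symm with h' | h'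
      · exact h' x hx ⟨le_rfl, hxb⟩
      · exact absurd (h' y hy).2 (not_lt.2 h.2)
    · rintro ⟨hbn, hb⟩
      refine ⟨⟨b, hbn⟩, ?_, rfl⟩
      rcases Nat.lt_or_ge x b with h | h
      · refine ((part_intervalPartition_iff hW (b := ⟨b, hbn⟩) (Fin.le_def.2 h.le)).2
          (.inr fun w hw => ⟨hxW w hw, ?_⟩)).symm
        have := Fin.le_def.1 (hyW w hw)
        rw [Fin.lt_def]
        dsimp only
        omega
      · exact (part_intervalPartition_iff hW (a := ⟨b, hbn⟩) (Fin.le_def.2 h)).2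
          (.inl fun w hw hw' => absurd (hxW w hw) (not_le.2 hw'.2))
  rw [← Finset.card_map, hmap, Finset.card_sdiff_of_subset, Finset.card_range, Nat.card_Ioc]
  intro b hb
  rw [Finset.mem_Ioc] at hb
  have := y.2
  rw [Finset.mem_range]
  omega

lemma card_part_intervalPartition {x w : Fin n} (hx : x ∈ W) (hw : w ∈ W) (hxw : x < w) :
    ((intervalPartition W).part w).card = gapBefore (W.map Fin.valEmbedding) w := by
  have hW : W.Nonempty := ⟨x, hx⟩
  rw [gapBefore, ← Finset.card_map Fin.valEmbedding]
  congr 1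
  ext b
  simp only [Finset.mem_map, Fin.valEmbedding_apply, Finset.mem_filter, Finset.mem_range,
    mem_part_iff]
  constructor
  · rintro ⟨b, hb, rfl⟩
    rcases le_or_gt b w with h | h
    · refine ⟨Nat.lt_succ_of_le h, ?_⟩
      rintro _ ⟨u, hu, rfl⟩ hbu
      rcases (part_intervalPartition_iff hW h).1 hb with h' | h'
      · exact not_lt.1 fun huw => h' u hu ⟨hbu, huw⟩
      · exact absurd (h' w hw).2 (lt_irrefl w)
    · rcases (part_intervalPartition_iff hW h.le).1 hb.symm with h' | h'
      · exact absurd ⟨le_rfl, h⟩ (h' w hw)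
      · exact absurd (h' x hx).1 (not_le.2 hxw)
  · rintro ⟨hbw, hb⟩
    have hbn : b < n := by have := w.2; omega
    refine ⟨⟨b, hbn⟩, (part_intervalPartition_iff hW (Fin.le_def.2 (Nat.lt_succ_iff.1 hbw))).2
      (.inl fun u hu hu' => ?_), rfl⟩
    exact absurd (hb u ⟨u, hu, rfl⟩ hu'.1) (not_le.2 hu'.2)

lemma blockProd_intervalPartition (r : ℕ → ℝ) {x y : Fin n} (hx : x ∈ W) (hy : y ∈ W)
    (hxW : ∀ w ∈ W, x ≤ w) (hyW : ∀ w ∈ W, w ≤ y) :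
    blockProd r (intervalPartition W)
      = r (n - (y - x)) * gapProd r x (W.map Fin.valEmbedding) := by
  rw [blockProd, parts_intervalPartition ⟨x, hx⟩,
    Finset.prod_image (injOn_part_intervalPartition W), ← Finset.mul_prod_erase W _ hx,
    card_part_intervalPartition_min hx hy hxW hyW, gapProd]
  congr 1
  have : (W.map Fin.valEmbedding).erase (x : ℕ) = (W.erase x).map Fin.valEmbedding := by
    rw [Finset.map_erase]; rfl
  rw [this, Finset.prod_map]
  refine Finset.prod_congr rfl fun w hw => ?_
  rw [Finset.mem_erase] at hw
  rw [card_part_intervalPartition hx hw.2 (lt_of_le_of_ne (hxW w hw.2) hw.1.symm)]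
  rfl

end IntervalPartition

lemma sum_nonempty_eq_sum_subsetsFrom (n : ℕ) (f : ℕ → Finset ℕ → ℝ) (g : Finset (Fin n) → ℝ)
    (hfg : ∀ (W : Finset (Fin n)) (x : Fin n), x ∈ W → (∀ w ∈ W, x ≤ w) → g W = f x (W.map Fin.valEmbedding)) :
    ∑ W : Finset (Fin n) with W.Nonempty, g W
      = ∑ x ∈ range n, ∑ k ∈ range n, ∑ V ∈ subsetsFrom x n (k + 1), f x V := by
  simp only [Finset.sum_sigma']
  refine Finset.sum_bij (fun W hW => ⟨(W.min' (Finset.mem_filter.1 hW).2 : Fin n), W.card - 1,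
    W.map Fin.valEmbedding⟩) ?_ ?_ ?_ ?_
  · intro W hW
    have hW := (Finset.mem_filter.1 hW).2
    have hpos := Finset.card_pos.2 hW
    have hle : W.card ≤ n := by simpa using Finset.card_le_univ W
    simp only [Finset.mem_sigma, Finset.mem_range, mem_subsetsFrom, Finset.card_map,
      Finset.mem_map, Fin.valEmbedding_apply]
    refine ⟨Fin.is_lt _, by omega, ?_, ⟨_, Finset.min'_mem _ hW, rfl⟩, by omega⟩
    rintro _ ⟨w, hw, rfl⟩
    exact ⟨Finset.min'_le W w hw, w.2⟩
  · intro W _ W' _ h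
    simp only [Sigma.mk.injEq, heq_eq_eq] at h
    exact Finset.map_injective _ h.2.2
  · rintro ⟨x, k, V⟩ h
    simp only [Finset.mem_sigma, Finset.mem_range, mem_subsetsFrom] at h
    obtain ⟨hx, hk, h1, h2, h3⟩ := h
    have hmap : (Finset.univ.filter fun i : Fin n => (i : ℕ) ∈ V).map Fin.valEmbedding = V := by
      ext i
      simp only [Finset.mem_map, Finset.mem_filter, Finset.mem_univ, true_and,
        Fin.valEmbedding_apply]
      exact ⟨by rintro ⟨j, hj, rfl⟩; exact hj, fun hi => ⟨⟨i, (h1 i hi).2⟩, hi, rfl⟩⟩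
    have hmem : (⟨x, hx⟩ : Fin n) ∈ Finset.univ.filter fun i : Fin n => (i : ℕ) ∈ V := by
      simpa using h2
    refine ⟨Finset.univ.filter fun i : Fin n => (i : ℕ) ∈ V, by simpa using ⟨_, hmem⟩, ?_⟩
    have hcard : (Finset.univ.filter fun i : Fin n => (i : ℕ) ∈ V).card = k + 1 := by
      rw [← h3, ← Finset.card_map Fin.valEmbedding, hmap]
    have hmin : (Finset.univ.filter fun i : Fin n => (i : ℕ) ∈ V).min' ⟨_, hmem⟩ = ⟨x, hx⟩ :=
      le_antisymm (Finset.min'_le _ _ hmem) (Finset.le_min' _ _ _ fun i hi =>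
        (h1 i (Finset.mem_filter.1 hi).2).1)
    rw [hmap, hcard, hmin]
    rfl
  · intro W hW
    exact hfg W _ (Finset.min'_mem _ _) fun w hw => Finset.min'_le W w hw

lemma sum_range_sum_Ico_sub (n : ℕ) (h : ℕ → ℝ) :
    ∑ x ∈ range n, ∑ y ∈ Ico x n, h (y - x) = ∑ e ∈ range n, ((n - e : ℕ) : ℝ) * h e := by
  have h1 : ∀ x ∈ range n, ∑ y ∈ Ico x n, h (y - x) = ∑ e ∈ range (n - x), h e := by
    intro x _
    rw [Finset.sum_Ico_eq_sum_range]
    exact Finset.sum_congr rfl fun e _ => by rw [Nat.add_sub_cancel_left]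
  rw [Finset.sum_congr rfl h1,
    Finset.sum_comm' (t' := range n) (s' := fun e => range (n - e))]
  · refine Finset.sum_congr rfl fun e _ => ?_
    rw [Finset.sum_const, Finset.card_range, nsmul_eq_mul]
  · intro x e
    simp only [Finset.mem_range]
    omega

/-- The sum over all cyclic interval partitions, as a coefficient. -/
theorem sum_blockProd_intervalPartition (n : ℕ) (r κ : ℕ → ℝ) :
    ∑ W : Finset (Fin n) with W.Nonempty, κ W.card * blockProd r (intervalPartition W)
      = ∑ k ∈ range n, κ (k + 1) *
        PowerSeries.coeff n (momentSeries r ^ k * euler (momentSeries r)) := by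
  rw [sum_nonempty_eq_sum_subsetsFrom n
    (fun x V => κ V.card * (r (n - (V.sup id - x)) * gapProd r x V))]
  · rw [Finset.sum_comm]
    refine Finset.sum_congr rfl fun k _ => ?_
    have h1 : ∀ x ∈ range n, ∑ V ∈ subsetsFrom x n (k + 1),
        κ V.card * (r (n - (V.sup id - x)) * gapProd r x V) = κ (k + 1) * ∑ y ∈ Ico x n,
          r (n - (y - x)) * PowerSeries.coeff (y - x) (momentSeries r ^ k) := by
      intro x hx
      rw [← sum_subsetsFrom_gapProd r (fun y => r (n - (y - x))) (Finset.mem_range.1 hx) k,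
        Finset.mul_sum]
      refine Finset.sum_congr rfl fun V hV => ?_
      rw [(mem_subsetsFrom.1 hV).2.2]
    -- The spread `e` between first and last element of `W` can start at `n - e` places; this factor
    -- with `r (n - e)` is a coefficient of `X R'`.
    rw [Finset.sum_congr rfl h1, ← Finset.mul_sum, sum_range_sum_Ico_sub n
      (fun e => r (n - e) * PowerSeries.coeff e (momentSeries r ^ k)), PowerSeries.coeff_mul,
      Finset.Nat.sum_antidiagonal_eq_sum_range_succ
        (fun a b => PowerSeries.coeff a (momentSeries r ^ k) *
          PowerSeries.coeff b (euler (momentSeries r))), Finset.sum_range_succ]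
    congr 1
    rw [Nat.sub_self, coeff_euler, Nat.cast_zero, zero_mul, mul_zero, add_zero]
    refine Finset.sum_congr rfl fun e he => ?_
    have he := Finset.mem_range.1 he
    rw [coeff_euler, coeff_momentSeries _ (by omega)]
    ring
  · intro W x hx hxW
    have hW : W.Nonempty := ⟨x, hx⟩
    have hsup : (W.map Fin.valEmbedding).sup id = (W.max' hW : Fin n) := by
      refine le_antisymm (Finset.sup_le fun i hi => ?_)
        (Finset.le_sup (f := id) (Finset.mem_map_of_mem Fin.valEmbedding (Finset.max'_mem W hW)))
      obtain ⟨w, hw, rfl⟩ := Finset.mem_map.1 hi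
      exact Finset.le_max' W w hw
    rw [Finset.card_map, hsup, blockProd_intervalPartition r hx (Finset.max'_mem W hW) hxW
      fun w hw => Finset.le_max' W w hw]

lemma sum_blockProd_intervalPartition_eq_coeff (n : ℕ) (r κ : ℕ → ℝ) :
    ∑ W : Finset (Fin n) with W.Nonempty, κ W.card * blockProd r (intervalPartition W)
      = PowerSeries.coeff n (euler (momentSeries r) *
        (PowerSeries.mk fun k => κ (k + 1)).subst (momentSeries r)) := by
  rw [sum_blockProd_intervalPartition, coeff_mul_subst_eq_sum (constantCoeff_momentSeries r)
    (constantCoeff_euler _)]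
  simp

/-! ### First-order perturbation of the moment-cumulant relation -/

/-- The infinitesimal part of a power series over the dual numbers. -/
noncomputable def sndSeries (f : (DualNumber ℝ)⟦X⟧) : ℝ⟦X⟧ :=
  PowerSeries.mk fun n => (PowerSeries.coeff n f).snd

/-- The standard part of a power series over the dual numbers. -/
noncomputable def fstSeries (f : (DualNumber ℝ)⟦X⟧) : ℝ⟦X⟧ :=
  PowerSeries.map (TrivSqZeroExt.fstHom ℝ ℝ ℝ : DualNumber ℝ →+* ℝ) f

lemma coeff_fstSeries (f : (DualNumber ℝ)⟦X⟧) (n : ℕ) :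
    PowerSeries.coeff n (fstSeries f) = (PowerSeries.coeff n f).fst := rfl

lemma coeff_sndSeries (f : (DualNumber ℝ)⟦X⟧) (n : ℕ) :
    PowerSeries.coeff n (sndSeries f) = (PowerSeries.coeff n f).snd :=
  PowerSeries.coeff_mk _ _

lemma sndSeries_mul (f g : (DualNumber ℝ)⟦X⟧) :
    sndSeries (f * g) = fstSeries f * sndSeries g + sndSeries f * fstSeries g := by
  ext n
  rw [coeff_sndSeries, map_add, PowerSeries.coeff_mul, PowerSeries.coeff_mul, PowerSeries.coeff_mul,
    TrivSqZeroExt.snd_sum, ← Finset.sum_add_distrib]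
  refine Finset.sum_congr rfl fun x _ => ?_
  simp only [TrivSqZeroExt.snd_mul, coeff_fstSeries, coeff_sndSeries, smul_eq_mul,
    MulOpposite.smul_eq_mul_unop, MulOpposite.unop_op]

lemma sndSeries_pow_succ (f : (DualNumber ℝ)⟦X⟧) (k : ℕ) :
    sndSeries (f ^ (k + 1)) = ((k : ℝ) + 1) • (fstSeries f ^ k * sndSeries f) := by
  induction k with
  | zero => simp
  | succ k ih =>
    have hp : fstSeries (f ^ (k + 1)) = fstSeries f ^ (k + 1) := map_pow _ _ _
    rw [pow_succ, sndSeries_mul, ih, hp]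
    push_cast
    simp only [PowerSeries.smul_eq_C_mul, map_add, map_one]
    ring

/-- The weights `r + ε s`. -/
noncomputable def dualWeight (r s : ℕ → ℝ) (k : ℕ) : DualNumber ℝ :=
  TrivSqZeroExt.inl (r k) + TrivSqZeroExt.inr (s k)

lemma fst_prod_dualWeight {ι : Type*} (r s : ℕ → ℝ) (P : Finset ι) (c : ι → ℕ) :
    (∏ V ∈ P, dualWeight r s (c V)).fst = ∏ V ∈ P, r (c V) := by
  refine (map_prod (TrivSqZeroExt.fstHom ℝ ℝ ℝ) _ _).trans ?_
  exact Finset.prod_congr rfl fun V _ => by simp [dualWeight]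

lemma snd_prod_dualWeight {ι : Type*} [DecidableEq ι] (r s : ℕ → ℝ) (P : Finset ι) (c : ι → ℕ) :
    (∏ V ∈ P, dualWeight r s (c V)).snd = ∑ V ∈ P, s (c V) * ∏ W ∈ P.erase V, r (c W) := by
  induction P using Finset.induction_on with
  | empty => simp
  | insert a P ha ih =>
    rw [Finset.prod_insert ha, TrivSqZeroExt.snd_mul, ih, fst_prod_dualWeight,
      Finset.sum_insert ha, Finset.erase_insert ha]
    have h1 : ∀ V ∈ P, s (c V) * ∏ W ∈ (insert a P).erase V, r (c W)
        = r (c a) * (s (c V) * ∏ W ∈ P.erase V, r (c W)) := by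
      intro V hV
      have hne : a ≠ V := fun h => ha (h ▸ hV)
      rw [Finset.erase_insert_of_ne hne, Finset.prod_insert fun h => ha (Finset.mem_of_mem_erase h)]
      ring
    rw [Finset.sum_congr rfl h1, ← Finset.mul_sum]
    simp only [dualWeight, TrivSqZeroExt.fst_add, TrivSqZeroExt.fst_inl, TrivSqZeroExt.fst_inr,
      TrivSqZeroExt.snd_add, TrivSqZeroExt.snd_inl, TrivSqZeroExt.snd_inr, smul_eq_mul,
      MulOpposite.smul_eq_mul_unop, MulOpposite.unop_op]
    ring

/-- The infinitesimal moments attached to free cumulants `r` and infinitesimal free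
cumulants `s`. -/
noncomputable def infSum (r s : ℕ → ℝ) (n : ℕ) : ℝ := ∑ π ∈ NC n, blockDeriv r s π

lemma fst_ncSum_dualWeight (r s : ℕ → ℝ) (n : ℕ) : (ncSum (dualWeight r s) n).fst = ncSum r n := by
  rw [ncSum, TrivSqZeroExt.fst_sum]
  exact Finset.sum_congr rfl fun π _ => fst_prod_dualWeight r s π.parts Finset.card

/-- Infinitesimal sums are the `ε`-parts of ordinary ones over the dual numbers, so the functional
equation, valid over any commutative ring, also yields its linearization. -/
lemma snd_ncSum_dualWeight (r s : ℕ → ℝ) (n : ℕ) : (ncSum (dualWeight r s) n).snd = infSum r s n := by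
  rw [ncSum, TrivSqZeroExt.snd_sum]
  exact Finset.sum_congr rfl fun π _ => snd_prod_dualWeight r s π.parts Finset.card

lemma parts_eq_empty (π : SetPartition 0) : π.parts = ∅ := by
  rw [Finset.eq_empty_iff_forall_notMem]
  intro V hV
  obtain ⟨i, -⟩ := π.nonempty_of_mem_parts hV
  exact i.elim0

lemma ncSum_zero {A : Type*} [CommRing A] (r : ℕ → A) : ncSum r 0 = 1 := by
  have h1 : NC 0 = {⊤} := by
    refine Finset.eq_singleton_iff_unique_mem.2 ⟨top_mem_NC 0, fun π _ => Finpartition.ext ?_⟩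
    rw [parts_eq_empty, parts_eq_empty]
  rw [ncSum, h1, Finset.sum_singleton, parts_eq_empty, Finset.prod_empty]

lemma infSum_zero (r s : ℕ → ℝ) : infSum r s 0 = 0 :=
  Finset.sum_eq_zero fun π _ => by rw [blockDeriv, parts_eq_empty, Finset.sum_empty]

lemma ncSeries_eq (r : ℕ → ℝ) :
    ncSeries r = PowerSeries.X * (1 + momentSeries (ncSum r)) := by
  rw [ncSeries]
  congr 1
  ext n
  rcases n with _ | n
  · simp [momentSeries, ncSum_zero]
  · simp [momentSeries, PowerSeries.coeff_one]

lemma hasSubst_ncSeries (r : ℕ → ℝ) : PowerSeries.HasSubst (ncSeries r) :=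
  PowerSeries.HasSubst.of_constantCoeff_zero' (constantCoeff_ncSeries r)

/-- The relation `M(X) = R(X (1 + M(X)))`. -/
lemma momentSeries_ncSum (r : ℕ → ℝ) :
    momentSeries (ncSum r) = (momentSeries r).subst (ncSeries r) := by
  ext n
  rw [coeff_subst_eq_sum (constantCoeff_ncSeries r)]
  rcases Nat.eq_zero_or_pos n with rfl | hn
  · simp [momentSeries]
  · rw [coeff_momentSeries _ hn.ne', ncSum_eq_sum_coeff r hn.ne']
    refine Finset.sum_congr rfl fun k _ => ?_
    rcases Nat.eq_zero_or_pos k with rfl | hk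
    · simp [PowerSeries.coeff_one, hn.ne']
    · rw [coeff_momentSeries _ hk.ne']

/-- The linearization `L(X) = S(X (1 + M(X))) + X L(X) R'(X (1 + M(X)))` of the relation
`M(X) = R(X (1 + M(X)))`. -/
lemma momentSeries_infSum (r s : ℕ → ℝ) :
    momentSeries (infSum r s) = (momentSeries s).subst (ncSeries r)
      + PowerSeries.X * momentSeries (infSum r s) *
        (PowerSeries.derivative ℝ (momentSeries r)).subst (ncSeries r) := by
  have hfst : fstSeries (ncSeries (dualWeight r s)) = ncSeries r := by
    ext n
    rw [coeff_fstSeries]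
    rcases n with _ | n
    · simp [ncSeries]
    · rw [coeff_ncSeries _ n.succ_ne_zero, coeff_ncSeries _ n.succ_ne_zero, fst_ncSum_dualWeight]
  have hsnd : sndSeries (ncSeries (dualWeight r s))
      = PowerSeries.X * momentSeries (infSum r s) := by
    ext n
    rw [coeff_sndSeries]
    rcases n with _ | n
    · simp [ncSeries]
    · rw [coeff_ncSeries _ n.succ_ne_zero, PowerSeries.coeff_succ_X_mul, snd_ncSum_dualWeight,
        Nat.succ_sub_one]
      rcases n with _ | n
      · simp [infSum_zero, constantCoeff_momentSeries]
      · rw [coeff_momentSeries _ n.succ_ne_zero]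
  have hpow : ∀ k, fstSeries (ncSeries (dualWeight r s) ^ k) = ncSeries r ^ k := fun k => by
    rw [← hfst]; exact map_pow _ _ _
  ext n
  rw [map_add, coeff_subst_eq_sum (constantCoeff_ncSeries r),
    coeff_mul_subst_eq_sum (constantCoeff_ncSeries r) (by simp)]
  rcases Nat.eq_zero_or_pos n with rfl | hn
  · simp [momentSeries]
  rw [coeff_momentSeries _ hn.ne', ← snd_ncSum_dualWeight,
    ncSum_eq_sum_coeff _ hn.ne', TrivSqZeroExt.snd_sum]
  have h1 : ∀ k, (dualWeight r s k * PowerSeries.coeff n (ncSeries (dualWeight r s) ^ k)).snd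
      = s k * PowerSeries.coeff n (ncSeries r ^ k)
        + r k * PowerSeries.coeff n (sndSeries (ncSeries (dualWeight r s) ^ k)) := by
    intro k
    rw [TrivSqZeroExt.snd_mul, coeff_sndSeries, ← hpow k, coeff_fstSeries]
    simp only [dualWeight, TrivSqZeroExt.fst_add, TrivSqZeroExt.fst_inl, TrivSqZeroExt.fst_inr,
      TrivSqZeroExt.snd_add, TrivSqZeroExt.snd_inl, TrivSqZeroExt.snd_inr, smul_eq_mul,
      MulOpposite.smul_eq_mul_unop, MulOpposite.unop_op]
    ring
  simp only [h1]
  rw [Finset.sum_add_distrib]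
  congr 1
  · refine Finset.sum_congr rfl fun k _ => ?_
    rcases Nat.eq_zero_or_pos k with rfl | hk
    · simp [PowerSeries.coeff_one, hn.ne']
    · rw [coeff_momentSeries _ hk.ne']
  · rw [Finset.sum_range_succ']
    have h0 : sndSeries (ncSeries (dualWeight r s) ^ 0) = 0 := by
      ext n; rw [coeff_sndSeries, pow_zero, PowerSeries.coeff_one]; split_ifs <;> simp
    rw [h0, map_zero, mul_zero, add_zero]
    refine Finset.sum_congr rfl fun k _ => ?_
    rw [sndSeries_pow_succ, hfst, hsnd, PowerSeries.coeff_derivative, map_smul, coeff_momentSeries _ k.succ_ne_zero, smul_eq_mul]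
    ring

/-- If the infinitesimal free cumulants have generating series `X R'(X) N(R(X))`, then the
infinitesimal moments have generating series `X M'(X) N(M(X))`. -/
theorem momentSeries_infSum_eq {r s : ℕ → ℝ} {N : ℝ⟦X⟧}
    (hs : momentSeries s = euler (momentSeries r) * N.subst (momentSeries r)) :
    momentSeries (infSum r s)
      = euler (momentSeries (ncSum r)) * N.subst (momentSeries (ncSum r)) := by
  set z := ncSeries r with hz
  set M := momentSeries (ncSum r) with hM
  set R := momentSeries r with hR
  set L := momentSeries (infSum r s) with hL
  have hzs : PowerSeries.HasSubst z := hasSubst_ncSeries r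
  have hRs : PowerSeries.HasSubst R :=
    PowerSeries.HasSubst.of_constantCoeff_zero' (constantCoeff_momentSeries r)
  have hMR : M = R.subst z := momentSeries_ncSum r
  have hzM : z = PowerSeries.X * (1 + M) := ncSeries_eq r
  have hθM : euler M = (PowerSeries.derivative ℝ R).subst z * euler z := by
    rw [← euler_subst hzs, ← hMR]
  have hθz : euler z = z + PowerSeries.X * euler M := by
    rw [hzM]
    simp only [euler, Derivation.leibniz, smul_eq_mul, PowerSeries.derivative_X, map_add, mul_one,
      Derivation.map_one_eq_zero, zero_add]
    ring
  have hSz : (momentSeries s).subst z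
      = z * (PowerSeries.derivative ℝ R).subst z * N.subst M := by
    rw [hs, euler, PowerSeries.subst_mul hzs, PowerSeries.subst_mul hzs, PowerSeries.subst_X hzs,
      PowerSeries.subst_comp_subst_apply hRs hzs, ← hMR]
  have hLeq : L = (momentSeries s).subst z
      + PowerSeries.X * L * (PowerSeries.derivative ℝ R).subst z := momentSeries_infSum r s
  have hz0 : z ≠ 0 := by
    intro h
    have h1 := congrArg (PowerSeries.coeff 1) h
    rw [hz, coeff_ncSeries r one_ne_zero, Nat.sub_self, ncSum_zero, map_zero] at h1
    exact one_ne_zero h1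
  -- With `D = R'(z)` and `θ = X d/dX`: `L (1 - X D) = z D N(M)` and `θM (1 - X D) = z D`.
  -- Eliminating `D` gives `z L = z θM N(M)`.
  refine mul_left_cancel₀ hz0 ?_
  rw [hSz] at hLeq
  generalize (PowerSeries.derivative ℝ R).subst z = D at *
  linear_combination (euler z) * hLeq - L * hθz
    - (z * N.subst M + PowerSeries.X * L) * hθM

/-! ### Free cumulants determine moments -/

lemma blockProd_congr {n : ℕ} {u v : ℕ → ℝ} (h : ∀ k, 1 ≤ k → u k = v k) (π : SetPartition n) :
    blockProd u π = blockProd v π :=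
  Finset.prod_congr rfl fun _ hV => h _ (Finset.card_pos.2 (π.nonempty_of_mem_parts hV))

lemma blockDeriv_congr {n : ℕ} {u v u' v' : ℕ → ℝ} (h : ∀ k, 1 ≤ k → u k = v k)
    (h' : ∀ k, 1 ≤ k → u' k = v' k) (π : SetPartition n) :
    blockDeriv u u' π = blockDeriv v v' π := by
  have hpos : ∀ V ∈ π.parts, 1 ≤ V.card := fun V hV =>
    Finset.card_pos.2 (π.nonempty_of_mem_parts hV)
  refine Finset.sum_congr rfl fun V hV => ?_
  rw [h' _ (hpos V hV), Finset.prod_congr rfl fun W hW =>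
    h _ (hpos W (Finset.mem_of_mem_erase hW))]

lemma infSum_congr {u v u' v' : ℕ → ℝ} (h : ∀ k, 1 ≤ k → u k = v k)
    (h' : ∀ k, 1 ≤ k → u' k = v' k) (n : ℕ) : infSum u u' n = infSum v v' n :=
  Finset.sum_congr rfl fun π _ => blockDeriv_congr h h' π

lemma infSum_add (r s t : ℕ → ℝ) (n : ℕ) :
    infSum r (fun k => s k + t k) n = infSum r s n + infSum r t n := by
  simp only [infSum, blockDeriv, add_mul, Finset.sum_add_distrib]

/-- The relation is triangular: size `n` occurs only in the term of `⊤`, with coefficient `1`. -/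
lemma infFreeCumulant_eq_of_infSum {m m' c : ℕ → ℝ}
    (h : ∀ n, 1 ≤ n → m' n = infSum (freeCumulant m) c n) {n : ℕ} (hn : 1 ≤ n) :
    infFreeCumulant m m' n = c n := by
  induction n using Nat.strong_induction_on with
  | _ n ih =>
    have hn0 : n ≠ 0 := by omega
    have h1 := infMoment_eq_sum_infFreeCumulant m m' hn0
    rw [h n hn, infSum, ← Finset.add_sum_erase _ _ (top_mem_NC n),
      ← Finset.add_sum_erase (NC n) _ (top_mem_NC n), blockDeriv_top hn0, blockDeriv_top hn0] at h1
    have h2 : ∑ π ∈ (NC n).erase ⊤, blockDeriv (freeCumulant m) c π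
        = ∑ π ∈ (NC n).erase ⊤, blockDeriv (freeCumulant m) (infFreeCumulant m m') π := by
      refine Finset.sum_congr rfl fun π hπ => Finset.sum_congr rfl fun V hV => ?_
      rw [ih _ (card_lt_of_ne_top (Finset.ne_of_mem_erase hπ) hV)
        (Finset.card_pos.2 (π.nonempty_of_mem_parts hV))]
    linarith

/-- The linear functional on polynomials with prescribed moments. -/
noncomputable def functionalOfMoments (c : ℕ → ℝ) : ℝ[X] →ₗ[ℝ] ℝ :=
  Polynomial.lsum fun n => c n • LinearMap.id

lemma functionalMoment_functionalOfMoments (c : ℕ → ℝ) (n : ℕ) :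
    functionalMoment (functionalOfMoments c) n = c n := by
  rw [functionalMoment, functionalOfMoments, Polynomial.lsum_apply, Polynomial.X_pow_eq_monomial,
    Polynomial.sum_monomial_index _ _ (by simp)]
  simp

lemma functionalMoment_zero {μ' : ℝ[X] →ₗ[ℝ] ℝ} (h : μ' 1 = 0) : functionalMoment μ' 0 = 0 := by
  rw [functionalMoment, pow_zero, h]

lemma measureMoment_zero (μ : Measure ℝ) [IsProbabilityMeasure μ] : measureMoment μ 0 = 1 := by
  simp [measureMoment]

lemma measureMoment_dirac_one (n : ℕ) : measureMoment (Measure.dirac 1) n = 1 := by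
  simp [measureMoment]

/-- Only the moments of `γ` and `μ` are identified; the measures may differ when the moment problem
is indeterminate. -/
lemma measureMoment_eq_of_freeCumulants {μ γ : Measure ℝ} [IsProbabilityMeasure μ]
    [IsProbabilityMeasure γ] (h : ∀ n, 1 ≤ n → freeCumulants γ n = freeCumulants μ n) (n : ℕ) :
    measureMoment γ n = measureMoment μ n := by
  rcases Nat.eq_zero_or_pos n with rfl | hn
  · rw [measureMoment_zero, measureMoment_zero]
  · rw [moment_eq_sum_freeCumulant (measureMoment γ) hn.ne',
      moment_eq_sum_freeCumulant (measureMoment μ) hn.ne']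
    exact Finset.sum_congr rfl fun π _ => blockProd_congr h π

lemma functionalMoment_eq_infSum (μ : Measure ℝ) (μ' : ℝ[X] →ₗ[ℝ] ℝ) {n : ℕ} (hn : n ≠ 0) :
    functionalMoment μ' n = infSum (freeCumulants μ) (infFreeCumulants μ μ') n :=
  infMoment_eq_sum_infFreeCumulant _ _ hn

/-! ### Convolution with an infinitesimal distribution at `δ₁` -/

/-- The contribution of `ν'` to the infinitesimal free cumulants of `(μ, μ') ⊠_B (δ₁, ν')`. -/
noncomputable def cumulantShift (r κ : ℕ → ℝ) (n : ℕ) : ℝ :=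
  ∑ W : Finset (Fin n) with W.Nonempty, κ W.card * blockProd r (intervalPartition W)

lemma momentSeries_cumulantShift (r κ : ℕ → ℝ) : momentSeries (cumulantShift r κ)
    = euler (momentSeries r) * (PowerSeries.mk fun k => κ (k + 1)).subst (momentSeries r) := by
  ext n
  rw [← sum_blockProd_intervalPartition_eq_coeff]
  rcases Nat.eq_zero_or_pos n with rfl | hn
  · rw [PowerSeries.coeff_zero_eq_constantCoeff_apply, constantCoeff_momentSeries]
    refine (Finset.sum_eq_zero fun W hW => ?_).symm
    obtain ⟨i, -⟩ := (Finset.mem_filter.1 hW).2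
    exact i.elim0
  · rw [coeff_momentSeries _ hn.ne', cumulantShift]

lemma isInfFreeMulConv_dirac_one_iff {μ γ : Measure ℝ} {μ' ν' γ' : ℝ[X] →ₗ[ℝ] ℝ} :
    IsInfFreeMulConv μ μ' (Measure.dirac 1) ν' γ γ' ↔
      IsInfDistribution γ γ' ∧ (∀ n, 1 ≤ n → freeCumulants γ n = freeCumulants μ n) ∧
      ∀ n, 1 ≤ n → infFreeCumulants γ γ' n = infFreeCumulants μ μ' n +
        cumulantShift (freeCumulants μ) (infFreeCumulants (Measure.dirac 1) ν') n := by
  have hu1 : freeCumulants (Measure.dirac 1) 1 = 1 := freeCumulant_one_eq measureMoment_dirac_one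
  have hu2 : ∀ k, 2 ≤ k → freeCumulants (Measure.dirac 1) k = 0 := fun k hk =>
    freeCumulant_eq_zero measureMoment_dirac_one hk
  have h1 : ∀ n, 1 ≤ n → ∑ π ∈ NC n, blockProd (freeCumulants μ) π *
      blockProd (freeCumulants (Measure.dirac 1)) (kreweras π) = freeCumulants μ n := by
    intro n hn
    rw [sum_NC_mul_blockProd_kreweras hu1 hu2 (by omega), blockProd_top (by omega)]
  have h2 : ∀ n, 1 ≤ n → ∑ π ∈ NC n,
      (blockDeriv (freeCumulants μ) (infFreeCumulants μ μ') π *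
          blockProd (freeCumulants (Measure.dirac 1)) (kreweras π) +
        blockProd (freeCumulants μ) π *
          blockDeriv (freeCumulants (Measure.dirac 1)) (infFreeCumulants (Measure.dirac 1) ν')
            (kreweras π)) = infFreeCumulants μ μ' n +
        cumulantShift (freeCumulants μ) (infFreeCumulants (Measure.dirac 1) ν') n := by
    intro n hn
    rw [Finset.sum_add_distrib, sum_NC_mul_blockProd_kreweras hu1 hu2 (by omega),
      blockDeriv_top (by omega), sum_NC_blockProd_mul_blockDeriv_kreweras hu1 hu2]
    rfl
  constructor
  · rintro ⟨⟨_, h3, h4, h5⟩, h6, h7⟩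
    exact ⟨⟨h3, h4, h6⟩, fun n hn => (h5 n hn).trans (h1 n hn),
      fun n hn => (h7 n hn).trans (h2 n hn)⟩
  · rintro ⟨⟨h3, h4, h6⟩, h5, h7⟩
    exact ⟨⟨by simp, h3, h4, fun n hn => (h5 n hn).trans (h1 n hn).symm⟩, h6,
      fun n hn => (h7 n hn).trans (h2 n hn).symm⟩

theorem exists_isInfFreeMulConv_dirac_one {μ : Measure ℝ} {μ' : ℝ[X] →ₗ[ℝ] ℝ}
    (hμ : IsInfDistribution μ μ') (ν' : ℝ[X] →ₗ[ℝ] ℝ) :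
    ∃ (γ : Measure ℝ) (γ' : ℝ[X] →ₗ[ℝ] ℝ),
      IsInfFreeMulConv μ μ' (Measure.dirac 1) ν' γ γ' := by
  set c : ℕ → ℝ := fun n => infFreeCumulants μ μ' n +
    cumulantShift (freeCumulants μ) (infFreeCumulants (Measure.dirac 1) ν') n with hc
  have hm := functionalMoment_functionalOfMoments (infSum (freeCumulants μ) c)
  -- Convolution with `δ₁` allows `γ = μ`, and `γ'` is an unconstrained functional apart from `γ' 1
  -- = 0`, so its moments may be prescribed from the desired cumulants.
  refine ⟨μ, functionalOfMoments (infSum (freeCumulants μ) c), isInfFreeMulConv_dirac_one_iff.2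
    ⟨⟨hμ.1, hμ.2, ?_⟩, fun _ _ => rfl, fun n hn => ?_⟩⟩
  · have := hm 0
    rwa [functionalMoment, pow_zero, infSum_zero] at this
  · exact infFreeCumulant_eq_of_infSum (fun k _ => hm k) hn

/-- The infinitesimal moments are linear in the infinitesimal cumulants, so the shift contributes
separately, as `X M' N(M)`. -/
lemma functionalMoment_isInfFreeMulConv_dirac_one {μ γ : Measure ℝ} {μ' ν' γ' : ℝ[X] →ₗ[ℝ] ℝ}
    (h : IsInfFreeMulConv μ μ' (Measure.dirac 1) ν' γ γ') {n : ℕ} (hn : n ≠ 0) :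
    functionalMoment γ' n = functionalMoment μ' n +
      PowerSeries.coeff n (euler (momentSeries (measureMoment μ)) *
        (PowerSeries.mk fun k => infFreeCumulants (Measure.dirac 1) ν' (k + 1)).subst
          (momentSeries (measureMoment μ))) := by
  obtain ⟨-, h1, h2⟩ := isInfFreeMulConv_dirac_one_iff.1 h
  have hM : momentSeries (measureMoment μ) = momentSeries (ncSum (freeCumulants μ)) := by
    ext k
    by_cases hk : k = 0
    · subst hk; simp [constantCoeff_momentSeries]
    · rw [coeff_momentSeries _ hk, coeff_momentSeries _ hk,
        moment_eq_sum_freeCumulant (measureMoment μ) hk]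
      rfl
  rw [functionalMoment_eq_infSum γ γ' hn, infSum_congr h1 h2, infSum_add,
    ← functionalMoment_eq_infSum μ μ' hn, hM,
    ← momentSeries_infSum_eq (momentSeries_cumulantShift _ _), coeff_momentSeries _ hn]

/-! ### The power sums of `λ - 1` -/

lemma rootPowerSums_taylor_one {d : ℕ} {q : ℝ[X]} (hq : IsRealRooted d q) {n : ℕ} (hn : n ≠ 0) :
    PowerSeries.coeff n (rootPowerSums q) = d +
      ∑ k ∈ range n, (n.choose (k + 1) : ℝ) *
        PowerSeries.coeff (k + 1) (rootPowerSums (taylor 1 q)) := by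
  have hqe : q = (q.roots.map fun a => X - C a).prod := by
    have := hq.splits.eq_prod_roots
    rwa [hq.monic.leadingCoeff, C_1, one_mul] at this
  have hte : taylor 1 q = ((q.roots.map fun a => a - 1).map fun a => X - C a).prod := by
    conv_lhs => rw [hqe]
    rw [taylor_apply, Polynomial.multiset_prod_comp, Multiset.map_map, Multiset.map_map]
    congr 1
    refine Multiset.map_congr rfl fun a _ => ?_
    simp only [Function.comp_apply, sub_comp, X_comp, C_comp, C_sub]
    ring
  have htm : (taylor 1 q).Monic := by rw [Polynomial.Monic, leadingCoeff_taylor]; exact hq.monic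
  have hts : (taylor 1 q).Splits := by
    rw [hte]
    refine Polynomial.Splits.multisetProd ?_
    intro f hf
    obtain ⟨a, -, rfl⟩ := Multiset.mem_map.1 hf
    exact Polynomial.Splits.X_sub_C a
  have htr : (taylor 1 q).roots = q.roots.map fun a => a - 1 := by
    rw [hte, Polynomial.roots_multiset_prod_X_sub_C]
  have hcard : (Multiset.card q.roots : ℝ) = d := by
    rw [← hq.splits.natDegree_eq_card_roots, hq.natDegree_eq]
  have hk : ∀ k, PowerSeries.coeff (k + 1) (rootPowerSums (taylor 1 q))
      = (q.roots.map fun a => (a - 1) ^ (k + 1)).sum := fun k => by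
    rw [rootPowerSums_of_splits htm hts k.succ_ne_zero, htr, Multiset.map_map]
    rfl
  -- The constant `1`, summed over the `d` roots, is the leading term `d`.
  have hbin : ∀ a : ℝ, a ^ n = 1 + ∑ k ∈ range n, (n.choose (k + 1) : ℝ) * (a - 1) ^ (k + 1) := by
    intro a
    have := add_pow (a - 1) 1 n
    rw [sub_add_cancel, Finset.sum_range_succ'] at this
    rw [this, add_comm]
    simp [mul_comm]
  rw [rootPowerSums_of_splits hq.monic hq.splits hn]
  simp only [hk, hbin]
  rw [Multiset.sum_map_add, Multiset.map_const', Multiset.sum_replicate, nsmul_eq_mul, mul_one,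
    hcard, Multiset.sum_map_sum]
  simp only [Multiset.sum_map_mul_left]

lemma tendsto_rootPowerSums_div {p : ℕ → ℝ[X]} {μ : Measure ℝ} {μ' : ℝ[X] →ₗ[ℝ] ℝ}
    (hp : ∀ d, 1 ≤ d → IsRealRooted d (p d)) (h : HasInfDistribution p μ μ') {n : ℕ} (hn : n ≠ 0) :
    Tendsto (fun d : ℕ => PowerSeries.coeff n (rootPowerSums (p d)) / d) atTop
      (𝓝 (measureMoment μ n)) := by
  have h1 := (Complex.continuous_re.tendsto _).comp (h.tendsto_moment n)
  rw [Complex.ofReal_re] at h1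
  refine h1.congr' ?_
  filter_upwards [eventually_ge_atTop 1] with d hd
  rw [Function.comp_apply, rootMoment_eq_rootPowerSums (hp d hd).monic d hn, Complex.ofReal_re]

lemma tendsto_rootPowerSums_sub {p : ℕ → ℝ[X]} {μ : Measure ℝ} {μ' : ℝ[X] →ₗ[ℝ] ℝ}
    (hp : ∀ d, 1 ≤ d → IsRealRooted d (p d)) (h : HasInfDistribution p μ μ') {n : ℕ} (hn : n ≠ 0) :
    Tendsto (fun d : ℕ => PowerSeries.coeff n (rootPowerSums (p d)) - d * measureMoment μ n) atTop
      (𝓝 (functionalMoment μ' n)) := by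
  have h1 := (Complex.continuous_re.tendsto _).comp (h.tendsto_infMoment n)
  rw [Complex.ofReal_re] at h1
  refine h1.congr' ?_
  filter_upwards [eventually_ge_atTop 1] with d hd
  have hd0 : (d : ℝ) ≠ 0 := by positivity
  rw [Function.comp_apply, rootMoment_eq_rootPowerSums (hp d hd).monic d hn, ← Complex.ofReal_sub,
    ← Complex.ofReal_natCast, ← Complex.ofReal_mul, Complex.ofReal_re]
  field_simp

/-- The sums of `λ^n - 1` are binomial combinations of power sums of `λ - 1`, and their limits
`ν'(x^n)` are the same combinations of the infinitesimal cumulants, one partition per nonempty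
subset. The system has top coefficient `1` and is inverted by induction. -/
lemma tendsto_rootPowerSums_taylor_one {q : ℕ → ℝ[X]} {ν' : ℝ[X] →ₗ[ℝ] ℝ}
    (hq : ∀ d, 1 ≤ d → IsRealRooted d (q d)) (h : HasInfDistribution q (Measure.dirac 1) ν')
    {n : ℕ} (hn : n ≠ 0) :
    Tendsto (fun d => PowerSeries.coeff n (rootPowerSums (taylor 1 (q d)))) atTop
      (𝓝 (infFreeCumulants (Measure.dirac 1) ν' n)) := by
  induction n using Nat.strong_induction_on with
  | _ n ih =>
    obtain ⟨k, rfl⟩ := Nat.exists_eq_succ_of_ne_zero hn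
    have h1 := tendsto_rootPowerSums_sub hq h hn
    rw [functionalMoment_eq_infSum (Measure.dirac 1) ν' hn, infSum, sum_NC_blockDeriv_delta
      (u := freeCumulants (Measure.dirac 1)) (freeCumulant_one_eq measureMoment_dirac_one)
      (fun k hk => freeCumulant_eq_zero measureMoment_dirac_one hk), Finset.sum_range_succ,
      Nat.choose_self, Nat.cast_one, one_mul] at h1
    have h2 : Tendsto (fun d => ∑ j ∈ range k, ((k + 1).choose (j + 1) : ℝ) *
        PowerSeries.coeff (j + 1) (rootPowerSums (taylor 1 (q d)))) atTop
        (𝓝 (∑ j ∈ range k, ((k + 1).choose (j + 1) : ℝ) *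
          infFreeCumulants (Measure.dirac 1) ν' (j + 1))) := by
      refine tendsto_finsetSum _ fun j hj => (ih (j + 1) ?_ j.succ_ne_zero).const_mul _
      have := Finset.mem_range.1 hj
      omega
    have h3 := h1.sub h2
    rw [add_sub_cancel_left] at h3
    refine h3.congr' ?_
    filter_upwards [eventually_ge_atTop 1] with d hd
    rw [rootPowerSums_taylor_one (hq d hd) hn, Finset.sum_range_succ, measureMoment_dirac_one,
      Nat.choose_self]
    push_cast
    ring

/-! ### Matching the two sides -/

theorem hasInfDistribution_finiteFreeMulConv {p q : ℕ → ℝ[X]}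
    (hp : ∀ d, 1 ≤ d → IsRealRooted d (p d)) (hq : ∀ d, 1 ≤ d → IsRealRooted d (q d))
    {μ γ : Measure ℝ} {μ' ν' γ' : ℝ[X] →ₗ[ℝ] ℝ} (hpμ : HasInfDistribution p μ μ')
    (hqν : HasInfDistribution q (Measure.dirac 1) ν')
    (hγ : IsInfFreeMulConv μ μ' (Measure.dirac 1) ν' γ γ') :
    HasInfDistribution (fun d => finiteFreeMulConv d (p d) (q d)) γ γ' := by
  obtain ⟨hdist, hr, -⟩ := isInfFreeMulConv_dirac_one_iff.1 hγ
  have := hdist.isProbabilityMeasure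
  have := hpμ.isInfDistribution.isProbabilityMeasure
  have hmom := measureMoment_eq_of_freeCumulants hr
  have hmonic : ∀ d, 1 ≤ d → (finiteFreeMulConv d (p d) (q d)).Monic := fun d hd =>
    finiteFreeMulConv_monic (hp d hd).monic (hp d hd).natDegree_eq (hq d hd).monic
      (hq d hd).natDegree_eq
  have hzero : ∀ᶠ d : ℕ in atTop,
      rootMoment d (finiteFreeMulConv d (p d) (q d)) 0 = 1 := by
    filter_upwards [eventually_ge_atTop 1] with d hd
    exact rootMoment_zero (finiteFreeMulConv_natDegree (hp d hd).monic (hp d hd).natDegree_eq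
      (hq d hd).monic (hq d hd).natDegree_eq) (by omega)
  have hinf : ∀ n, n ≠ 0 → Tendsto (fun d : ℕ =>
      PowerSeries.coeff n (rootPowerSums (finiteFreeMulConv d (p d) (q d)))
        - d * measureMoment μ n) atTop (𝓝 (functionalMoment γ' n)) := by
    intro n hn
    have h1 := tendsto_rootPowerSums_finiteFreeMulConv (fun d hd => (hp d hd).monic)
      (fun d hd => (hp d hd).natDegree_eq) (fun d hd => (hq d hd).monic)
      (fun d hd => (hq d hd).natDegree_eq)
      (fun n hn => tendsto_rootPowerSums_div hp hpμ hn)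
      (fun n hn => tendsto_rootPowerSums_taylor_one hq hqν hn) n
    rw [functionalMoment_isInfFreeMulConv_dirac_one hγ hn]
    refine ((tendsto_rootPowerSums_sub hp hpμ hn).add h1).congr fun d => ?_
    ring
  refine ⟨hdist, fun n => ?_, fun n => ?_⟩
  · rcases Nat.eq_zero_or_pos n with rfl | hn
    · rw [measureMoment_zero, Complex.ofReal_one]
      exact tendsto_const_nhds.congr' (hzero.mono fun d hd => hd.symm)
    · rw [hmom]
      -- Convergence of the moments follows from the first-order statement on dividing by `d`.
      have h1 : Tendsto (fun d : ℕ => (d : ℝ)⁻¹ *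
          (PowerSeries.coeff n (rootPowerSums (finiteFreeMulConv d (p d) (q d)))
            - d * measureMoment μ n) + measureMoment μ n) atTop
          (𝓝 (0 * functionalMoment γ' n + measureMoment μ n)) :=
        (tendsto_inv_atTop_nhds_zero_nat.mul (hinf n hn.ne')).add_const _
      rw [zero_mul, zero_add] at h1
      refine ((Complex.continuous_ofReal.tendsto _).comp h1).congr' ?_
      filter_upwards [eventually_ge_atTop 1] with d hd
      have hd0 : (d : ℝ) ≠ 0 := by positivity
      rw [Function.comp_apply, rootMoment_eq_rootPowerSums (hmonic d hd) d hn.ne']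
      congr 1
      field_simp
      ring
  · rcases Nat.eq_zero_or_pos n with rfl | hn
    · rw [functionalMoment_zero hdist.map_one, Complex.ofReal_zero, measureMoment_zero]
      refine tendsto_const_nhds.congr' (hzero.mono fun d hd => ?_)
      dsimp only
      rw [hd, Complex.ofReal_one, sub_self, mul_zero]
    · refine ((Complex.continuous_ofReal.tendsto _).comp (hinf n hn.ne')).congr' ?_
      filter_upwards [eventually_ge_atTop 1] with d hd
      have hd0 : (d : ℝ) ≠ 0 := by positivity
      rw [Function.comp_apply, rootMoment_eq_rootPowerSums (hmonic d hd) d hn.ne', hmom,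
        ← Complex.ofReal_sub, ← Complex.ofReal_natCast, ← Complex.ofReal_mul]
      congr 1
      field_simp

end FiniteFree

theorem mainTheorem11
    (p q : ℕ → Polynomial ℝ)
    (hp : ∀ d : ℕ, 1 ≤ d → FiniteFree.IsRealRooted d (p d))
    (hq : ∀ d : ℕ, 1 ≤ d → FiniteFree.IsRealRooted d (q d))
    (μ ν : MeasureTheory.Measure ℝ)
    (μ' ν' : Polynomial ℝ →ₗ[ℝ] ℝ)
    (hpμ : FiniteFree.HasInfDistribution p μ μ')
    (hqν : FiniteFree.HasInfDistribution q ν ν')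
    (hν : ν = MeasureTheory.Measure.dirac 1) :
    (∃ (γ : MeasureTheory.Measure ℝ) (γ' : Polynomial ℝ →ₗ[ℝ] ℝ),
      FiniteFree.IsInfFreeMulConv μ μ' ν ν' γ γ') ∧
    ∀ (γ : MeasureTheory.Measure ℝ) (γ' : Polynomial ℝ →ₗ[ℝ] ℝ),
      FiniteFree.IsInfFreeMulConv μ μ' ν ν' γ γ' →
      FiniteFree.HasInfDistribution
        (fun d : ℕ => FiniteFree.finiteFreeMulConv d (p d) (q d)) γ γ' := by
  subst hν
  exact ⟨FiniteFree.exists_isInfFreeMulConv_dirac_one hpμ.isInfDistribution ν', fun γ γ' h =>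
    FiniteFree.hasInfDistribution_finiteFreeMulConv hp hq hpμ hqν h⟩
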